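/- **Definitions.** A *stochastic arrival-departure model* $\mathcal G=\langle G,a,b,\mathcal P\rangle$ consists of a finite simple graph $G=(V,E)$, an arrival time $a_v\ge 1$ and a deadline $b_v\ge a_v$ (integers) for every $v\in V$, where $[a_u,b_u]\cap[a_v,b_v]\neq\emptyset$ for every edge $uv\in E$, and, for every $v\in V$, a probability distribution $P_v$ with rational probabilities on $\{a_v,a_v+1,\dots,b_v\}$. The death times $d_v$ are drawn independently, $d_v$ according to $P_v$; the vertex $v$ is alive exactly at the times $a_v,\dots,d_v$, and an edge $uv\in E$ is *available* at time $t$ if $u$ and $v$ are both alive at time $t$. The *instantiation* determined by the death times is the static graph on $V$ of all edges that are available at some time. For an instantiation $I$ let $\Pr(I)$ be its probability and $\mathrm{OPT}(I)$ the maximum size of a matching in $I$. A matching is made over time by matching each of its edges at some time at which that edge is available. Define * $\mathrm{OPT}(\mathcal G)=\sum_I \Pr(I)\,\mathrm{OPT}(I)$, the expected maximum matching size in hindsight; * for an edge $e=uv\in E$ present at time $1$ (that is, $a_u=a_v=1$), $\mathrm{OPT}(\mathcal G\mid e)$, the expectation over the death times of the maximum size of a matching in which $e$ is matched at time $1$;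 * $\mathrm{OPT}(\mathcal G\mid\emptyset)$, the expectation over the death times of the maximum size of a matching in which no edge is matched at time $1$. An instance $\mathcal G$ is given by its adjacency matrix, the numbers $a_v,b_v$ and the tables of the probabilities $P_v(a_v),\dots,P_v(b_v)$ (numerators and denominators), all numbers being written in binary; an instance $(\mathcal G,e)$ contains in addition the endpoints of $e$. A *fully polynomial randomized approximation scheme (FPRAS)* for a function $f\ge 0$ of the instance $Y$ is a single randomized algorithm which, given any instance $Y$ and any rational $\varepsilon>0$ (as a numerator and a denominator in binary), always halts within time polynomial in the size of the input $(Y,\varepsilon)$ and in $1/\varepsilon$, and whose output $g$ satisfies $$(1-\varepsilon)\,f(Y)\le g\le(1+\varepsilon)\,f(Y)$$ with probability at least $\tfrac34$. Algorithms are programs for a random access machine with fair coin tosses, and their running time is measured by the logarithmic cost criterion (every operation costs the bit lengths of the numbers involved). **Theorem.** There is an FPRAS for each of the functions $\mathcal G\mapsto\mathrm{OPT}(\mathcal G)$, $(\mathcal G,e)\mapsto\mathrm{OPT}(\mathcal G\mid e)$ and $\mathcal G\mapsto\mathrm{OPT}(\mathcal G\mid\emptyset)$, where $\mathcal G$ ranges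 over all stochastic arrival-departure models and $e$ over the edges of $\mathcal G$ that are present at time $1$. -/

import Mathlib

/-! ### Randomized programs with a logarithmic-cost measure -/

/-- Arithmetic expressions over natural-number variables and arrays
(variables and arrays are named by natural numbers). -/
inductive RExpr : Type
  | const : ℕ → RExpr
  | var : ℕ → RExpr
  | get : ℕ → RExpr → RExpr
  | add : RExpr → RExpr → RExpr
  | sub : RExpr → RExpr → RExpr
  | mul : RExpr → RExpr → RExpr
  | div : RExpr → RExpr → RExpr

/-- Randomized while-programs on a random access memory. `toss x` stores a fair coin toss
in variable `x`; an expression counts as true when its value is nonzero. -/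
inductive RProg : Type
  | skip : RProg
  | assign : ℕ → RExpr → RProg
  | store : ℕ → RExpr → RExpr → RProg
  | toss : ℕ → RProg
  | seq : RProg → RProg → RProg
  | ite : RExpr → RProg → RProg → RProg
  | loop : RExpr → RProg → RProg

/-- A memory state: the variables, the arrays, and the number of coins tossed so far. -/
structure RState : Type where
  var : ℕ → ℕ
  arr : ℕ → ℕ → ℕ
  coins : ℕ

namespace RExpr

/-- The value of an expression (truncated subtraction, rounded-down division,
`a / 0 = 0`). -/
def eval (s : RState) : RExpr → ℕ
  | const c => c
  | var x => s.var x
  | get A i => s.arr A (i.eval s)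
  | add a b => a.eval s + b.eval s
  | sub a b => a.eval s - b.eval s
  | mul a b => a.eval s * b.eval s
  | div a b => a.eval s / b.eval s

/-- Logarithmic cost of an evaluation: every node of the expression costs one plus the number
of binary digits of the value computed there. Hence the bit lengths of all operands, array
indices and results are charged. -/
def cost (s : RState) : RExpr → ℕ
  | const c => 1 + Nat.size c
  | var x => 1 + Nat.size (s.var x)
  | get A i => 1 + Nat.size ((get A i).eval s) + i.cost s
  | add a b => 1 + Nat.size ((add a b).eval s) + a.cost s + b.cost s
  | sub a b => 1 + Nat.size ((sub a b).eval s) + a.cost s + b.cost s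
  | mul a b => 1 + Nat.size ((mul a b).eval s) + a.cost s + b.cost s
  | div a b => 1 + Nat.size ((div a b).eval s) + a.cost s + b.cost s

end RExpr

namespace RProg

/-- `Exec ω p s s' t`: with the coin sequence `ω`, the program `p` started in state `s` halts
in state `s'` after running time exactly `t`. There is no derivation when `p` does not halt. -/
inductive Exec (ω : ℕ → Bool) : RProg → RState → RState → ℕ → Prop
  | skip (s : RState) : Exec ω skip s s 1
  | assign (s : RState) (x : ℕ) (e : RExpr) :
      Exec ω (assign x e) s { s with var := Function.update s.var x (e.eval s) } (1 + e.cost s)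
  | store (s : RState) (A : ℕ) (i e : RExpr) :
      Exec ω (store A i e) s
        { s with arr :=
            Function.update s.arr A (Function.update (s.arr A) (i.eval s) (e.eval s)) }
        (1 + i.cost s + e.cost s)
  | toss (s : RState) (x : ℕ) :
      Exec ω (toss x) s
        { s with
          var := Function.update s.var x (if ω s.coins = true then 1 else 0),
          coins := s.coins + 1 } 1
  | seq {p q : RProg} {s s' s'' : RState} {t t' : ℕ} :
      Exec ω p s s' t → Exec ω q s' s'' t' → Exec ω (seq p q) s s'' (t + t')
  | ite_true {e : RExpr} {p q : RProg} {s s' : RState} {t : ℕ} :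
      e.eval s ≠ 0 → Exec ω p s s' t → Exec ω (ite e p q) s s' (1 + e.cost s + t)
  | ite_false {e : RExpr} {p q : RProg} {s s' : RState} {t : ℕ} :
      e.eval s = 0 → Exec ω q s s' t → Exec ω (ite e p q) s s' (1 + e.cost s + t)
  | loop_done {e : RExpr} {p : RProg} {s : RState} :
      e.eval s = 0 → Exec ω (loop e p) s s (1 + e.cost s)
  | loop_step {e : RExpr} {p : RProg} {s s' s'' : RState} {t t' : ℕ} :
      e.eval s ≠ 0 → Exec ω p s s' t → Exec ω (loop e p) s' s'' t' →
        Exec ω (loop e p) s s'' (1 + e.cost s + t + t')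

/-- For a fixed coin sequence the final state and the running time are unique. -/
theorem Exec.unique {ω : ℕ → Bool} {p : RProg} {s s₁ s₂ : RState} {t₁ t₂ : ℕ}
    (h₁ : Exec ω p s s₁ t₁) (h₂ : Exec ω p s s₂ t₂) : s₁ = s₂ ∧ t₁ = t₂ := by
  induction h₁ generalizing s₂ t₂ with
  | skip | assign | store | toss => cases h₂; exact ⟨rfl, rfl⟩
  | seq _ _ ih ih' =>
    cases h₂ with
    | seq a b =>
      obtain ⟨rfl, rfl⟩ := ih a
      obtain ⟨rfl, rfl⟩ := ih' b
      exact ⟨rfl, rfl⟩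
  | ite_true h _ ih =>
    cases h₂ with
    | ite_true _ a => obtain ⟨rfl, rfl⟩ := ih a; exact ⟨rfl, rfl⟩
    | ite_false h' _ => exact absurd h' h
  | ite_false h _ ih =>
    cases h₂ with
    | ite_true h' _ => exact absurd h h'
    | ite_false _ a => obtain ⟨rfl, rfl⟩ := ih a; exact ⟨rfl, rfl⟩
  | loop_done h =>
    cases h₂ with
    | loop_done => exact ⟨rfl, rfl⟩
    | loop_step h' => exact absurd h h'
  | loop_step h _ _ ih ih' =>
    cases h₂ with
    | loop_done h' => exact absurd h' h
    | loop_step _ a b =>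
      obtain ⟨rfl, rfl⟩ := ih a
      obtain ⟨rfl, rfl⟩ := ih' b
      exact ⟨rfl, rfl⟩

/-- The initial state: array `0` holds the input, variable `0` its number of entries, and
everything else is zero. -/
def start (input : List ℕ) : RState where
  var x := if x = 0 then input.length else 0
  arr A i := if A = 0 then input.getD i 0 else 0
  coins := 0

end RProg

/-- The size of an input: the total number of binary digits, plus one for each entry. -/
def inputSize (input : List ℕ) : ℕ := (input.map fun x => Nat.size x + 1).sum

/-- The distribution of an infinite sequence of independent fair coin tosses. -/
noncomputable def fairCoins : MeasureTheory.Measure (ℕ → Bool) :=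
  MeasureTheory.Measure.infinitePi fun _ => (PMF.uniformOfFintype Bool).toMeasure

/-- The input given to an approximation scheme: the accuracy `ε` (numerator and denominator)
followed by the encoded instance. -/
def schemeInput (ε : ℚ) (instanceCode : List ℕ) : List ℕ :=
  [ε.num.toNat, ε.den] ++ instanceCode

/-- `HasFPRAS enc f`: there is one randomized program which, on every instance `Y` (encoded as
`enc Y`) and every rational `ε > 0`, always halts within time polynomial in the input size and
`1 / ε`, and whose output, the fraction `(variable 0) / (variable 1)`, lies between
`(1 - ε) f(Y)` and `(1 + ε) f(Y)` with probability at least `3 / 4`. -/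
def HasFPRAS {ι : Type} (enc : ι → List ℕ) (f : ι → ℚ) : Prop :=
  ∃ (p : RProg) (c : ℕ), ∀ (Y : ι) (ε : ℚ), 0 < ε →
    (∀ ω : ℕ → Bool, ∃ (s : RState) (t : ℕ),
      p.Exec ω (RProg.start (schemeInput ε (enc Y))) s t ∧
        (t : ℚ) ≤ c * (inputSize (schemeInput ε (enc Y)) + 1 / ε) ^ c) ∧
    3 / 4 ≤ fairCoins {ω : ℕ → Bool | ∃ (s : RState) (t : ℕ),
      p.Exec ω (RProg.start (schemeInput ε (enc Y))) s t ∧ s.var 1 ≠ 0 ∧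
        (1 - ε) * f Y ≤ (s.var 0 : ℚ) / (s.var 1 : ℚ) ∧
        (s.var 0 : ℚ) / (s.var 1 : ℚ) ≤ (1 + ε) * f Y}

/-! ### The stochastic arrival-departure model -/

/-- A stochastic arrival-departure model with rational probabilities: an underlying graph,
arrival times `a`, deadlines `b`, and for every vertex `v` a distribution `P v` of its death
time on `[a v, b v]`. Endpoints of an edge have intersecting lifetimes. -/
structure ADModel : Type where
  n : ℕ
  graph : SimpleGraph (Fin n)
  a : Fin n → ℕ
  b : Fin n → ℕ
  P : Fin n → ℕ → ℚ
  one_le_a : ∀ v, 1 ≤ a v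
  a_le_b : ∀ v, a v ≤ b v
  lifetimes_meet : ∀ u v, graph.Adj u v → (Set.Icc (a u) (b u) ∩ Set.Icc (a v) (b v)).Nonempty
  P_nonneg : ∀ v t, 0 ≤ P v t
  P_support : ∀ v t, t ∉ Set.Icc (a v) (b v) → P v t = 0
  P_sum : ∀ v, ∑ t ∈ Finset.Icc (a v) (b v), P v t = 1

/-- The maximum size of a matching in a finite graph. -/
noncomputable def maxMatchingSize {V : Type} [Finite V] (I : SimpleGraph V) : ℕ :=
  sSup {k : ℕ | ∃ M : I.Subgraph, M.IsMatching ∧ M.edgeSet.ncard = k}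

namespace ADModel

/-- All possible assignments of death times. -/
def deaths (G : ADModel) : Finset (Fin G.n → ℕ) :=
  Fintype.piFinset fun v => Finset.Icc (G.a v) (G.b v)

/-- The probability of an assignment of death times; different vertices are independent. -/
def deathProb (G : ADModel) (d : Fin G.n → ℕ) : ℚ := ∏ v, G.P v (d v)

/-- The edges available at time `t` when the death times are `d`: a vertex `v` is alive
exactly at the times from `a v` to `d v`. -/
def snapshot (G : ADModel) (d : Fin G.n → ℕ) (t : ℕ) : SimpleGraph (Fin G.n) where
  Adj u v := G.graph.Adj u v ∧ (G.a u ≤ t ∧ t ≤ d u) ∧ (G.a v ≤ t ∧ t ≤ d v)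
  symm := ⟨fun _ _ h => ⟨h.1.symm, h.2.2, h.2.1⟩⟩
  loopless := ⟨fun _ h => h.1.ne rfl⟩

/-- The instantiation determined by the death times `d`: the static graph of all edges that
are available at some time. -/
def instantiation (G : ADModel) (d : Fin G.n → ℕ) : SimpleGraph (Fin G.n) where
  Adj u v := ∃ t, (G.snapshot d t).Adj u v
  symm := ⟨fun _ _ h => h.imp fun _ h => h.symm⟩
  loopless := ⟨fun _ h => h.elim fun _ h => h.ne rfl⟩

open Classical in
/-- The probability that the instantiation `I` is realized. -/
noncomputable def instProb (G : ADModel) (I : SimpleGraph (Fin G.n)) : ℚ :=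
  ∑ d ∈ G.deaths.filter (fun d => G.instantiation d = I), G.deathProb d

open Classical in
/-- The expected size of an optimal matching in hindsight. -/
noncomputable def opt (G : ADModel) : ℚ :=
  ∑ I : SimpleGraph (Fin G.n), G.instProb I * maxMatchingSize I

/-- `M` is a matching, and every edge `e` of `M` is available at the time `τ e` at which it
is matched. -/
def IsTimedMatching (G : ADModel) (d : Fin G.n → ℕ) (M : (G.instantiation d).Subgraph)
    (τ : Sym2 (Fin G.n) → ℕ) : Prop :=
  M.IsMatching ∧ ∀ e ∈ M.edgeSet, e ∈ (G.snapshot d (τ e)).edgeSet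

/-- The expected size of an optimal matching in hindsight, given that the edge `e` is matched
at time `1` (meant for edges both of whose endpoints arrive at time `1`). -/
noncomputable def optGivenEdge (G : ADModel) (e : Sym2 (Fin G.n)) : ℚ :=
  ∑ d ∈ G.deaths, G.deathProb d *
    (sSup {k : ℕ | ∃ (M : (G.instantiation d).Subgraph) (τ : Sym2 (Fin G.n) → ℕ),
      G.IsTimedMatching d M τ ∧ (e ∈ M.edgeSet ∧ τ e = 1) ∧ M.edgeSet.ncard = k} : ℕ)

/-- The expected size of an optimal matching in hindsight, given that no edge is matched at
time `1`. -/
noncomputable def optGivenNone (G : ADModel) : ℚ :=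
  ∑ d ∈ G.deaths, G.deathProb d *
    (sSup {k : ℕ | ∃ (M : (G.instantiation d).Subgraph) (τ : Sym2 (Fin G.n) → ℕ),
      G.IsTimedMatching d M τ ∧ (∀ f ∈ M.edgeSet, τ f ≠ 1) ∧ M.edgeSet.ncard = k} : ℕ)

open Classical in
/-- The encoding of a model: the number of vertices, the adjacency matrix row by row, and for
every vertex `v` the times `a v` and `b v` followed by the table of the probabilities
`P v (a v), …, P v (b v)` as numerators and denominators. -/
noncomputable def encode (G : ADModel) : List ℕ :=
  [G.n] ++
  ((List.finRange G.n).flatMap fun u => (List.finRange G.n).map fun v =>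
    if G.graph.Adj u v then 1 else 0) ++
  (List.finRange G.n).flatMap fun v => [G.a v, G.b v] ++
    (List.range (G.b v + 1 - G.a v)).flatMap fun i =>
      [(G.P v (G.a v + i)).num.toNat, (G.P v (G.a v + i)).den]

end ADModel

/-- A model together with an edge `uv` that is present at time `1`. -/
structure ADModelWithEdge : Type where
  model : ADModel
  u : Fin model.n
  v : Fin model.n
  adj : model.graph.Adj u v
  a_u : model.a u = 1
  a_v : model.a v = 1

namespace ADModelWithEdge

/-- The endpoints of the edge, followed by the encoding of the model. -/
noncomputable def encode (Y : ADModelWithEdge) : List ℕ :=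
  [(Y.u : ℕ), (Y.v : ℕ)] ++ Y.model.encode

/-- The expected size of an optimal matching in hindsight given that the edge `uv` is matched
at time `1`. -/
noncomputable def opt (Y : ADModelWithEdge) : ℚ := Y.model.optGivenEdge s(Y.u, Y.v)

end ADModelWithEdge

/-!
All three quantities are expected sizes of maximum matchings. Since matched edges never conflict
in time, a maximum timed matching for fixed death times is a maximum matching of the static graph
of the edges that are available at some admissible time: at any time for `OPT`, at a time `t ≥ 2`
if nothing is matched at time `1`, and, if `e` is matched at time `1`, the edges that avoid the
endpoints of `e`, with `1` added for `e`. In each case an edge `uv` is available exactly when both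
death times reach a threshold (the later arrival time, or `2`), and the quantity, multiplied by
`D ^ n` for a common denominator `D` of the probabilities, is the `weightedOpt` of an `Instance`
(`weightedOpt_eq_opt`, `weightedOpt_eq_optGivenNone`, `weightedOpt_eq_optGivenEdge`).

Sampling the death times directly does not give a small relative error, because the optimum may be
nonzero with tiny probability only. Instead the event that some edge is available is split by the
last available edge `e` in a fixed order, as in the Karp–Luby estimator for unions. Conditionally on
`e` being available, the death times are still independent and easily sampled; the sample is
weighted by the (exactly computable) weight `edgeW` of this event, and counts only if `e` is the
last available edge. As a graph with an edge has a matching of size `1`, every sample is at most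
`n ^ 3` times the optimum (`Instance.sample_le`), so that polynomially many samples suffice by
Chebyshev's inequality (`fairCoins_estimate`, `Instance.sample_estimate`).

The matching number itself is not computed by a matching algorithm but estimated by algebra: the
rank of the Tutte matrix at a random point over the field with `p` elements is never more than twice
the matching number (`rank_tutteMatrix_le`), and by the Schwartz–Zippel lemma it is equal to it
except with probability `n / p` (`sum_rank_tutteMatrix_ge`). Hence the mean of the sample is twice
the weighted optimum up to a small relative error (`Instance.sum_sample_bounds`). The rank is found
by fraction-free Gaussian elimination modulo `p` (`Sampler.sat_rankProg`). The random choices are the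
mixed-radix digits of one random binary number that is so long that the digits are almost uniform.

The algorithm is an explicit random access program. Its correctness and running time are proved in
a program logic for total correctness, `RProg.Sat`: if all numbers in the memory keep at most `X`
bits and all loops run at most `X` times, then the running time is polynomial in `X`
(`RProg.exists_timeBound_le`), and `X` may be taken polynomial in the input size and `1 / ε`
(`Sampler.room`, `Sampler.bitBound_poly`). The theorem follows from
`Sampler.hasFPRAS_of_weightedOpt`.
-/

/-! ### A program logic for random access programs with time bounds -/

namespace RExpr

/-- A syntactic weight: the number of nodes plus the bit lengths of the constants. -/
def weight : RExpr → ℕ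
  | const c => 1 + Nat.size c
  | var _ => 1
  | get _ i => 1 + i.weight
  | add a b => 1 + a.weight + b.weight
  | sub a b => 1 + a.weight + b.weight
  | mul a b => 1 + a.weight + b.weight
  | div a b => 1 + a.weight + b.weight

/-- Upper bound for the cost of evaluating an expression in a state all of whose entries have
at most `X` bits: there are at most `weight` nodes, each with a value of at most
`weight * (X + 1)` bits. -/
def costBound (e : RExpr) (X : ℕ) : ℕ := e.weight * (e.weight * (X + 1) + 1)

end RExpr

/-- All entries of the memory have at most `X` bits. -/
structure RState.Bounded (X : ℕ) (s : RState) : Prop where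
  var : ∀ x, s.var x < 2 ^ X
  arr : ∀ A i, s.arr A i < 2 ^ X

namespace RExpr

lemma size_eval_le {X : ℕ} {s : RState} (hs : s.Bounded X) (e : RExpr) :
    Nat.size (e.eval s) ≤ e.weight * (X + 1) := by
  induction e with
  | const c => simp only [eval, weight]; nlinarith [Nat.zero_le (c.size * X)]
  | var x => simp only [eval, weight]; have := Nat.size_le.2 (hs.var x); omega
  | get A i _ =>
    simp only [eval, weight]
    have := Nat.size_le.2 (hs.arr A (i.eval s))
    nlinarith [Nat.zero_le (i.weight * (X + 1))]
  | add a b iha ihb =>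
    simp only [eval, weight]
    have h : Nat.size (a.eval s + b.eval s) ≤ Nat.size (a.eval s) + Nat.size (b.eval s) + 1 := by
      rw [Nat.size_le]
      have h1 := Nat.lt_size_self (a.eval s)
      have h2 := Nat.lt_size_self (b.eval s)
      have h3 : 2 ^ (a.eval s).size ≤ 2 ^ ((a.eval s).size + (b.eval s).size) :=
        Nat.pow_le_pow_right (by norm_num) (by omega)
      have h4 : 2 ^ (b.eval s).size ≤ 2 ^ ((a.eval s).size + (b.eval s).size) :=
        Nat.pow_le_pow_right (by norm_num) (by omega)
      rw [pow_succ]; omega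
    nlinarith
  | sub a b iha _ =>
    simp only [eval, weight]
    have : Nat.size (a.eval s - b.eval s) ≤ Nat.size (a.eval s) :=
      Nat.size_le_size (Nat.sub_le _ _)
    nlinarith [Nat.zero_le (b.weight * (X + 1))]
  | mul a b iha ihb =>
    simp only [eval, weight]
    have h : Nat.size (a.eval s * b.eval s) ≤ Nat.size (a.eval s) + Nat.size (b.eval s) := by
      rw [Nat.size_le, pow_add]
      exact Nat.mul_lt_mul'' (Nat.lt_size_self _) (Nat.lt_size_self _)
    nlinarith
  | div a b iha _ =>
    simp only [eval, weight]
    have : Nat.size (a.eval s / b.eval s) ≤ Nat.size (a.eval s) :=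
      Nat.size_le_size (Nat.div_le_self _ _)
    nlinarith [Nat.zero_le (b.weight * (X + 1))]

lemma cost_le {X : ℕ} {s : RState} (hs : s.Bounded X) (e : RExpr) :
    e.cost s ≤ e.costBound X := by
  have key : ∀ e : RExpr, ∀ B, e.weight * (X + 1) ≤ B → e.cost s ≤ e.weight * (B + 1) := by
    intro e
    induction e with
    | const c =>
      intro B hB
      simp only [cost, weight] at *
      nlinarith [Nat.zero_le (c.size * B)]
    | var x =>
      intro B hB
      have := size_eval_le hs (var x)
      simp only [cost, weight, eval] at *; omega
    | get A i ih =>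
      intro B hB
      have h1 := size_eval_le hs (get A i)
      simp only [cost, weight] at *
      have h2 := ih B (by nlinarith)
      nlinarith
    | add a b iha ihb =>
      intro B hB
      have h1 := size_eval_le hs (add a b)
      simp only [cost, weight] at *
      have h2 := iha B (by nlinarith [Nat.zero_le (b.weight * (X + 1))])
      have h3 := ihb B (by nlinarith [Nat.zero_le (a.weight * (X + 1))])
      nlinarith
    | sub a b iha ihb =>
      intro B hB
      have h1 := size_eval_le hs (sub a b)
      simp only [cost, weight] at *
      have h2 := iha B (by nlinarith [Nat.zero_le (b.weight * (X + 1))])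
      have h3 := ihb B (by nlinarith [Nat.zero_le (a.weight * (X + 1))])
      nlinarith
    | mul a b iha ihb =>
      intro B hB
      have h1 := size_eval_le hs (mul a b)
      simp only [cost, weight] at *
      have h2 := iha B (by nlinarith [Nat.zero_le (b.weight * (X + 1))])
      have h3 := ihb B (by nlinarith [Nat.zero_le (a.weight * (X + 1))])
      nlinarith
    | div a b iha ihb =>
      intro B hB
      have h1 := size_eval_le hs (div a b)
      simp only [cost, weight] at *
      have h2 := iha B (by nlinarith [Nat.zero_le (b.weight * (X + 1))])
      have h3 := ihb B (by nlinarith [Nat.zero_le (a.weight * (X + 1))])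
      nlinarith
  exact key e _ le_rfl

end RExpr

namespace RState

/-- Write the value `v` to the variable `x`. -/
def setVar (s : RState) (x v : ℕ) : RState := { s with var := Function.update s.var x v }

/-- Write the value `v` to the entry `i` of the array `A`. -/
def setArr (s : RState) (A i v : ℕ) : RState :=
  { s with arr := Function.update s.arr A (Function.update (s.arr A) i v) }

@[simp] lemma setVar_var (s : RState) (x v y : ℕ) :
    (s.setVar x v).var y = if y = x then v else s.var y := by
  simp [setVar, Function.update_apply]

@[simp] lemma setVar_arr (s : RState) (x v : ℕ) : (s.setVar x v).arr = s.arr := rfl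

@[simp] lemma setVar_coins (s : RState) (x v : ℕ) : (s.setVar x v).coins = s.coins := rfl

@[simp] lemma setArr_var (s : RState) (A i v : ℕ) : (s.setArr A i v).var = s.var := rfl

@[simp] lemma setArr_coins (s : RState) (A i v : ℕ) : (s.setArr A i v).coins = s.coins := rfl

@[simp] lemma setArr_arr (s : RState) (A i v B j : ℕ) :
    (s.setArr A i v).arr B j = if B = A ∧ j = i then v else s.arr B j := by
  simp only [setArr, Function.update_apply]
  by_cases h : B = A <;> simp [h, Function.update_apply]

lemma Bounded.setVar {X : ℕ} {s : RState} (hs : s.Bounded X) (x : ℕ) {v : ℕ} (hv : v < 2 ^ X) :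
    (s.setVar x v).Bounded X :=
  ⟨fun y => by rw [setVar_var]; split_ifs; exacts [hv, hs.var y], hs.arr⟩

lemma Bounded.setArr {X : ℕ} {s : RState} (hs : s.Bounded X) (A i : ℕ) {v : ℕ}
    (hv : v < 2 ^ X) : (s.setArr A i v).Bounded X :=
  ⟨hs.var, fun B j => by rw [setArr_arr]; split_ifs; exacts [hv, hs.arr B j]⟩

end RState

namespace RProg

/-- Whether the program contains an assignment to the variable `y`. -/
def modsVar : RProg → ℕ → Bool
  | skip, _ => false
  | assign x _, y => x == y
  | store _ _ _, _ => false
  | toss x, y => x == y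
  | seq p q, y => p.modsVar y || q.modsVar y
  | ite _ p q, y => p.modsVar y || q.modsVar y
  | loop _ p, y => p.modsVar y

/-- Whether the program contains an assignment to an entry of the array `B`. -/
def modsArr : RProg → ℕ → Bool
  | skip, _ => false
  | assign _ _, _ => false
  | store A _ _, B => A == B
  | toss _, _ => false
  | seq p q, B => p.modsArr B || q.modsArr B
  | ite _ p q, B => p.modsArr B || q.modsArr B
  | loop _ p, B => p.modsArr B

/-- Whether the program contains a coin toss. -/
def tosses : RProg → Bool
  | skip => false
  | assign _ _ => false
  | store _ _ _ => false
  | toss _ => true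
  | seq p q => p.tosses || q.tosses
  | ite _ p q => p.tosses || q.tosses
  | loop _ p => p.tosses

/-- The states `s` and `s'` agree wherever the program `p` does not write. -/
structure Agree (p : RProg) (s s' : RState) : Prop where
  var : ∀ x, p.modsVar x = false → s'.var x = s.var x
  arr : ∀ A, p.modsArr A = false → s'.arr A = s.arr A
  coins : p.tosses = false → s'.coins = s.coins

lemma Agree.refl (p : RProg) (s : RState) : p.Agree s s := ⟨by simp, by simp, by simp⟩

lemma Agree.trans {p : RProg} {s s' s'' : RState} (h : p.Agree s s') (h' : p.Agree s' s'') :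
    p.Agree s s'' :=
  ⟨fun x hx => (h'.var x hx).trans (h.var x hx), fun A hA => (h'.arr A hA).trans (h.arr A hA),
    fun ht => (h'.coins ht).trans (h.coins ht)⟩

lemma Agree.seq {p q : RProg} {s s' s'' : RState} (h : p.Agree s s') (h' : q.Agree s' s'') :
    (seq p q).Agree s s'' := by
  refine ⟨fun x hx => ?_, fun x hx => ?_, fun hx => ?_⟩ <;>
    simp only [modsVar, modsArr, tosses, Bool.or_eq_false_iff] at hx
  · exact (h'.var x hx.2).trans (h.var x hx.1)
  · exact (h'.arr x hx.2).trans (h.arr x hx.1)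
  · exact (h'.coins hx.2).trans (h.coins hx.1)

lemma Exec.agree {ω : ℕ → Bool} {p : RProg} {s s' : RState} {t : ℕ} (h : Exec ω p s s' t) :
    p.Agree s s' := by
  induction h with
  | skip => exact Agree.refl _ _
  | assign s x e =>
    refine ⟨fun y hy => ?_, fun _ _ => rfl, fun _ => rfl⟩
    have : y ≠ x := by rintro rfl; simp [modsVar] at hy
    simp [this]
  | store s A i e =>
    refine ⟨fun _ _ => rfl, fun B hB => ?_, fun _ => rfl⟩
    have : B ≠ A := by rintro rfl; simp [modsArr] at hB
    simp [this]
  | toss s x =>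
    refine ⟨fun y hy => ?_, fun _ _ => rfl, fun h => by simp [tosses] at h⟩
    have : y ≠ x := by rintro rfl; simp [modsVar] at hy
    simp [this]
  | seq _ _ ih ih' => exact ih.seq ih'
  | ite_true _ _ ih =>
    refine ⟨fun x hx => ih.var x ?_, fun x hx => ih.arr x ?_, fun hx => ih.coins ?_⟩ <;>
      simp only [modsVar, modsArr, tosses, Bool.or_eq_false_iff] at hx <;> exact hx.1
  | ite_false _ _ ih =>
    refine ⟨fun x hx => ih.var x ?_, fun x hx => ih.arr x ?_, fun hx => ih.coins ?_⟩ <;>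
      simp only [modsVar, modsArr, tosses, Bool.or_eq_false_iff] at hx <;> exact hx.2
  | loop_done => exact Agree.refl _ _
  | loop_step _ _ _ ih ih' => exact Agree.trans ⟨ih.1, ih.2, ih.3⟩ ih'

/-- Upper bound for the running time of a program all of whose loops run at most `X` times in
states whose entries have at most `X` bits. -/
def timeBound (X : ℕ) : RProg → ℕ
  | skip => 1
  | assign _ e => 1 + e.costBound X
  | store _ i e => 1 + i.costBound X + e.costBound X
  | toss _ => 1
  | seq p q => p.timeBound X + q.timeBound X
  | ite e p q => 1 + e.costBound X + p.timeBound X + q.timeBound X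
  | loop e p => (X + 1) * (1 + e.costBound X + p.timeBound X)

lemma exists_costBound_le (e : RExpr) : ∃ c, ∀ X, e.costBound X ≤ c * (X + 1) ^ c := by
  refine ⟨e.weight * (e.weight + 1) + 1, fun X => ?_⟩
  have h : X + 1 ≤ (X + 1) ^ (e.weight * (e.weight + 1) + 1) :=
    Nat.le_self_pow (by omega) _
  rw [RExpr.costBound]
  calc e.weight * (e.weight * (X + 1) + 1) ≤ e.weight * (e.weight + 1) * (X + 1) := by
        nlinarith [Nat.zero_le (e.weight * X)]
    _ ≤ _ := Nat.mul_le_mul (by omega) h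

lemma exists_timeBound_le (p : RProg) : ∃ c, ∀ X, p.timeBound X ≤ c * (X + 1) ^ c := by
  have one : ∀ c X : ℕ, 1 ≤ 1 * (X + 1) ^ c := fun c X => by
    rw [one_mul]; exact Nat.one_le_pow _ _ (by omega)
  induction p with
  | skip => exact ⟨1, fun X => one 1 X⟩
  | assign x e =>
    obtain ⟨c, hc⟩ := exists_costBound_le e
    refine ⟨1 + c, fun X => ?_⟩
    simp only [timeBound]
    rw [add_mul]
    refine Nat.add_le_add (one _ _) ((hc X).trans ?_)
    exact Nat.mul_le_mul_left _ (Nat.pow_le_pow_right (by omega) (by omega))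
  | store A i e =>
    obtain ⟨c, hc⟩ := exists_costBound_le i
    obtain ⟨d, hd⟩ := exists_costBound_le e
    refine ⟨1 + c + d, fun X => ?_⟩
    simp only [timeBound]
    rw [add_mul, add_mul]
    refine Nat.add_le_add (Nat.add_le_add (one _ _) ((hc X).trans ?_)) ((hd X).trans ?_) <;>
    exact Nat.mul_le_mul_left _ (Nat.pow_le_pow_right (by omega) (by omega))
  | toss => exact ⟨1, fun X => one 1 X⟩
  | seq p q ihp ihq =>
    obtain ⟨c, hc⟩ := ihp
    obtain ⟨d, hd⟩ := ihq
    refine ⟨c + d, fun X => ?_⟩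
    simp only [timeBound]
    rw [add_mul]
    refine Nat.add_le_add ((hc X).trans ?_) ((hd X).trans ?_) <;>
    exact Nat.mul_le_mul_left _ (Nat.pow_le_pow_right (by omega) (by omega))
  | ite e p q ihp ihq =>
    obtain ⟨c, hc⟩ := ihp
    obtain ⟨d, hd⟩ := ihq
    obtain ⟨f, hf⟩ := exists_costBound_le e
    refine ⟨1 + f + c + d, fun X => ?_⟩
    simp only [timeBound]
    rw [add_mul, add_mul, add_mul]
    refine Nat.add_le_add (Nat.add_le_add (Nat.add_le_add (one _ _) ((hf X).trans ?_))
      ((hc X).trans ?_)) ((hd X).trans ?_) <;>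
    exact Nat.mul_le_mul_left _ (Nat.pow_le_pow_right (by omega) (by omega))
  | loop e p ih =>
    obtain ⟨c, hc⟩ := ih
    obtain ⟨f, hf⟩ := exists_costBound_le e
    refine ⟨1 + f + c + 1, fun X => ?_⟩
    simp only [timeBound]
    have h : 1 + e.costBound X + p.timeBound X ≤ (1 + f + c) * (X + 1) ^ (1 + f + c) := by
      rw [add_mul, add_mul]
      refine Nat.add_le_add (Nat.add_le_add (one _ _) ((hf X).trans ?_)) ((hc X).trans ?_) <;>
      exact Nat.mul_le_mul_left _ (Nat.pow_le_pow_right (by omega) (by omega))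
    calc _ ≤ (X + 1) * ((1 + f + c) * (X + 1) ^ (1 + f + c)) := Nat.mul_le_mul_left _ h
      _ = (1 + f + c) * (X + 1) ^ (1 + f + c + 1) := by ring
      _ ≤ _ := Nat.mul_le_mul_right _ (by omega)

/-- Total correctness with a time bound: from the bounded state `s` the program halts within
its time bound, in a bounded state which satisfies `Q` and agrees with `s` wherever the program
does not write. -/
def Sat (ω : ℕ → Bool) (X : ℕ) (p : RProg) (s : RState) (Q : RState → Prop) : Prop :=
  s.Bounded X → ∃ s' t, Exec ω p s s' t ∧ t ≤ p.timeBound X ∧ s'.Bounded X ∧ p.Agree s s' ∧ Q s'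

variable {ω : ℕ → Bool} {X : ℕ} {p q : RProg} {s : RState} {Q R : RState → Prop}

lemma Sat.of_bounded (h : s.Bounded X → Sat ω X p s Q) : Sat ω X p s Q := fun hs => h hs hs

lemma Sat.imp (h : Sat ω X p s R) (hQ : ∀ s', s'.Bounded X → p.Agree s s' → R s' → Q s') :
    Sat ω X p s Q := fun hs => by
  obtain ⟨s', t, h1, h2, h3, h4, h5⟩ := h hs
  exact ⟨s', t, h1, h2, h3, h4, hQ s' h3 h4 h5⟩

lemma Sat.skip (h : Q s) : Sat ω X skip s Q := fun hs =>
  ⟨s, 1, Exec.skip s, le_rfl, hs, Agree.refl _ _, h⟩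

lemma Sat.assign {x : ℕ} {e : RExpr} (hb : e.eval s < 2 ^ X) (h : Q (s.setVar x (e.eval s))) :
    Sat ω X (assign x e) s Q := fun hs =>
  ⟨_, _, Exec.assign s x e, Nat.add_le_add_left (e.cost_le hs) _, hs.setVar x hb,
    (Exec.assign (ω := ω) s x e).agree, h⟩

lemma Sat.store {A : ℕ} {i e : RExpr} (hb : e.eval s < 2 ^ X)
    (h : Q (s.setArr A (i.eval s) (e.eval s))) : Sat ω X (store A i e) s Q := fun hs =>
  ⟨_, _, Exec.store s A i e, Nat.add_le_add (Nat.add_le_add_left (i.cost_le hs) _)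
    (e.cost_le hs), hs.setArr A _ hb, (Exec.store (ω := ω) s A i e).agree, h⟩

lemma Sat.toss {x : ℕ} (hX : 0 < X)
    (h : Q { s.setVar x (if ω s.coins = true then 1 else 0) with coins := s.coins + 1 }) :
    Sat ω X (toss x) s Q := fun hs => by
  refine ⟨_, _, Exec.toss s x, le_rfl, ?_, (Exec.toss (ω := ω) s x).agree, h⟩
  have h2 : 1 < 2 ^ X := Nat.one_lt_two_pow hX.ne'
  have : (if ω s.coins = true then 1 else 0) < 2 ^ X := by split_ifs <;> omega
  exact ⟨(hs.setVar x this).var, hs.arr⟩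

lemma Sat.seq (hp : Sat ω X p s R)
    (hq : ∀ s', s'.Bounded X → p.Agree s s' → R s' → Sat ω X q s' Q) :
    Sat ω X (seq p q) s Q := fun hs => by
  obtain ⟨s', t, h1, h2, h3, h4, h5⟩ := hp hs
  obtain ⟨s'', t', g1, g2, g3, g4, g5⟩ := hq s' h3 h4 h5 h3
  exact ⟨s'', t + t', h1.seq g1, Nat.add_le_add h2 g2, g3, h4.seq g4, g5⟩

lemma Sat.ite {e : RExpr} (ht : e.eval s ≠ 0 → Sat ω X p s Q)
    (hf : e.eval s = 0 → Sat ω X q s Q) : Sat ω X (ite e p q) s Q := fun hs => by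
  by_cases h : e.eval s = 0
  · obtain ⟨s', t, h1, h2, h3, _, h5⟩ := hf h hs
    have := h1.ite_false (p := p) h
    exact ⟨s', _, this, by have := e.cost_le hs; simp only [timeBound]; omega, h3,
      this.agree, h5⟩
  · obtain ⟨s', t, h1, h2, h3, _, h5⟩ := ht h hs
    have := h1.ite_true (q := q) h
    exact ⟨s', _, this, by have := e.cost_le hs; simp only [timeBound]; omega, h3,
      this.agree, h5⟩

/-- The rule for while-loops: `I k` holds after `k` rounds, and there are exactly `N` rounds. -/
lemma Sat.loop {e : RExpr} (I : ℕ → RState → Prop) (N : ℕ) (hN : N ≤ X) (h0 : I 0 s)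
    (hstep : ∀ k < N, ∀ s', s'.Bounded X → (RProg.loop e p).Agree s s' → I k s' →
      e.eval s' ≠ 0 ∧ Sat ω X p s' (I (k + 1)))
    (hend : ∀ s', (RProg.loop e p).Agree s s' → I N s' → e.eval s' = 0) :
    Sat ω X (loop e p) s (I N) := fun hs => by
  have key : ∀ m k, k + m = N → ∀ s', s'.Bounded X → (RProg.loop e p).Agree s s' → I k s' →
      ∃ s'' t, Exec ω (RProg.loop e p) s' s'' t ∧
        t ≤ (m + 1) * (1 + e.costBound X + p.timeBound X) ∧ s''.Bounded X ∧ I N s'' := by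
    intro m
    induction m with
    | zero =>
      rintro k hk s' hs' ha hI
      obtain rfl : k = N := by omega
      exact ⟨s', _, Exec.loop_done (hend s' ha hI), by have := e.cost_le hs'; omega, hs', hI⟩
    | succ m ih =>
      rintro k hk s' hs' ha hI
      obtain ⟨he, hp⟩ := hstep k (by omega) s' hs' ha hI
      obtain ⟨s₁, t₁, h1, h2, h3, h4, h5⟩ := hp hs'
      obtain ⟨s₂, t₂, g1, g2, g3, g4⟩ := ih (k + 1) (by omega) s₁ h3
        (ha.trans ⟨h4.1, h4.2, h4.3⟩) h5
      refine ⟨s₂, _, Exec.loop_step he h1 g1, ?_, g3, g4⟩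
      have := e.cost_le hs'
      rw [add_mul]; omega
  obtain ⟨s'', t, h1, h2, h3, h4⟩ := key N 0 (by omega) s hs (Agree.refl _ _) h0
  refine ⟨s'', t, h1, h2.trans ?_, h3, h1.agree, h4⟩
  exact Nat.mul_le_mul_right _ (by omega)

/-- Run `p` for `i = 0, 1, …` as long as `i` is less than the variable `l`. -/
def forTo (i l : ℕ) (p : RProg) : RProg :=
  seq (assign i (.const 0)) (loop (.sub (.var l) (.var i))
    (seq p (assign i (.add (.var i) (.const 1)))))

/-- The rule for counting loops. The invariant must not depend on the loop variable. -/
lemma Sat.forTo {i l : ℕ} (I : ℕ → RState → Prop) {N : ℕ} (hl : s.var l = N)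
    (hil : i ≠ l := by decide)
    (hpi : p.modsVar i = false := by rfl) (hpl : p.modsVar l = false := by rfl)
    (hN : N ≤ X) (hinv : ∀ k s' v, I k s' → I k (s'.setVar i v)) (h0 : I 0 s)
    (hstep : ∀ k < N, ∀ s', s'.Bounded X → (RProg.forTo i l p).Agree s s' → s'.var i = k → I k s' →
      Sat ω X p s' (I (k + 1))) :
    Sat ω X (RProg.forTo i l p) s (I N) := by
  have h2 : N < 2 ^ X := hN.trans_lt X.lt_two_pow_self
  refine Sat.seq (R := fun s' => I 0 s' ∧ s'.var i = 0) (Sat.assign (by simp [RExpr.eval]) ?_) ?_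
  · exact ⟨hinv _ _ _ h0, by simp [RExpr.eval]⟩
  rintro s₀ hs₀ ha₀ ⟨hI₀, hi₀⟩
  have hml : ∀ s', (RProg.loop (.sub (.var l) (.var i))
      (RProg.seq p (RProg.assign i (.add (.var i) (.const 1))))).Agree s₀ s' → s'.var l = N := by
    intro s' ha'
    rw [ha'.var l (by simp [modsVar, hpl, hil]), ha₀.var l (by simp [modsVar, hil]), hl]
  refine (Sat.loop (fun k s' => I k s' ∧ s'.var i = k) N hN ⟨hI₀, hi₀⟩ ?_ ?_).imp
    (fun s' _ _ h => h.1)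
  · rintro k hk s' hs' ha' ⟨hI', hi'⟩
    refine ⟨by simp only [RExpr.eval, hml s' ha', hi']; omega, ?_⟩
    refine Sat.seq (hstep k hk s' hs' (ha₀.seq ha') hi' hI') fun s₁ _ ha₁ hI₁ => ?_
    have : s₁.var i = k := by rw [ha₁.var i hpi, hi']
    refine Sat.assign (by simp only [RExpr.eval, this]; omega) ⟨hinv _ _ _ hI₁, ?_⟩
    simp [RExpr.eval, this]
  · rintro s' ha' ⟨-, hi'⟩
    simp only [RExpr.eval, hml s' ha', hi']; omega

/-- Assign `e` to the entries `0, …, N - 1` of the array `A`, where `i` is the running index. -/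
def fill (i l A : ℕ) (e : RExpr) : RProg := forTo i l (store A (.var i) e)

lemma Sat.fill {i l A : ℕ} {e : RExpr} {N : ℕ} (f : ℕ → ℕ) (hl : s.var l = N) (hN : N ≤ X)
    (hil : i ≠ l := by decide)
    (hf : ∀ k < N, ∀ s', (RProg.fill i l A e).Agree s s' → s'.var i = k →
      (∀ x < k, s'.arr A x = f x) → e.eval s' = f k ∧ f k < 2 ^ X) :
    Sat ω X (RProg.fill i l A e) s (fun s' => ∀ k < N, s'.arr A k = f k) := by
  refine Sat.forTo (fun k s' => ∀ x < k, s'.arr A x = f x) hl hil rfl rfl hN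
    (fun _ _ _ h => h) (by simp) ?_
  intro k hk s' hs' ha hi hI
  obtain ⟨h1, h2⟩ := hf k hk s' ha hi hI
  refine Sat.store (by rw [h1]; exact h2) fun x hx => ?_
  simp only [RState.setArr_arr, RExpr.eval, hi, h1, true_and]
  split_ifs with h
  · rw [h]
  · exact hI x (by omega)

end RProg

/-! ### Matchings as sets of edges -/

/-- A set of pairwise disjoint edges of `I`. -/
def IsMatchingSet {V : Type} (I : SimpleGraph V) (E : Set (Sym2 V)) : Prop :=
  E ⊆ I.edgeSet ∧ ∀ e ∈ E, ∀ f ∈ E, ∀ v, v ∈ e → v ∈ f → e = f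

lemma SimpleGraph.Subgraph.IsMatching.isMatchingSet {V : Type} {I : SimpleGraph V}
    {M : I.Subgraph} (hM : M.IsMatching) : IsMatchingSet I M.edgeSet := by
  refine ⟨M.edgeSet_subset, fun e he f hf v hve hvf => ?_⟩
  obtain ⟨a, rfl⟩ := Sym2.mem_iff_exists.1 hve
  obtain ⟨b, rfl⟩ := Sym2.mem_iff_exists.1 hvf
  rw [SimpleGraph.Subgraph.mem_edgeSet] at he hf
  rw [(hM he.fst_mem).unique he hf]

lemma IsMatchingSet.exists_subgraph {V : Type} {I : SimpleGraph V} {E : Set (Sym2 V)}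
    (hE : IsMatchingSet I E) : ∃ M : I.Subgraph, M.IsMatching ∧ M.edgeSet = E := by
  let M : I.Subgraph :=
    { verts := {v | ∃ w, s(v, w) ∈ E}
      Adj := fun v w => s(v, w) ∈ E
      adj_sub := fun {v w} h => hE.1 h
      edge_vert := fun {v w} h => ⟨w, h⟩
      symm := ⟨fun v w h => by rwa [Sym2.eq_swap]⟩ }
  refine ⟨M, ?_, ?_⟩
  · rintro v ⟨w, hw⟩
    refine ⟨w, hw, fun w' hw' => ?_⟩
    exact (Sym2.congr_right.1 (hE.2 _ hw _ hw' v (Sym2.mem_mk_left _ _) (Sym2.mem_mk_left _ _))).symm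
  · ext e
    induction e with
    | _ a b => rfl

lemma maxMatchingSize_set_eq {V : Type} [Finite V] (I : SimpleGraph V) :
    {k : ℕ | ∃ M : I.Subgraph, M.IsMatching ∧ M.edgeSet.ncard = k} =
      {k : ℕ | ∃ E, IsMatchingSet I E ∧ E.ncard = k} := by
  ext k
  constructor
  · rintro ⟨M, hM, rfl⟩
    exact ⟨_, hM.isMatchingSet, rfl⟩
  · rintro ⟨E, hE, rfl⟩
    obtain ⟨M, hM, rfl⟩ := hE.exists_subgraph
    exact ⟨M, hM, rfl⟩

lemma bddAbove_ncard {α : Type} [Finite α] (P : Set α → Prop) :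
    BddAbove {k : ℕ | ∃ E, P E ∧ E.ncard = k} := by
  refine ⟨Nat.card α, ?_⟩
  rintro k ⟨E, -, rfl⟩
  exact Set.ncard_le_card E

lemma IsMatchingSet.ncard_le {V : Type} [Finite V] {I : SimpleGraph V} {E : Set (Sym2 V)}
    (hE : IsMatchingSet I E) : E.ncard ≤ maxMatchingSize I := by
  rw [maxMatchingSize, maxMatchingSize_set_eq]
  exact le_csSup (bddAbove_ncard _) ⟨E, hE, rfl⟩

lemma isMatchingSet_empty {V : Type} (I : SimpleGraph V) : IsMatchingSet I ∅ :=
  ⟨Set.empty_subset _, by simp⟩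

lemma exists_isMatchingSet_ncard_eq {V : Type} [Finite V] (I : SimpleGraph V) :
    ∃ E, IsMatchingSet I E ∧ E.ncard = maxMatchingSize I := by
  have h := Nat.sSup_mem (s := {k : ℕ | ∃ E, IsMatchingSet I E ∧ E.ncard = k})
    ⟨0, ∅, isMatchingSet_empty I, by simp⟩ (bddAbove_ncard _)
  rw [maxMatchingSize, maxMatchingSize_set_eq]
  exact h

/-! ### Principal submatrices of skew-symmetric matrices -/

lemma dotProduct_mulVec_of_skew {V F : Type} [Fintype V] [Field F]
    {A : Matrix V V F} (hA : A.transpose = -A)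
    (x y : V → F) :
    dotProduct x (A.mulVec y) = -dotProduct (A.mulVec x) y := by
  rw [Matrix.dotProduct_mulVec, ← Matrix.mulVec_transpose, hA, Matrix.neg_mulVec, neg_dotProduct]

section Skew

variable {V F : Type} [Fintype V] [DecidableEq V] [Field F]

/-- The principal submatrix of `A` with index set `S` is nonsingular. -/
def NondegOn (A : Matrix V V F) (S : Finset V) : Prop :=
  ∀ y : V → F, (∀ i ∉ S, y i = 0) → (∀ i ∈ S, (A.mulVec y) i = 0) → y = 0

/-- The principal submatrix of `A` with index set `S`, extended by the identity matrix. -/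
def Matrix.principal {R : Type} [CommRing R] (A : Matrix V V R) (S : Finset V) : Matrix V V R :=
  Matrix.of fun i j => if i ∈ S ∧ j ∈ S then A i j else if i = j then 1 else 0

lemma nondegOn_iff_det_principal_ne_zero (A : Matrix V V F) (S : Finset V) :
    NondegOn A S ↔ (A.principal S).det ≠ 0 := by
  have hmul : ∀ y : V → F, (∀ i ∉ S, y i = 0) → ∀ i ∈ S,
      ((A.principal S).mulVec y) i = (A.mulVec y) i := by
    intro y hy i hi
    simp only [Matrix.mulVec, dotProduct, Matrix.principal, Matrix.of_apply]
    refine Finset.sum_congr rfl fun j _ => ?_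
    by_cases hj : j ∈ S
    · simp [hi, hj]
    · simp [hy j hj]
  have hmul' : ∀ y : V → F, ∀ i ∉ S, ((A.principal S).mulVec y) i = y i := by
    intro y i hi
    simp [Matrix.mulVec, dotProduct, Matrix.principal, hi]
  rw [Ne, ← Matrix.exists_mulVec_eq_zero_iff]
  constructor
  · rintro h ⟨y, hy, hy0⟩
    have h0 : ∀ i ∉ S, y i = 0 := fun i hi => by rw [← hmul' y i hi, hy0]; rfl
    exact hy (h y h0 fun i hi => by rw [← hmul y h0 i hi, hy0]; rfl)
  · intro h y h0 h1
    by_contra hy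
    refine h ⟨y, hy, ?_⟩
    ext i
    by_cases hi : i ∈ S
    · rw [hmul y h0 i hi, h1 i hi]; rfl
    · rw [hmul' y i hi, h0 i hi]; rfl

lemma NondegOn.card_le_rank {A : Matrix V V F} {S : Finset V} (h : NondegOn A S) :
    S.card ≤ A.rank := by
  have hli : LinearIndependent F fun i : S => A.col i := by
    rw [Fintype.linearIndependent_iff]
    intro g hg i
    let y : V → F := fun v => if hv : v ∈ S then g ⟨v, hv⟩ else 0
    have hy : A.mulVec y = 0 := by
      rw [Matrix.mulVec_eq_sum, ← hg, ← Finset.sum_subset (Finset.subset_univ S), ←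
        Finset.sum_coe_sort S]
      · refine Finset.sum_congr rfl fun j _ => ?_
        simp only [y, j.2, dite_true, op_smul_eq_smul]; rfl
      · intro v _ hv
        simp [y, hv]
    have := h y (fun v hv => by simp [y, hv]) fun v _ => by rw [hy]; rfl
    simpa [y] using congrFun this i
  have h1 := finrank_span_eq_card hli
  rw [Fintype.card_coe] at h1
  rw [← h1, Matrix.rank_eq_finrank_span_cols]
  refine Submodule.finrank_mono (Submodule.span_mono ?_)
  rintro _ ⟨i, rfl⟩
  exact ⟨i, rfl⟩

/-- The rows of a maximal linearly independent set of rows of a skew-symmetric matrix span a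
nonsingular principal submatrix. -/
lemma exists_nondegOn_card_eq_rank {A : Matrix V V F} (hA : A.transpose = -A) :
    ∃ S : Finset V, NondegOn A S ∧ S.card = A.rank := by
  obtain ⟨b, -, -, hspan, hli⟩ := exists_linearIndepOn_extension (K := F) (v := A.row)
    (linearIndepOn_empty F A.row) (Set.empty_subset Set.univ)
  classical
  refine ⟨b.toFinset, ?_, ?_⟩
  · intro y hy hAy
    have hrow : ∀ k, dotProduct (A.row k) y = 0 := by
      intro k
      have hk : A.row k ∈ Submodule.span F (A.row '' b) := hspan ⟨k, trivial, rfl⟩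
      generalize A.row k = r at hk ⊢
      induction hk using Submodule.span_induction with
      | mem x hx =>
        obtain ⟨i, hi, rfl⟩ := hx
        exact hAy i (by simpa using hi)
      | zero => simp
      | add x z _ _ hx hz => rw [add_dotProduct, hx, hz, add_zero]
      | smul c x _ hx => rw [smul_dotProduct, hx, smul_zero]
    have hz : A.mulVec y = 0 := funext hrow
    have hz' : ∑ i, y i • A.row i = 0 := by
      have : Matrix.vecMul y A = 0 := by
        rw [← Matrix.mulVec_transpose, hA, Matrix.neg_mulVec, hz, neg_zero]
      rw [← this, Matrix.vecMul_eq_sum]; rfl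
    have hz2 : ∑ i ∈ b.toFinset, y i • A.row i = 0 := by
      rw [← hz']
      exact Finset.sum_subset (Finset.subset_univ _) fun i _ hi => by rw [hy i hi, zero_smul]
    have := linearIndepOn_iff'.1 hli b.toFinset y (by simp) hz2
    funext i
    by_cases hi : i ∈ b.toFinset
    · exact this i hi
    · exact hy i hi
  · have h1 := finrank_span_eq_card hli
    rw [Set.toFinset_card, ← h1, Matrix.rank_eq_finrank_span_row]
    have h2 : Set.range (fun x : b => A.row x) = A.row '' b := by
      ext; simp
    have h3 : Submodule.span F (Set.range A.row) ≤ Submodule.span F (A.row '' b) := by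
      rw [Submodule.span_le]
      rintro _ ⟨k, rfl⟩
      exact hspan ⟨k, trivial, rfl⟩
    rw [h2, le_antisymm (Submodule.span_mono (Set.image_subset_range _ _)) h3]

/-- The expansion step for a skew-symmetric matrix: a nonsingular principal submatrix stays
nonsingular when the endpoints of a suitable nonzero entry in a given row are removed. -/
lemma NondegOn.exists_erase_pair [NeZero (2 : F)] {A : Matrix V V F} (hA : A.transpose = -A)
    {S : Finset V} (h : NondegOn A S) {s : V} (hs : s ∈ S) :
    ∃ j ∈ S, j ≠ s ∧ A s j ≠ 0 ∧ NondegOn A ((S.erase s).erase j) := by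
  have hdet := (nondegOn_iff_det_principal_ne_zero A S).1 h
  have hskew : ∀ i k, A i k = -A k i := fun i k => by
    have := congrFun (congrFun hA k) i
    simpa [Matrix.transpose_apply] using this
  -- the column `s` of the inverse of the principal submatrix
  obtain ⟨x, hxS, hx⟩ : ∃ x : V → F, (∀ i ∉ S, x i = 0) ∧
      ∀ i ∈ S, (A.mulVec x) i = if i = s then 1 else 0 := by
    have hu : IsUnit (A.principal S).det := isUnit_iff_ne_zero.2 hdet
    set x := (A.principal S)⁻¹.mulVec (Pi.single s 1) with hxdef
    have hBx : (A.principal S).mulVec x = Pi.single s 1 := by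
      rw [hxdef, Matrix.mulVec_mulVec, Matrix.mul_nonsing_inv _ hu, Matrix.one_mulVec]
    have hx0 : ∀ i ∉ S, x i = 0 := by
      intro i hi
      have h1 := congrFun hBx i
      have h2 : i ≠ s := fun h => hi (h ▸ hs)
      simpa [Matrix.mulVec, dotProduct, Matrix.principal, hi, h2] using h1
    refine ⟨x, hx0, fun i hi => ?_⟩
    have h1 := congrFun hBx i
    rw [Pi.single_apply] at h1
    rw [← h1]
    simp only [Matrix.mulVec, dotProduct, Matrix.principal, Matrix.of_apply]
    refine Finset.sum_congr rfl fun j _ => ?_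
    by_cases hj : j ∈ S
    · simp [hi, hj]
    · simp [hx0 j hj]
  have hdot : ∀ y : V → F, (∀ i ∉ S, y i = 0) → dotProduct (A.mulVec x) y = y s := by
    intro y hy
    have : ∀ i, (A.mulVec x) i * y i = if i = s then y s else 0 := by
      intro i
      by_cases hi : i ∈ S
      · rw [hx i hi]; split_ifs with h <;> simp [h]
      · rw [hy i hi, mul_zero, if_neg (by rintro rfl; exact hi hs)]
    simp [dotProduct, this]
  have hxs : x s = 0 := by
    have h1 := dotProduct_mulVec_of_skew hA x x
    rw [dotProduct_comm, hdot x hxS] at h1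
    have h2 : (2 : F) * x s = 0 := by linear_combination h1
    exact (mul_eq_zero.1 h2).resolve_left (NeZero.ne 2)
  obtain ⟨j, -, hj⟩ : ∃ j ∈ Finset.univ, A s j * x j ≠ 0 := by
    apply Finset.exists_ne_zero_of_sum_ne_zero
    have := hx s hs
    rw [if_pos rfl] at this
    change (A.mulVec x) s ≠ 0
    rw [this]; exact one_ne_zero
  have hxj : x j ≠ 0 := right_ne_zero_of_mul hj
  have hjS : j ∈ S := by_contra fun h => hxj (hxS j h)
  have hjs : j ≠ s := fun h => hxj (h ▸ hxs)
  refine ⟨j, hjS, hjs, left_ne_zero_of_mul hj, fun y hy hAy => ?_⟩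
  simp only [Finset.mem_erase, not_and, ne_eq] at hy hAy
  have hyS : ∀ i ∉ S, y i = 0 := fun i hi => hy i fun _ _ => hi
  have hys : y s = 0 := hy s fun _ h => absurd rfl h
  have hyj : y j = 0 := hy j fun h => absurd rfl h
  set α := (A.mulVec y) s
  -- pairing with `x` shows that the coordinate `j` of `A y` vanishes
  have hβ : (A.mulVec y) j = 0 := by
    have h1 := dotProduct_mulVec_of_skew hA x y
    rw [hdot y hyS, hys, neg_zero] at h1
    have h2 : dotProduct x (A.mulVec y) = x j * (A.mulVec y) j := by
      rw [dotProduct, Finset.sum_eq_single j]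
      · intro i _ hij
        by_cases his : i = s
        · rw [his, hxs, zero_mul]
        · by_cases hi : i ∈ S
          · rw [hAy i ⟨hij, his, hi⟩, mul_zero]
          · rw [hxS i hi, zero_mul]
      · simp
    rw [h2] at h1
    exact (mul_eq_zero.1 h1).resolve_left hxj
  have hyx : y - α • x = 0 := by
    refine h _ (fun i hi => by simp [hyS i hi, hxS i hi]) fun i hi => ?_
    rw [Matrix.mulVec_sub, Matrix.mulVec_smul, Pi.sub_apply, Pi.smul_apply, hx i hi]
    by_cases his : i = s
    · subst his; simp [α]
    · by_cases hij : i = j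
      · subst hij; simp [hβ, his]
      · simp [hAy i ⟨hij, his, hi⟩, his]
  have hα : α = 0 := by
    have := congrFun hyx j
    simp only [Pi.sub_apply, Pi.smul_apply, hyj, smul_eq_mul, Pi.zero_apply, zero_sub,
      neg_eq_zero] at this
    exact (mul_eq_zero.1 this).resolve_right hxj
  simpa [hα] using hyx

/-- A nonsingular principal submatrix of a skew-symmetric matrix yields a perfect matching of its
index set by nonzero entries. -/
lemma NondegOn.exists_matching [NeZero (2 : F)] {A : Matrix V V F} (hA : A.transpose = -A)
    {I : SimpleGraph V} (hI : ∀ i j, A i j ≠ 0 → I.Adj i j) {S : Finset V} (h : NondegOn A S) :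
    ∃ E, IsMatchingSet I E ∧ (∀ e ∈ E, ∀ v ∈ e, v ∈ S) ∧ 2 * E.ncard = S.card := by
  induction hn : S.card using Nat.strong_induction_on generalizing S with
  | _ n ih =>
    subst hn
    obtain rfl | ⟨s, hs⟩ := S.eq_empty_or_nonempty
    · exact ⟨∅, isMatchingSet_empty I, by simp, by simp⟩
    obtain ⟨j, hjS, hjs, hAj, hnd⟩ := h.exists_erase_pair hA hs
    have hj' : j ∈ S.erase s := Finset.mem_erase.2 ⟨hjs, hjS⟩
    have hc1 := Finset.card_erase_add_one hs
    have hc2 := Finset.card_erase_add_one hj'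
    obtain ⟨E, hE, hES, hEc⟩ := ih _ (by omega) hnd rfl
    have hmem : ∀ e ∈ E, s ∉ e ∧ j ∉ e := fun e he =>
      ⟨fun h => by simpa using hES e he s h, fun h => by simpa using hES e he j h⟩
    have hnot : s(s, j) ∉ E := fun h => (hmem _ h).1 (Sym2.mem_mk_left _ _)
    have hdisj : ∀ e ∈ E, ∀ v, v ∈ s(s, j) → v ∉ e := by
      intro e he v hv
      rcases Sym2.mem_iff.1 hv with rfl | rfl
      exacts [(hmem e he).1, (hmem e he).2]
    refine ⟨insert s(s, j) E, ⟨?_, ?_⟩, ?_, ?_⟩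
    · exact Set.insert_subset (hI s j hAj) hE.1
    · rintro e (rfl | he) f (rfl | hf) v hve hvf
      · rfl
      · exact absurd hvf (hdisj f hf v hve)
      · exact absurd hve (hdisj e he v hvf)
      · exact hE.2 e he f hf v hve hvf
    · rintro e (rfl | he) v hv
      · rcases Sym2.mem_iff.1 hv with rfl | rfl <;> assumption
      · have := hES e he v hv
        simp only [Finset.mem_erase] at this
        exact this.2.2
    · rw [Set.ncard_insert_of_notMem hnot (Set.toFinite E)]; omega

/-- The rank of a skew-symmetric matrix that is supported on the edges of `I` is at most twice the
size of a maximum matching of `I`. -/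
lemma rank_le_two_mul_maxMatchingSize [NeZero (2 : F)] {A : Matrix V V F}
    (hA : A.transpose = -A) {I : SimpleGraph V} (hI : ∀ i j, A i j ≠ 0 → I.Adj i j) :
    A.rank ≤ 2 * maxMatchingSize I := by
  obtain ⟨S, hS, hc⟩ := exists_nondegOn_card_eq_rank hA
  obtain ⟨E, hE, -, hEc⟩ := hS.exists_matching hA hI
  have := hE.ncard_le
  omega

end Skew

/-! ### The Tutte matrix at a random point -/

open Classical in
/-- The Tutte matrix of a graph on `Fin n`, with the value `z (i, j)` substituted for the variable
of the edge `ij`, where `j < i`. The pairs `(i, j)` are numbered by `finProdFinEquiv`. -/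
noncomputable def tutteMatrix {n : ℕ} {R : Type} [CommRing R] (I : SimpleGraph (Fin n))
    (z : Fin (n * n) → R) : Matrix (Fin n) (Fin n) R :=
  Matrix.of fun i j => if I.Adj i j then
    (if j < i then z (finProdFinEquiv (i, j)) else -z (finProdFinEquiv (j, i))) else 0

lemma tutteMatrix_transpose {n : ℕ} {R : Type} [CommRing R] (I : SimpleGraph (Fin n))
    (z : Fin (n * n) → R) : (tutteMatrix I z).transpose = -tutteMatrix I z := by
  ext i j
  simp only [tutteMatrix, Matrix.transpose_apply, Matrix.of_apply, Matrix.neg_apply]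
  by_cases h : I.Adj i j
  · rcases lt_or_gt_of_ne h.ne with h' | h' <;> simp [h, h.symm, h', h'.not_gt]
  · have h2 : ¬I.Adj j i := fun h' => h h'.symm
    simp [h, h2]

lemma rank_tutteMatrix_le {n : ℕ} {F : Type} [Field F] [NeZero (2 : F)] (I : SimpleGraph (Fin n))
    (z : Fin (n * n) → F) : (tutteMatrix I z).rank ≤ 2 * maxMatchingSize I := by
  refine rank_le_two_mul_maxMatchingSize (tutteMatrix_transpose I z) fun i j h => ?_
  by_contra hI
  simp [tutteMatrix, hI] at h

/-- At the indicator of a matching, the Tutte matrix is nonsingular on the matched vertices. -/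
lemma exists_nondegOn_tutteMatrix {n : ℕ} {F : Type} [Field F] {I : SimpleGraph (Fin n)}
    {E : Set (Sym2 (Fin n))} (hE : IsMatchingSet I E) :
    ∃ (S : Finset (Fin n)) (z : Fin (n * n) → F), S.card = 2 * E.ncard ∧
      NondegOn (tutteMatrix I z) S := by
  classical
  set E' := (Set.toFinite E).toFinset with hE'
  have hmemE : ∀ e, e ∈ E' ↔ e ∈ E := fun e => by simp [hE']
  refine ⟨E'.biUnion Sym2.toFinset, fun k => if s((finProdFinEquiv.symm k).1,
    (finProdFinEquiv.symm k).2) ∈ E then 1 else 0, ?_, ?_⟩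
  · rw [Finset.card_biUnion]
    · rw [Finset.sum_congr rfl (g := fun _ => 2)]
      · rw [Finset.sum_const, smul_eq_mul, mul_comm, hE', ← Set.ncard_eq_toFinset_card]
      · intro e he
        exact Sym2.card_toFinset_of_not_isDiag _
          (I.not_isDiag_of_mem_edgeSet (hE.1 ((hmemE e).1 he)))
    · intro e he f hf hef
      rw [Function.onFun, Finset.disjoint_left]
      intro v hv hv'
      rw [Sym2.mem_toFinset] at hv hv'
      exact hef (hE.2 e ((hmemE e).1 he) f ((hmemE f).1 hf) v hv hv')
  · intro y hy hAy
    funext j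
    by_cases hj : j ∈ E'.biUnion Sym2.toFinset
    swap
    · exact hy j hj
    simp only [Finset.mem_biUnion, Sym2.mem_toFinset, hmemE] at hj
    obtain ⟨e, he, hje⟩ := hj
    obtain ⟨i, rfl⟩ := Sym2.mem_iff_exists.1 hje
    -- the row of the partner `i` of `j` has its only nonzero entry in the column `j`
    have hi : i ∈ E'.biUnion Sym2.toFinset := by
      simp only [Finset.mem_biUnion, Sym2.mem_toFinset, hmemE]
      exact ⟨_, he, Sym2.mem_mk_right _ _⟩
    have h := hAy i hi
    have hadj : I.Adj i j := (hE.1 he : I.Adj j i).symm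
    rw [Matrix.mulVec, dotProduct, Finset.sum_eq_single j] at h
    · have he' : s(i, j) ∈ E := by rwa [Sym2.eq_swap]
      by_cases hij : j < i <;> simpa [tutteMatrix, hadj, he, he', hij] using h
    · intro k _ hk
      have h1 : s(k, i) ∉ E := fun h' => hk (Sym2.congr_left.1
        (hE.2 _ h' _ he i (Sym2.mem_mk_right _ _) (Sym2.mem_mk_right _ _)))
      have h2 : s(i, k) ∉ E := by rwa [Sym2.eq_swap]
      simp [tutteMatrix, h1, h2]
    · simp

lemma totalDegree_det_le {n m : ℕ} {R : Type} [CommRing R]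
    (A : Matrix (Fin n) (Fin n) (MvPolynomial (Fin m) R)) (hA : ∀ i j, (A i j).totalDegree ≤ 1) :
    A.det.totalDegree ≤ n := by
  rw [Matrix.det_apply]
  refine MvPolynomial.totalDegree_finsetSum_le fun σ _ => ?_
  have h : (∏ i, A (σ i) i).totalDegree ≤ n := by
    refine (MvPolynomial.totalDegree_finsetProd _ _).trans ?_
    refine (Finset.sum_le_sum fun i _ => hA _ _).trans ?_
    simp
  exact (MvPolynomial.totalDegree_smul_le _ _).trans h

/-- **Lovász's rank bound**: over the field with `p` elements, the average rank of the Tutte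
matrix at a random point is at least `(1 - n / p)` times twice the size of a maximum matching. -/
lemma sum_rank_tutteMatrix_ge {n p : ℕ} [Fact p.Prime] (I : SimpleGraph (Fin n)) :
    (p : ℚ) ^ (n * n) * (1 - n / p) * (2 * maxMatchingSize I) ≤
      ∑ z : Fin (n * n) → ZMod p, ((tutteMatrix I z).rank : ℚ) := by
  obtain ⟨E, hE, hEc⟩ := exists_isMatchingSet_ncard_eq I
  obtain ⟨S, z₀, hS, hz₀⟩ := exists_nondegOn_tutteMatrix (F := ZMod p) hE
  set B := (tutteMatrix I (MvPolynomial.X (R := ZMod p))).principal S with hB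
  have hev : ∀ z : Fin (n * n) → ZMod p,
      MvPolynomial.eval z B.det = ((tutteMatrix I z).principal S).det := by
    intro z
    rw [RingHom.map_det]
    congr 1
    ext i j
    simp only [hB, Matrix.principal, tutteMatrix, RingHom.mapMatrix_apply, Matrix.map_apply,
      Matrix.of_apply]
    split_ifs <;> simp
  have hne : B.det ≠ 0 := by
    intro h
    have := (nondegOn_iff_det_principal_ne_zero _ _).1 hz₀
    rw [← hev, h, map_zero] at this
    exact this rfl
  have hdeg : B.det.totalDegree ≤ n := by
    refine totalDegree_det_le _ fun i j => ?_
    simp only [hB, Matrix.principal, tutteMatrix, Matrix.of_apply]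
    split_ifs <;> simp [MvPolynomial.totalDegree_neg, MvPolynomial.totalDegree_X]
  have hsz := MvPolynomial.schwartz_zippel_totalDegree hne Finset.univ
  have hp0 : (0 : ℚ) < p := by exact_mod_cast (Fact.out : p.Prime).pos
  classical
  set Z := Finset.univ.filter fun z : Fin (n * n) → ZMod p => MvPolynomial.eval z B.det = 0 with hZ
  have hsz2 : (Z.card : ℚ) ≤ p ^ (n * n) * (n / p) := by
    rw [Fintype.piFinset_univ, Finset.card_univ, ZMod.card] at hsz
    have h1 : ((Z.card : ℚ≥0) : ℚ) / p ^ (n * n) ≤ B.det.totalDegree / p := by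
      exact_mod_cast hsz
    rw [div_le_iff₀ (by positivity)] at h1
    refine h1.trans ?_
    rw [mul_comm]
    have : (B.det.totalDegree : ℚ) ≤ n := by exact_mod_cast hdeg
    gcongr
  have hcard : (Zᶜ.card : ℚ) = p ^ (n * n) - Z.card := by
    rw [Finset.card_compl, Nat.cast_sub (Finset.card_le_univ _)]
    simp [ZMod.card]
  calc (p : ℚ) ^ (n * n) * (1 - n / p) * (2 * maxMatchingSize I)
      ≤ Zᶜ.card * (2 * maxMatchingSize I) := by
        refine mul_le_mul_of_nonneg_right ?_ (by positivity)
        rw [hcard]; linarith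
    _ = ∑ z ∈ Zᶜ, (2 * maxMatchingSize I : ℚ) := by rw [Finset.sum_const, nsmul_eq_mul]
    _ ≤ ∑ z ∈ Zᶜ, ((tutteMatrix I z).rank : ℚ) := by
        refine Finset.sum_le_sum fun z hz => ?_
        have h1 : NondegOn (tutteMatrix I z) S := by
          rw [nondegOn_iff_det_principal_ne_zero, ← hev]
          simpa [hZ] using hz
        have := h1.card_le_rank
        rw [hS, hEc] at this
        exact_mod_cast this
    _ ≤ _ := Finset.sum_le_sum_of_subset_of_nonneg (Finset.subset_univ _) fun _ _ _ => by
        positivity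

/-! ### Last indices and mixed-radix digits -/

/-- `i + 1` for the last `i < m` with `P i`, and `0` if there is none. -/
def lastIdx (P : ℕ → Prop) [DecidablePred P] : ℕ → ℕ
  | 0 => 0
  | m + 1 => if P m then m + 1 else lastIdx P m

lemma lastIdx_le (P : ℕ → Prop) [DecidablePred P] (m : ℕ) : lastIdx P m ≤ m := by
  induction m with
  | zero => rfl
  | succ m ih => rw [lastIdx]; split_ifs <;> omega

lemma lastIdx_eq_succ {P : ℕ → Prop} [DecidablePred P] {m i : ℕ} (h : lastIdx P m = i + 1) :
    i < m ∧ P i ∧ ∀ j, i < j → j < m → ¬P j := by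
  induction m with
  | zero => simp [lastIdx] at h
  | succ m ih =>
    rw [lastIdx] at h
    split_ifs at h with hP
    · obtain rfl : m = i := by omega
      exact ⟨by omega, hP, fun j h1 h2 => by omega⟩
    · obtain ⟨h1, h2, h3⟩ := ih h
      refine ⟨by omega, h2, fun j hj hj' => ?_⟩
      rcases Nat.lt_succ_iff_lt_or_eq.1 hj' with h' | rfl
      exacts [h3 j hj h', hP]

lemma lastIdx_eq_zero {P : ℕ → Prop} [DecidablePred P] {m : ℕ} (h : lastIdx P m = 0) :
    ∀ j < m, ¬P j := by
  induction m with
  | zero => simp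
  | succ m ih =>
    rw [lastIdx] at h
    split_ifs at h with hP
    intro j hj
    rcases Nat.lt_succ_iff_lt_or_eq.1 hj with h' | rfl
    exacts [ih h j h', hP]

/-- Sampling from the integer weights `f 0, …, f (m - 1)`: the outcome that belongs to
`q < f 0 + … + f (m - 1)`, found by comparing `q` with the partial sums. -/
def decode (f : ℕ → ℕ) (m q : ℕ) : ℕ := lastIdx (fun i => ∑ j ∈ Finset.range i, f j ≤ q) m - 1

lemma decode_eq_iff {f : ℕ → ℕ} {m q i : ℕ} (hq : q < ∑ j ∈ Finset.range m, f j) (hi : i < m) :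
    decode f m q = i ↔
      ∑ j ∈ Finset.range i, f j ≤ q ∧ q < ∑ j ∈ Finset.range (i + 1), f j := by
  have hmono : Monotone fun i => ∑ j ∈ Finset.range i, f j := fun a b h =>
    Finset.sum_le_sum_of_subset (Finset.range_mono h)
  rw [decode]
  rcases h : lastIdx (fun i => ∑ j ∈ Finset.range i, f j ≤ q) m with - | k
  · exact absurd (by simp) (lastIdx_eq_zero h 0 (by omega))
  obtain ⟨h1, h2, h3⟩ := lastIdx_eq_succ h
  have h4 : q < ∑ j ∈ Finset.range (k + 1), f j := by
    rcases Nat.lt_or_ge (k + 1) m with h' | h'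
    · exact not_le.1 (h3 _ (by omega) h')
    · rwa [show k + 1 = m by omega]
  rw [Nat.add_sub_cancel]
  constructor
  · rintro rfl; exact ⟨h2, h4⟩
  · rintro ⟨h5, h6⟩
    by_contra hne
    rcases Nat.lt_or_gt_of_ne hne with h' | h'
    · exact absurd (h4.trans_le (hmono (show k + 1 ≤ i by omega))) (by simpa using h5)
    · exact absurd (h6.trans_le (hmono (show i + 1 ≤ k by omega))) (by simpa using h2)

lemma decode_lt {f : ℕ → ℕ} {m q : ℕ} (hq : q < ∑ j ∈ Finset.range m, f j) :
    decode f m q < m := by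
  have hm : 0 < m := Nat.pos_of_ne_zero (by rintro rfl; simp at hq)
  have := lastIdx_le (fun i => ∑ j ∈ Finset.range i, f j ≤ q) m
  rw [decode]; omega

/-- Decoding a uniform vector of numbers produces independent outcomes with the given weights. -/
lemma sum_decode {n : ℕ} (len : Fin n → ℕ) (f : Fin n → ℕ → ℕ) (g : (Fin n → ℕ) → ℚ) :
    ∑ q ∈ Fintype.piFinset fun x => Finset.range (∑ j ∈ Finset.range (len x), f x j),
        g (fun x => decode (f x) (len x) (q x)) =
      ∑ j ∈ Fintype.piFinset fun x => Finset.range (len x), (∏ x, f x (j x) : ℕ) * g j := by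
  rw [← Finset.sum_fiberwise_of_maps_to (t := Fintype.piFinset fun x => Finset.range (len x))
    (g := fun q x => decode (f x) (len x) (q x))]
  · refine Finset.sum_congr rfl fun j hj => ?_
    rw [Fintype.mem_piFinset] at hj
    rw [Finset.sum_congr rfl (g := fun _ => g j) fun q hq => by rw [(Finset.mem_filter.1 hq).2],
      Finset.sum_const, nsmul_eq_mul]
    congr 2
    have : (Fintype.piFinset fun x => Finset.range (∑ j ∈ Finset.range (len x), f x j)).filter
        (fun q => (fun x => decode (f x) (len x) (q x)) = j) =
        Fintype.piFinset fun x => Finset.Ico (∑ k ∈ Finset.range (j x), f x k)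
          (∑ k ∈ Finset.range (j x + 1), f x k) := by
      ext q
      simp only [Finset.mem_filter, Fintype.mem_piFinset, Finset.mem_range, Finset.mem_Ico,
        funext_iff]
      constructor
      · rintro ⟨h1, h2⟩ x
        exact (decode_eq_iff (h1 x) (Finset.mem_range.1 (hj x))).1 (h2 x)
      · intro h
        have h1 : ∀ x, q x < ∑ j ∈ Finset.range (len x), f x j := fun x => (h x).2.trans_le
          (Finset.sum_le_sum_of_subset (Finset.range_mono (Finset.mem_range.1 (hj x))))
        exact ⟨h1, fun x => (decode_eq_iff (h1 x) (Finset.mem_range.1 (hj x))).2 (h x)⟩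
    rw [this, Fintype.card_piFinset]
    refine Finset.prod_congr rfl fun x _ => ?_
    rw [Nat.card_Ico, Finset.sum_range_succ]; omega
  · intro q hq
    rw [Fintype.mem_piFinset] at hq ⊢
    exact fun x => Finset.mem_range.2 (decode_lt (Finset.mem_range.1 (hq x)))

lemma sum_piFinset_succ {n : ℕ} (S : Fin (n + 1) → Finset ℕ) (f : (Fin (n + 1) → ℕ) → ℚ) :
    ∑ q ∈ Fintype.piFinset S, f q =
      ∑ a ∈ S 0, ∑ q ∈ Fintype.piFinset (fun i : Fin n => S i.succ), f (Fin.cons a q) := by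
  rw [← Finset.sum_product']
  refine Finset.sum_nbij' (fun q => (q 0, Fin.tail q)) (fun x => Fin.cons x.1 x.2) ?_ ?_ ?_ ?_ ?_
  · intro q hq
    simp only [Fintype.mem_piFinset, Finset.mem_product] at hq ⊢
    exact ⟨hq 0, fun i => hq i.succ⟩
  · rintro ⟨a, q⟩ hq
    simp only [Fintype.mem_piFinset, Finset.mem_product] at hq ⊢
    exact Fin.cases hq.1 hq.2
  · intro q _; simp
  · rintro ⟨a, q⟩ _; simp
  · intro q _; simp

lemma sum_range_mul (A B : ℕ) (g : ℕ → ℕ → ℚ) :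
    ∑ R ∈ Finset.range (A * B), g (R % A) (R / A) =
      ∑ a ∈ Finset.range A, ∑ b ∈ Finset.range B, g a b := by
  rw [← Finset.sum_product']
  refine Finset.sum_nbij' (fun R => (R % A, R / A)) (fun x => x.1 + A * x.2) ?_ ?_ ?_ ?_ ?_
  · intro R hR
    rw [Finset.mem_range] at hR
    have hA : 0 < A := Nat.pos_of_ne_zero (by rintro rfl; simp at hR)
    simp only [Finset.mem_product, Finset.mem_range]
    exact ⟨Nat.mod_lt _ hA, Nat.div_lt_of_lt_mul hR⟩
  · rintro ⟨a, b⟩ h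
    simp only [Finset.mem_product, Finset.mem_range] at h ⊢
    calc a + A * b < A + A * b := by omega
      _ = A * (b + 1) := by ring
      _ ≤ A * B := Nat.mul_le_mul_left _ h.2
  · intro R _; exact Nat.mod_add_div R A
  · rintro ⟨a, b⟩ h
    simp only [Finset.mem_product, Finset.mem_range] at h
    simp [Nat.add_mul_mod_self_left, Nat.mod_eq_of_lt h.1,
      Nat.add_mul_div_left _ _ (show 0 < A by omega), Nat.div_eq_of_lt h.1]
  · intro R _; rfl

/-- The mixed-radix digits of a uniform number are independent and uniform. -/
lemma sum_digits {m : ℕ} (T : ℕ → ℕ) (Q : ℕ) (F : (Fin m → ℕ) → ℕ → ℚ) :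
    ∑ R ∈ Finset.range ((∏ x ∈ Finset.range m, T x) * Q),
        F (fun x => R / (∏ y ∈ Finset.range x, T y) % T x) (R / ∏ y ∈ Finset.range m, T y) =
      ∑ q ∈ Fintype.piFinset (fun x : Fin m => Finset.range (T x)),
        ∑ r ∈ Finset.range Q, F q r := by
  induction m generalizing T with
  | zero =>
    simp only [Finset.range_zero, Finset.prod_empty, one_mul, Nat.div_one]
    rw [Fintype.piFinset_of_isEmpty, Finset.univ_unique, Finset.sum_singleton]
    refine Finset.sum_congr rfl fun R _ => ?_
    congr 1
    exact Subsingleton.elim _ _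
  | succ m ih =>
    rw [sum_piFinset_succ]
    simp only [Fin.val_zero, Fin.val_succ]
    rw [Finset.prod_range_succ', mul_comm _ (T 0), mul_assoc]
    have h := sum_range_mul (T 0) ((∏ k ∈ Finset.range m, T (k + 1)) * Q) fun a b =>
      F (Fin.cons a fun x : Fin m => b / (∏ y ∈ Finset.range x, T (y + 1)) % T (x + 1))
        (b / ∏ y ∈ Finset.range m, T (y + 1))
    refine Eq.trans ?_ (h.trans ?_)
    · refine Finset.sum_congr rfl fun R _ => ?_
      rw [Nat.div_div_eq_div_mul]
      congr 1
      funext x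
      refine Fin.cases ?_ (fun x => ?_) x
      · simp
      · simp only [Fin.val_succ, Fin.cons_succ]
        rw [Finset.prod_range_succ', mul_comm _ (T 0), Nat.div_div_eq_div_mul]
    · refine Finset.sum_congr rfl fun a _ => ?_
      exact ih (fun x => T (x + 1)) fun q r => F (Fin.cons a q) r

/-- Summing a function with period `M` over `R < B`: the error is at most one period. -/
lemma sum_range_bounds_of_periods {f : ℕ → ℚ} (hf : ∀ R, 0 ≤ f R) {M : ℕ} {S : ℚ} (hS : 0 ≤ S)
    (key : ∀ Q : ℕ, ∑ R ∈ Finset.range (M * Q), f R = Q * S) (B : ℕ) :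
    ((B : ℚ) - M) * S ≤ M * ∑ R ∈ Finset.range B, f R ∧
      M * ∑ R ∈ Finset.range B, f R ≤ ((B : ℚ) + M) * S := by
  rcases Nat.eq_zero_or_pos M with h0 | hpos
  · have : S = 0 := by simpa [h0, eq_comm] using key 1
    simp [this, h0]
  have h1 : M * (B / M) ≤ B := Nat.mul_div_le B M
  have h2 : B ≤ M * (B / M + 1) := by
    have := Nat.lt_mul_div_succ B hpos; omega
  have h1' : (M : ℚ) * (B / M : ℕ) ≤ B := by exact_mod_cast h1
  have h2' : (B : ℚ) ≤ M * ((B / M : ℕ) + 1) := by exact_mod_cast h2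
  have hsub : ∀ {a b : ℕ}, a ≤ b → ∑ R ∈ Finset.range a, f R ≤ ∑ R ∈ Finset.range b, f R := fun h =>
    Finset.sum_le_sum_of_subset_of_nonneg (Finset.range_mono h) fun _ _ _ => hf _
  have h3 := hsub h1
  have h4 := hsub h2
  rw [key] at h3 h4
  push_cast at h4
  constructor
  · calc _ ≤ (M * (B / M : ℕ) : ℚ) * S := by gcongr; linarith
      _ = M * ((B / M : ℕ) * S) := by ring
      _ ≤ _ := by gcongr
  · calc _ ≤ (M : ℚ) * (((B / M : ℕ) + 1) * S) := by gcongr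
      _ = (M * (B / M : ℕ) + M) * S := by ring
      _ ≤ _ := by gcongr

/-! ### The estimator and its mean -/

/-- The data on which the estimator works: vertices `0, …, n - 1`; the death time of `x` is
`a x + i` with probability `w x i / D`, where `i < len x`; an edge `kl` (present if `G k l = 1`)
is available if both of its endpoints live until time `thr k l`; `p` is the size of the field for
the Tutte matrix. -/
structure Instance where
  n : ℕ
  D : ℕ
  p : ℕ
  a : ℕ → ℕ
  len : ℕ → ℕ
  w : ℕ → ℕ → ℕ
  G : ℕ → ℕ → ℕ
  thr : ℕ → ℕ → ℕ
  sum_w : ∀ x < n, ∑ i ∈ Finset.range (len x), w x i = D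
  G_self : ∀ k, G k k = 0
  G_symm : ∀ k < n, ∀ l < n, G k l = G l k
  thr_symm : ∀ k < n, ∀ l < n, thr k l = thr l k
  p_prime : p.Prime
  two_lt_p : 2 < p

/-- Extension of a vector by zeros. -/
def extendZero (n : ℕ) (j : Fin n → ℕ) (x : ℕ) : ℕ := if h : x < n then j ⟨x, h⟩ else 0

lemma extendZero_fin {n : ℕ} (j : Fin n → ℕ) (x : Fin n) : extendZero n j x = j x := by
  simp [extendZero]

namespace Instance

variable (c : Instance)

instance : Fact c.p.Prime := ⟨c.p_prime⟩

instance : NeZero (2 : ZMod c.p) := ⟨by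
  intro h
  have : ((2 : ℕ) : ZMod c.p) = 0 := by exact_mod_cast h
  rw [ZMod.natCast_eq_zero_iff] at this
  exact absurd (Nat.le_of_dvd (by norm_num) this) (by have := c.two_lt_p; omega)⟩

/-- `1` if the edge `kl` exists and is available for the death times `d`, and `0` otherwise. -/
def avail (d : ℕ → ℕ) (k l : ℕ) : ℕ :=
  c.G k l * (1 - (c.thr k l - d k)) * (1 - (c.thr k l - d l))

lemma avail_ne_zero_iff {d : ℕ → ℕ} {k l : ℕ} :
    c.avail d k l ≠ 0 ↔ c.G k l ≠ 0 ∧ c.thr k l ≤ d k ∧ c.thr k l ≤ d l := by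
  simp only [avail, ne_eq, mul_eq_zero, not_or, and_assoc]
  refine and_congr Iff.rfl (and_congr ?_ ?_) <;> omega

/-- The graph of the edges that are available for the death times `d`. -/
def graph (d : ℕ → ℕ) : SimpleGraph (Fin c.n) where
  Adj k l := k ≠ l ∧ c.avail d k l ≠ 0
  symm := ⟨fun k l h => ⟨h.1.symm, by
    have h2 := h.2
    rw [avail_ne_zero_iff] at h2 ⊢
    rw [c.G_symm l l.2 k k.2, c.thr_symm l l.2 k k.2]
    exact ⟨h2.1, h2.2.2, h2.2.1⟩⟩⟩
  loopless := ⟨fun _ h => h.1 rfl⟩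

/-- The last available edge in a fixed order: `k * n + l + 1` for the edge `kl` with `l < k`, and
`0` if no edge is available. -/
def lastEdge (d : ℕ → ℕ) : ℕ :=
  lastIdx (fun e => c.avail d (e / c.n) (e % c.n) ≠ 0 ∧ e % c.n < e / c.n) (c.n * c.n)

/-- The earliest death time of `x` when the edge `uv` is required to be available. -/
def low (u v x : ℕ) : ℕ := if x = u ∨ x = v then c.thr u v else c.a x

/-- The weights of the death times of `x` that do not make the edge `uv` unavailable. -/
def maskW (u v x i : ℕ) : ℕ := c.w x i * (1 - (c.low u v x - (c.a x + i)))

/-- The total weight of the death times of `x` that do not make the edge `uv` unavailable. -/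
def total (u v x : ℕ) : ℕ := ∑ i ∈ Finset.range (c.len x), c.maskW u v x i

/-- The total weight of the event that `uv` is available, on the first `m` vertices. -/
def edgeW (u v m : ℕ) : ℕ := ∏ x ∈ Finset.range m, c.total u v x

/-- The death time of `x`, sampled conditionally on `uv` being available, from the digit of the
random number `R` that belongs to `x`. If all the weights `maskW` vanish, the value is meaningless,
but then `edgeW u v c.n`, which weights the sample, vanishes as well. -/
def deathAt (u v R x : ℕ) : ℕ :=
  c.a x + decode (c.maskW u v x) (c.len x) (R / c.edgeW u v x % c.total u v x)

/-- The sampled death times of all the vertices. -/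
def death (u v R : ℕ) : ℕ → ℕ := extendZero c.n fun x => c.deathAt u v R x

/-- The sampled point at which the Tutte matrix is evaluated: the digits of `r` in base `p`. -/
def point (r k : ℕ) : ℕ := r / c.p ^ k % c.p

/-- The rank of the Tutte matrix of `graph d` at the point given by `r`. -/
noncomputable def tutteRank (d : ℕ → ℕ) (r : ℕ) : ℕ :=
  (tutteMatrix (c.graph d) fun k => (c.point r k : ZMod c.p)).rank

/-- The contribution of the edge `uv`: the sample counts only if `uv` is the last available
edge. -/
noncomputable def sampleVal (u v R : ℕ) : ℕ :=
  if c.lastEdge (c.death u v R) = u * c.n + v + 1 then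
    c.edgeW u v c.n * c.tutteRank (c.death u v R) (R / c.edgeW u v c.n) else 0

/-- The value of the estimator for the random number `R`. -/
noncomputable def sample (R : ℕ) : ℕ :=
  ∑ e ∈ Finset.range (c.n * c.n),
    if c.G (e / c.n) (e % c.n) ≠ 0 ∧ e % c.n < e / c.n then c.sampleVal (e / c.n) (e % c.n) R else 0

/-- All vectors of indices of death times. -/
def indices : Finset (Fin c.n → ℕ) := Fintype.piFinset fun x => Finset.range (c.len x)

/-- The vector of death times with the given indices. -/
def deathOf (j : Fin c.n → ℕ) : ℕ → ℕ := extendZero c.n fun x => c.a x + j x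

/-- `D ^ n` times the expected size of a maximum matching. -/
noncomputable def weightedOpt : ℚ :=
  ∑ j ∈ c.indices, ((∏ x : Fin c.n, c.w x (j x) : ℕ) : ℚ) * (maxMatchingSize (c.graph (c.deathOf j)) : ℚ)

/-- The part of `weightedOpt` where `e` is the last available edge. -/
noncomputable def weightedOptAt (e : ℕ) : ℚ :=
  ∑ j ∈ c.indices, ((∏ x : Fin c.n, c.w x (j x) : ℕ) : ℚ) * if c.lastEdge (c.deathOf j) = e + 1 then
    (maxMatchingSize (c.graph (c.deathOf j)) : ℚ) else 0

lemma weightedOpt_nonneg : 0 ≤ c.weightedOpt := by unfold weightedOpt; positivity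

lemma weightedOptAt_nonneg (e : ℕ) : 0 ≤ c.weightedOptAt e := by
  unfold weightedOptAt
  refine Finset.sum_nonneg fun j _ => mul_nonneg (by positivity) ?_
  split_ifs <;> positivity

lemma lastEdge_spec {d : ℕ → ℕ} {u v : ℕ} (hv : v < c.n) (h : c.lastEdge d = u * c.n + v + 1) :
    c.avail d u v ≠ 0 ∧ v < u := by
  obtain ⟨h1, h2, -⟩ := lastIdx_eq_succ h
  have hn : 0 < c.n := by omega
  have e1 : (u * c.n + v) / c.n = u := by
    rw [mul_comm, Nat.mul_add_div hn, Nat.div_eq_of_lt hv, add_zero]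
  have e2 : (u * c.n + v) % c.n = v := by
    rw [mul_comm, Nat.mul_add_mod, Nat.mod_eq_of_lt hv]
  rwa [e1, e2] at h2

lemma maxMatchingSize_eq_zero_of_lastEdge {d : ℕ → ℕ} (h : c.lastEdge d = 0) :
    maxMatchingSize (c.graph d) = 0 := by
  obtain ⟨E, hE, hEc⟩ := exists_isMatchingSet_ncard_eq (c.graph d)
  rw [← hEc, Set.ncard_eq_zero, Set.eq_empty_iff_forall_notMem]
  intro e he
  have hmain : ∀ k l : Fin c.n, (c.graph d).Adj k l → ¬ (l < k) := by
    rintro k l ⟨-, hkl⟩ hlt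
    have hn : 0 < c.n := k.pos
    have hb : (k : ℕ) * c.n + l < c.n * c.n := by nlinarith [k.2, l.2]
    have := lastIdx_eq_zero h _ hb
    rw [mul_comm (k : ℕ), Nat.mul_add_div hn, Nat.div_eq_of_lt l.2, Nat.mul_add_mod,
      Nat.mod_eq_of_lt l.2, add_zero] at this
    exact this ⟨hkl, hlt⟩
  induction e with
  | _ k l =>
    have hkl : (c.graph d).Adj k l := hE.1 he
    rcases lt_or_gt_of_ne hkl.ne with h' | h'
    exacts [hmain l k hkl.symm h', hmain k l hkl h']

lemma one_le_maxMatchingSize {d : ℕ → ℕ} {k l : ℕ} (hk : k < c.n) (hl : l < c.n) (hkl : k ≠ l)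
    (h : c.avail d k l ≠ 0) : 1 ≤ maxMatchingSize (c.graph d) := by
  have hE : IsMatchingSet (c.graph d) {s((⟨k, hk⟩ : Fin c.n), (⟨l, hl⟩ : Fin c.n))} := by
    constructor
    · rw [Set.singleton_subset_iff]
      exact ⟨by simpa using hkl, h⟩
    · rintro e rfl f rfl _ _ _; rfl
  simpa using hE.ncard_le

lemma sum_weightedOptAt : c.weightedOpt = ∑ e ∈ Finset.range (c.n * c.n),
    if c.G (e / c.n) (e % c.n) ≠ 0 ∧ e % c.n < e / c.n then c.weightedOptAt e else 0 := by
  have h1 : ∀ e ∈ Finset.range (c.n * c.n), (if c.G (e / c.n) (e % c.n) ≠ 0 ∧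
      e % c.n < e / c.n then c.weightedOptAt e else 0) = c.weightedOptAt e := by
    intro e he
    split_ifs with h
    · rfl
    · symm
      refine Finset.sum_eq_zero fun j _ => ?_
      rw [if_neg, mul_zero]
      intro hl
      obtain ⟨-, h2, -⟩ := lastIdx_eq_succ hl
      rw [avail_ne_zero_iff] at h2
      exact h ⟨h2.1.1, h2.2⟩
  rw [Finset.sum_congr rfl h1]
  unfold weightedOptAt
  rw [Finset.sum_comm, weightedOpt]
  refine Finset.sum_congr rfl fun j _ => ?_
  rw [← Finset.mul_sum]
  congr 1
  rcases h : c.lastEdge (c.deathOf j) with - | e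
  · simp [c.maxMatchingSize_eq_zero_of_lastEdge h]
  · have he := (lastIdx_eq_succ h).1
    rw [Finset.sum_eq_single e]
    · simp
    · intro b _ hb
      rw [if_neg (by omega)]
    · intro h'; exact absurd (Finset.mem_range.2 he) h'

lemma maskW_le (u v x i : ℕ) : c.maskW u v x i ≤ c.w x i := by
  simpa [maskW] using Nat.mul_le_mul_left (c.w x i)
    (show 1 - (c.low u v x - (c.a x + i)) ≤ 1 by omega)

lemma total_le (u v : ℕ) {x : ℕ} (hx : x < c.n) : c.total u v x ≤ c.D :=
  (Finset.sum_le_sum fun i _ => c.maskW_le u v x i).trans (c.sum_w x hx).le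

lemma edgeW_le (u v : ℕ) {m : ℕ} (hm : m ≤ c.n) : c.edgeW u v m ≤ c.D ^ m := by
  rw [edgeW]
  refine (Finset.prod_le_prod' fun x hx => c.total_le u v
    ((Finset.mem_range.1 hx).trans_le hm)).trans ?_
  simp

lemma deathOf_fin (j : Fin c.n → ℕ) (x : Fin c.n) : c.deathOf j x = c.a x + j x :=
  extendZero_fin _ _

lemma maskW_eq_of_le {u v : ℕ} {d : ℕ → ℕ} {x i : ℕ} (hd : d x = c.a x + i)
    (hu : c.thr u v ≤ d u) (hv : c.thr u v ≤ d v) : c.maskW u v x i = c.w x i := by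
  have : c.low u v x - (c.a x + i) = 0 := by
    rw [low]
    split_ifs with h
    · rcases h with rfl | rfl <;> omega
    · omega
  rw [maskW, this]; simp

/-- Conditioning on `uv` being available does not change the weight of the death times for which
`uv` is available. -/
lemma prod_maskW_of_avail {u v : ℕ} (j : Fin c.n → ℕ) (h : c.avail (c.deathOf j) u v ≠ 0) :
    ∏ x : Fin c.n, c.maskW u v x (j x) = ∏ x : Fin c.n, c.w x (j x) := by
  rw [avail_ne_zero_iff] at h
  exact Finset.prod_congr rfl fun x _ => c.maskW_eq_of_le (c.deathOf_fin j x) h.2.1 h.2.2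

lemma avail_of_prod_maskW {u v : ℕ} (hu : u < c.n) (hv : v < c.n) (hG : c.G u v ≠ 0)
    (j : Fin c.n → ℕ) (h : ∏ x : Fin c.n, c.maskW u v x (j x) ≠ 0) :
    c.avail (c.deathOf j) u v ≠ 0 := by
  have h1 : ∀ x : Fin c.n, c.low u v x ≤ c.deathOf j x := by
    intro x
    have h2 := Finset.prod_ne_zero_iff.1 h x (Finset.mem_univ x)
    rw [maskW] at h2
    have := right_ne_zero_of_mul h2
    rw [deathOf_fin]
    omega
  rw [avail_ne_zero_iff]
  exact ⟨hG, by simpa [low] using h1 ⟨u, hu⟩, by simpa [low] using h1 ⟨v, hv⟩⟩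

lemma edgeW_eq_sum (u v : ℕ) :
    c.edgeW u v c.n = ∑ j ∈ c.indices, ∏ x : Fin c.n, c.maskW u v x (j x) := by
  rw [edgeW, Finset.prod_range, indices]
  exact Finset.prod_univ_sum _ _

lemma edgeW_le_weightedOpt {u v : ℕ} (hu : u < c.n) (hv : v < c.n) (huv : v < u)
    (hG : c.G u v ≠ 0) : (c.edgeW u v c.n : ℚ) ≤ c.weightedOpt := by
  rw [edgeW_eq_sum, weightedOpt]
  push_cast
  refine Finset.sum_le_sum fun j _ => ?_
  by_cases h : ∏ x : Fin c.n, c.maskW u v x (j x) = 0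
  · have : (∏ x : Fin c.n, (c.maskW u v x (j x) : ℚ)) = 0 := by exact_mod_cast h
    rw [this]; positivity
  · have h1 := c.avail_of_prod_maskW hu hv hG j h
    have h2 := c.one_le_maxMatchingSize hu hv huv.ne' h1
    have h3 : (∏ x : Fin c.n, (c.maskW u v x (j x) : ℚ)) = ∏ x : Fin c.n, (c.w x (j x) : ℚ) := by
      exact_mod_cast c.prod_maskW_of_avail j h1
    rw [h3]
    exact le_mul_of_one_le_right (by positivity) (by exact_mod_cast h2)

lemma tutteRank_le (d : ℕ → ℕ) (r : ℕ) : c.tutteRank d r ≤ c.n := by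
  exact Matrix.rank_le_width (tutteMatrix (c.graph d) fun k => (c.point r k : ZMod c.p))

/-- A sample exceeds its mean by at most a polynomial factor: the existence of one available edge
already guarantees a matching of size `1`. -/
lemma sample_le (R : ℕ) : (c.sample R : ℚ) ≤ c.n ^ 3 * c.weightedOpt := by
  have h0 := c.weightedOpt_nonneg
  rw [sample]
  push_cast
  calc _ ≤ ∑ e ∈ Finset.range (c.n * c.n), c.weightedOpt * c.n := by
        refine Finset.sum_le_sum fun e he => ?_
        rw [Finset.mem_range] at he
        have hn : 0 < c.n := Nat.pos_of_ne_zero fun h => by simp [h] at he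
        split_ifs with h
        · rw [sampleVal]
          split_ifs
          · push_cast
            have h1 := c.edgeW_le_weightedOpt (Nat.div_lt_of_lt_mul he) (Nat.mod_lt _ hn) h.2 h.1
            have h2 : (c.tutteRank (c.death (e / c.n) (e % c.n) R)
              (R / c.edgeW (e / c.n) (e % c.n) c.n) : ℚ) ≤ c.n := by
              exact_mod_cast c.tutteRank_le _ _
            gcongr
          · positivity
        · positivity
    _ = _ := by rw [Finset.sum_const, Finset.card_range, nsmul_eq_mul]; push_cast; ring

/-- The rank of the Tutte matrix, summed over all evaluation points. -/
noncomputable def rankSum (d : ℕ → ℕ) : ℚ :=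
  ∑ z : Fin (c.n * c.n) → ZMod c.p, ((tutteMatrix (c.graph d) z).rank : ℚ)

lemma rankSum_le (d : ℕ → ℕ) :
    c.rankSum d ≤ (c.p : ℚ) ^ (c.n * c.n) * (2 * maxMatchingSize (c.graph d)) := by
  rw [rankSum]
  refine (Finset.sum_le_sum (g := fun _ => (2 * maxMatchingSize (c.graph d) : ℚ))
    fun z _ => ?_).trans ?_
  · exact_mod_cast rank_tutteMatrix_le (c.graph d) z
  · rw [Finset.sum_const, nsmul_eq_mul, Finset.card_univ]
    simp [ZMod.card]

lemma sum_tutteRank (d : ℕ → ℕ) (Q : ℕ) :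
    ∑ r ∈ Finset.range (c.p ^ (c.n * c.n) * Q), (c.tutteRank d r : ℚ) = Q * c.rankSum d := by
  have h := sum_digits (m := c.n * c.n) (fun _ => c.p) Q fun z _ =>
    ((tutteMatrix (c.graph d) fun k => (z k : ZMod c.p)).rank : ℚ)
  simp only [Finset.prod_const, Finset.card_range, Finset.sum_const, nsmul_eq_mul] at h
  rw [← Finset.mul_sum] at h
  refine h.trans ?_
  congr 1
  have hp := c.p_prime.pos
  have : NeZero c.p := ⟨hp.ne'⟩
  rw [rankSum]
  refine Finset.sum_nbij' (fun z k => (z k : ZMod c.p)) (fun z k => (z k).val) ?_ ?_ ?_ ?_ ?_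
  · simp
  · intro z _
    simp [ZMod.val_lt]
  · intro z hz
    rw [Fintype.mem_piFinset] at hz
    funext k
    exact ZMod.val_cast_of_lt (Finset.mem_range.1 (hz k))
  · intro z _; simp
  · intro z _; rfl

/-- The mean of the contribution of an edge: up to the nonuniformity of the digits and the
failure probability of the Tutte matrix it is twice the part of the weighted optimum where that
edge is the last available one. -/
lemma sum_sampleVal_bounds {u v : ℕ} (hv : v < c.n) {B : ℕ} {η : ℚ}
    (hη : (c.D : ℚ) ^ c.n * c.p ^ (c.n * c.n) ≤ η * B) (hη1 : η ≤ 1) :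
    (1 - η) * (1 - c.n / c.p) * B * (2 * c.weightedOptAt (u * c.n + v)) ≤
      ∑ R ∈ Finset.range B, (c.sampleVal u v R : ℚ) ∧
    ∑ R ∈ Finset.range B, (c.sampleVal u v R : ℚ) ≤
      (1 + η) * B * (2 * c.weightedOptAt (u * c.n + v)) := by
  set W := c.edgeW u v c.n with hW
  set P := c.p ^ (c.n * c.n) with hP
  have hP0 : (0 : ℚ) < P := by
    have := c.p_prime.pos
    positivity
  let e := u * c.n + v
  let ind : (ℕ → ℕ) → ℚ := fun d => if c.lastEdge d = e + 1 then 1 else 0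
  have hind : ∀ d, 0 ≤ ind d := fun d => by simp only [ind]; split_ifs <;> norm_num
  let toD : (Fin c.n → ℕ) → ℕ → ℕ := fun q =>
    c.deathOf fun x => decode (c.maskW u v x) (c.len x) (q x)
  let f : ℕ → ℚ := fun R => ind (c.death u v R) * c.tutteRank (c.death u v R) (R / W)
  let S : ℚ := ∑ q ∈ Fintype.piFinset fun x : Fin c.n => Finset.range (c.total u v x),
    ind (toD q) * c.rankSum (toD q)
  have hval : ∀ R, (c.sampleVal u v R : ℚ) = W * f R := by
    intro R
    simp only [sampleVal, f, ind, e]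
    split_ifs <;> simp [hW]
  have hrs : ∀ d, 0 ≤ c.rankSum d := fun d => by unfold rankSum; positivity
  have hf : ∀ R, 0 ≤ f R := fun R => mul_nonneg (hind _) (by positivity)
  have hS0 : 0 ≤ S := Finset.sum_nonneg fun q _ => mul_nonneg (hind _) (hrs _)
  have key : ∀ Q : ℕ, ∑ R ∈ Finset.range (W * P * Q), f R = Q * S := by
    intro Q
    have h := sum_digits (m := c.n) (c.total u v) (P * Q) fun q r =>
      ind (toD q) * (c.tutteRank (toD q) r : ℚ)
    rw [mul_assoc]
    refine Eq.trans ?_ (h.trans ?_)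
    · rfl
    · rw [Finset.mul_sum]
      refine Finset.sum_congr rfl fun q _ => ?_
      rw [← Finset.mul_sum, hP, sum_tutteRank]; ring
  -- pass from uniform digits to the weights of the death times
  have hdec : ∀ g : (ℕ → ℕ) → ℚ, ∑ q ∈ Fintype.piFinset fun x : Fin c.n =>
      Finset.range (c.total u v x), ind (toD q) * g (toD q) =
      ∑ j ∈ c.indices, ((∏ x : Fin c.n, c.w x (j x) : ℕ) : ℚ) *
        if c.lastEdge (c.deathOf j) = e + 1 then g (c.deathOf j) else 0 := by
    intro g
    refine (sum_decode (fun x : Fin c.n => c.len x) (fun x => c.maskW u v x)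
      fun j => ind (c.deathOf j) * g (c.deathOf j)).trans ?_
    refine Finset.sum_congr rfl fun j _ => ?_
    simp only [ind]
    split_ifs with h
    · rw [c.prod_maskW_of_avail j (c.lastEdge_spec hv h).1, one_mul]
    · simp
  have hSle : S ≤ P * (2 * c.weightedOptAt e) := by
    calc S ≤ ∑ q ∈ Fintype.piFinset fun x : Fin c.n => Finset.range (c.total u v x),
          ind (toD q) * (P * (2 * maxMatchingSize (c.graph (toD q)))) := by
          refine Finset.sum_le_sum fun q _ => mul_le_mul_of_nonneg_left ?_ (hind _)
          have := c.rankSum_le (toD q)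
          rw [hP]; push_cast; exact this
      _ = _ := by
          rw [hdec fun d => P * (2 * maxMatchingSize (c.graph d)), weightedOptAt, Finset.mul_sum,
            Finset.mul_sum]
          refine Finset.sum_congr rfl fun j _ => ?_
          split_ifs <;> ring
  have hSge : (1 - c.n / c.p) * (P * (2 * c.weightedOptAt e)) ≤ S := by
    calc _ = ∑ q ∈ Fintype.piFinset fun x : Fin c.n => Finset.range (c.total u v x),
          ind (toD q) * (P * (1 - c.n / c.p) * (2 * maxMatchingSize (c.graph (toD q)))) := by
          rw [hdec fun d => P * (1 - c.n / c.p) * (2 * maxMatchingSize (c.graph d)),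
            weightedOptAt, Finset.mul_sum, Finset.mul_sum, Finset.mul_sum]
          refine Finset.sum_congr rfl fun j _ => ?_
          split_ifs <;> ring
      _ ≤ _ := by
          refine Finset.sum_le_sum fun q _ => mul_le_mul_of_nonneg_left ?_ (hind _)
          have := sum_rank_tutteMatrix_ge (p := c.p) (c.graph (toD q))
          rw [hP]; push_cast; exact this
  obtain ⟨h1, h2⟩ := sum_range_bounds_of_periods hf hS0 key B
  have hM : ((W * P : ℕ) : ℚ) ≤ η * B := by
    refine le_trans ?_ hη
    rw [hP]; push_cast
    have : (W : ℚ) ≤ (c.D : ℚ) ^ c.n := by exact_mod_cast c.edgeW_le u v le_rfl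
    gcongr
  have hA0 := c.weightedOptAt_nonneg e
  have hB0 : (0 : ℚ) ≤ B := by positivity
  have hsum : ∑ R ∈ Finset.range B, (c.sampleVal u v R : ℚ) = W * ∑ R ∈ Finset.range B, f R := by
    rw [Finset.mul_sum]; exact Finset.sum_congr rfl fun R _ => hval R
  push_cast at h1 h2 hM
  rw [hsum]
  constructor
  · refine le_of_mul_le_mul_left ?_ hP0
    calc (P : ℚ) * ((1 - η) * (1 - c.n / c.p) * B * (2 * c.weightedOptAt e))
        = (B - η * B) * ((1 - c.n / c.p) * (P * (2 * c.weightedOptAt e))) := by ring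
      _ ≤ (B - η * B) * S := by
          refine mul_le_mul_of_nonneg_left hSge ?_
          have := mul_le_mul_of_nonneg_right hη1 hB0
          linarith
      _ ≤ (B - W * P) * S := by gcongr
      _ ≤ W * P * ∑ R ∈ Finset.range B, f R := h1
      _ = _ := by ring
  · refine le_of_mul_le_mul_left ?_ hP0
    calc (P : ℚ) * (W * ∑ R ∈ Finset.range B, f R) = W * P * ∑ R ∈ Finset.range B, f R := by ring
      _ ≤ (B + W * P) * S := h2
      _ ≤ (B + η * B) * (P * (2 * c.weightedOptAt e)) := by
          have h0 : (0 : ℚ) ≤ W * P := by positivity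
          exact mul_le_mul (by linarith) hSle hS0 (by linarith)
      _ = _ := by ring

/-- The mean of the estimator is close to twice the weighted optimum. -/
lemma sum_sample_bounds {B : ℕ} {η : ℚ}
    (hη : (c.D : ℚ) ^ c.n * c.p ^ (c.n * c.n) ≤ η * B) (hη1 : η ≤ 1) :
    (1 - η) * (1 - c.n / c.p) * B * (2 * c.weightedOpt) ≤
      ∑ R ∈ Finset.range B, (c.sample R : ℚ) ∧
    ∑ R ∈ Finset.range B, (c.sample R : ℚ) ≤ (1 + η) * B * (2 * c.weightedOpt) := by
  simp only [sample, Nat.cast_sum]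
  rw [Finset.sum_comm, sum_weightedOptAt, Finset.mul_sum, Finset.mul_sum, Finset.mul_sum]
  have key : ∀ e ∈ Finset.range (c.n * c.n), e % c.n < c.n ∧ e / c.n * c.n + e % c.n = e := by
    intro e he
    have hn : 0 < c.n := Nat.pos_of_ne_zero fun h => by simp [h] at he
    exact ⟨Nat.mod_lt _ hn, by rw [mul_comm]; exact Nat.div_add_mod e c.n⟩
  constructor
  · refine Finset.sum_le_sum fun e he => ?_
    obtain ⟨h1, h2⟩ := key e he
    split_ifs with h
    · have := (c.sum_sampleVal_bounds (u := e / c.n) h1 hη hη1).1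
      rwa [h2] at this
    · simp
  · refine Finset.sum_le_sum fun e he => ?_
    obtain ⟨h1, h2⟩ := key e he
    split_ifs with h
    · have := (c.sum_sampleVal_bounds (u := e / c.n) h1 hη hη1).2
      rwa [h2] at this
    · simp

end Instance

/-! ### Averages over blocks of coins -/

open MeasureTheory ProbabilityTheory in
instance : IsProbabilityMeasure fairCoins := by unfold fairCoins; infer_instance

/-- The number whose binary digits are the `k` coins that start at position `m`. -/
def blockNum (ω : ℕ → Bool) (m : ℕ) : ℕ → ℕ
  | 0 => 0
  | k + 1 => 2 * blockNum ω m k + if ω (m + k) = true then 1 else 0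

lemma blockNum_lt (ω : ℕ → Bool) (m k : ℕ) : blockNum ω m k < 2 ^ k := by
  induction k with
  | zero => simp [blockNum]
  | succ k ih => rw [blockNum, pow_succ]; split_ifs <;> omega

lemma blockNum_congr {ω ω' : ℕ → Bool} {m k : ℕ}
    (h : ∀ i ∈ Finset.Ico m (m + k), ω i = ω' i) : blockNum ω m k = blockNum ω' m k := by
  induction k with
  | zero => rfl
  | succ k ih =>
    rw [blockNum, blockNum, ih fun i hi => h i (by rw [Finset.mem_Ico] at hi ⊢; omega),
      h (m + k) (by rw [Finset.mem_Ico]; omega)]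

lemma measurable_blockNum (m k : ℕ) : Measurable fun ω => blockNum ω m k := by
  induction k with
  | zero => exact measurable_const
  | succ k ih =>
    have h : Measurable fun ω : ℕ → Bool => (if ω (m + k) = true then 1 else 0 : ℕ) :=
      (Measurable.of_discrete (f := fun b : Bool => (if b = true then 1 else 0 : ℕ))).comp
        (measurable_pi_apply _)
    exact (ih.const_mul 2).add h

lemma sum_range_two_mul (m : ℕ) (g : ℕ → ℝ) :
    ∑ R ∈ Finset.range (m * 2), g R = ∑ R ∈ Finset.range m, (g (2 * R) + g (2 * R + 1)) := by
  induction m with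
  | zero => simp
  | succ m ih =>
    rw [add_mul, one_mul, Finset.sum_range_succ, Finset.sum_range_succ, ih, Finset.sum_range_succ,
      mul_comm m 2]
    ring

section

open MeasureTheory ProbabilityTheory

lemma integrable_blockNum (m k : ℕ) (g : ℕ → ℝ) :
    Integrable (fun ω => g (blockNum ω m k)) fairCoins := by
  refine Integrable.of_bound (C := ∑ R ∈ Finset.range (2 ^ k), |g R|)
    ((Measurable.of_discrete (f := g)).comp (measurable_blockNum m k)).aestronglyMeasurable
    (Filter.Eventually.of_forall fun ω => ?_)
  rw [Real.norm_eq_abs]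
  exact Finset.single_le_sum (f := fun R => |g R|) (fun _ _ => abs_nonneg _)
    (Finset.mem_range.2 (blockNum_lt ω m k))

lemma iIndepFun_coins : iIndepFun (fun (i : ℕ) (ω : ℕ → Bool) => ω i) fairCoins :=
  iIndepFun_infinitePi (X := fun _ b => b) fun _ => measurable_id

/-- Functions of disjoint sets of coins are independent. -/
lemma indepFun_of_disjoint {α β : Type} [MeasurableSpace α] [MeasurableSpace β]
    {S T : Finset ℕ} (hST : Disjoint S T) {F : (ℕ → Bool) → α} {G : (ℕ → Bool) → β}
    (hF : Measurable F) (hG : Measurable G)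
    (hFS : ∀ ω ω', (∀ i ∈ S, ω i = ω' i) → F ω = F ω')
    (hGT : ∀ ω ω', (∀ i ∈ T, ω i = ω' i) → G ω = G ω') : IndepFun F G fairCoins := by
  have h := iIndepFun_coins.indepFun_finset S T hST fun i => measurable_pi_apply i
  let ext : (U : Finset ℕ) → (U → Bool) → ℕ → Bool := fun U r i =>
    if h : i ∈ U then r ⟨i, h⟩ else false
  have hext : ∀ U, Measurable (ext U) := fun U => by
    refine measurable_pi_iff.2 fun i => ?_
    by_cases hi : i ∈ U
    · simpa [ext, hi] using measurable_pi_apply _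
    · simp [ext, hi]
  have h2 := h.comp (hF.comp (hext S)) (hG.comp (hext T))
  convert h2 using 1
  · funext ω; exact hFS _ _ fun i hi => by simp [ext, hi]
  · funext ω; exact hGT _ _ fun i hi => by simp [ext, hi]

lemma integral_coin (i : ℕ) : ∫ ω, (if ω i = true then 1 else 0 : ℝ) ∂fairCoins = 1 / 2 := by
  have h := Measure.infinitePi_map_eval (fun _ : ℕ => (PMF.uniformOfFintype Bool).toMeasure) i
  have h2 : ∫ ω, (if ω i = true then 1 else 0 : ℝ) ∂fairCoins =
      ∫ b : Bool, (if b = true then 1 else 0 : ℝ) ∂(PMF.uniformOfFintype Bool).toMeasure := by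
    rw [← h, integral_map (measurable_pi_apply i).aemeasurable
      Measurable.of_discrete.aestronglyMeasurable]
    rfl
  rw [h2, PMF.integral_eq_sum]
  simp

/-- A block of `k` coins is a uniform number below `2 ^ k`. -/
lemma integral_blockNum (m k : ℕ) (g : ℕ → ℝ) :
    2 ^ k * ∫ ω, g (blockNum ω m k) ∂fairCoins = ∑ R ∈ Finset.range (2 ^ k), g R := by
  induction k generalizing g with
  | zero => simp [blockNum]
  | succ k ih =>
    have hind : ∀ φ : ℕ → ℝ, ∫ ω, φ (blockNum ω m k) *
        (if ω (m + k) = true then 1 else 0 : ℝ) ∂fairCoins =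
        (∫ ω, φ (blockNum ω m k) ∂fairCoins) * (1 / 2) := by
      intro φ
      rw [← integral_coin (m + k)]
      have hm1 : Measurable fun ω => φ (blockNum ω m k) :=
        (Measurable.of_discrete (f := φ)).comp (measurable_blockNum m k)
      have hm2 : Measurable fun ω : ℕ → Bool => (if ω (m + k) = true then 1 else 0 : ℝ) :=
        (Measurable.of_discrete (f := fun b : Bool => (if b = true then 1 else 0 : ℝ))).comp
          (measurable_pi_apply _)
      refine IndepFun.integral_fun_mul_eq_mul_integral ?_ hm1.aestronglyMeasurable
        hm2.aestronglyMeasurable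
      refine indepFun_of_disjoint (S := Finset.Ico m (m + k)) (T := {m + k}) (by simp) hm1 hm2
        (fun ω ω' h => by rw [blockNum_congr h]) fun ω ω' h => by rw [h _ (by simp)]
    have hint : ∀ φ : ℕ → ℝ, Integrable (fun ω => φ (blockNum ω m k) *
        (if ω (m + k) = true then 1 else 0 : ℝ)) fairCoins := by
      intro φ
      refine (integrable_blockNum m (k + 1) fun R => φ (R / 2) * (R % 2 : ℕ)).congr
        (Filter.Eventually.of_forall fun ω => ?_)
      simp only [blockNum]
      split_ifs
      · rw [show (2 * blockNum ω m k + 1) / 2 = blockNum ω m k by omega,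
          show (2 * blockNum ω m k + 1) % 2 = 1 by omega]
        simp
      · simp
    have hsplit : ∀ ω, g (blockNum ω m (k + 1)) = g (2 * blockNum ω m k) +
        (g (2 * blockNum ω m k + 1) - g (2 * blockNum ω m k)) *
          (if ω (m + k) = true then 1 else 0 : ℝ) := by
      intro ω
      rw [blockNum]
      split_ifs <;> simp
    simp only [hsplit]
    rw [integral_add (integrable_blockNum m k fun R => g (2 * R))
      (hint fun R => g (2 * R + 1) - g (2 * R)), hind fun R => g (2 * R + 1) - g (2 * R),
      integral_sub (integrable_blockNum m k fun R => g (2 * R + 1))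
        (integrable_blockNum m k fun R => g (2 * R)), pow_succ, pow_succ, sum_range_two_mul,
      Finset.sum_add_distrib, ← ih fun R => g (2 * R), ← ih fun R => g (2 * R + 1)]
    ring

/-- **Chebyshev's inequality** for the average of a bounded function over independent blocks of
coins. -/
lemma fairCoins_estimate {K N : ℕ} {f : ℕ → ℝ} {b μ δ : ℝ} (hf0 : ∀ R, 0 ≤ f R)
    (hfb : ∀ R, f R ≤ b) (hμ : 2 ^ K * μ = ∑ R ∈ Finset.range (2 ^ K), f R) (hδ : 0 < δ)
    (h : 4 * (N * (b * μ)) ≤ δ ^ 2) :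
    3 / 4 ≤ fairCoins {ω | |∑ j ∈ Finset.range N, f (blockNum ω (j * K) K) - N * μ| < δ} := by
  let X : ℕ → (ℕ → Bool) → ℝ := fun j ω => f (blockNum ω (j * K) K)
  have hXm : ∀ j, Measurable (X j) := fun j =>
    (Measurable.of_discrete (f := f)).comp (measurable_blockNum _ K)
  have hb : 0 ≤ b := (hf0 0).trans (hfb 0)
  have hX2 : ∀ j, MemLp (X j) 2 fairCoins := fun j =>
    MemLp.of_bound (hXm j).aestronglyMeasurable b (Filter.Eventually.of_forall fun ω => by
      rw [Real.norm_eq_abs, abs_of_nonneg (hf0 _)]; exact hfb _)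
  have hEX : ∀ j, ∫ ω, X j ω ∂fairCoins = μ := fun j => by
    have h1 := integral_blockNum (j * K) K f
    rw [← hμ] at h1
    exact mul_left_cancel₀ (by positivity) h1
  have hvar : ∀ j, variance (X j) fairCoins ≤ b * μ := fun j => by
    have h1 := variance_le_sub_mul_sub (μ := fairCoins) (X := X j) (a := 0) (b := b)
      (Filter.Eventually.of_forall fun ω => ⟨hf0 _, hfb _⟩) (hXm j).aemeasurable
    rw [hEX j] at h1
    nlinarith [sq_nonneg μ]
  have hindep : ∀ i j, i ≠ j → IndepFun (X i) (X j) fairCoins := by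
    intro i j hij
    refine indepFun_of_disjoint (S := Finset.Ico (i * K) (i * K + K))
      (T := Finset.Ico (j * K) (j * K + K)) ?_ (hXm i) (hXm j)
      (fun ω ω' h => by simp only [X]; rw [blockNum_congr h])
      fun ω ω' h => by simp only [X]; rw [blockNum_congr h]
    rw [Finset.disjoint_left]
    intro x hx hx'
    rw [Finset.mem_Ico] at hx hx'
    rcases Nat.lt_or_gt_of_ne hij with h' | h' <;> nlinarith
  set S : (ℕ → Bool) → ℝ := ∑ j ∈ Finset.range N, X j with hS
  have hSm : Measurable S := by
    have hSe : S = fun ω => ∑ j ∈ Finset.range N, X j ω := by funext ω; simp [hS]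
    rw [hSe]; exact Finset.measurable_sum _ fun j _ => hXm j
  have hS2 : MemLp S 2 fairCoins := memLp_finsetSum' _ fun j _ => hX2 j
  have hES : ∫ ω, S ω ∂fairCoins = N * μ := by
    simp only [hS, Finset.sum_apply]
    rw [integral_finsetSum _ fun j _ => (hX2 j).integrable (by norm_num)]
    simp [hEX]
  have hVS : variance S fairCoins ≤ N * (b * μ) := by
    rw [hS, IndepFun.variance_sum (fun j _ => hX2 j) fun i _ j _ hij => hindep i j hij]
    refine (Finset.sum_le_sum fun j _ => hvar j).trans ?_
    simp
  have hcheb := meas_ge_le_variance_div_sq hS2 hδ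
  rw [hES] at hcheb
  have hset : {ω | |∑ j ∈ Finset.range N, f (blockNum ω (j * K) K) - N * μ| < δ} =
      {ω | δ ≤ |S ω - N * μ|}ᶜ := by
    ext ω
    simp [hS, X]
  have hmeas : MeasurableSet {ω | δ ≤ |S ω - N * μ|} :=
    measurableSet_le measurable_const (hSm.sub measurable_const).abs
  have hquarter : ENNReal.ofReal (variance S fairCoins / δ ^ 2) ≤ 1 / 4 := by
    have : variance S fairCoins / δ ^ 2 ≤ 1 / 4 := by
      rw [div_le_iff₀ (by positivity)]; linarith
    refine (ENNReal.ofReal_le_ofReal this).trans ?_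
    rw [ENNReal.ofReal_div_of_pos (by norm_num)]
    simp
  rw [hset, prob_compl_eq_one_sub hmeas]
  refine le_trans ?_ (tsub_le_tsub_left (hcheb.trans hquarter) 1)
  have h34 : (3 / 4 : ENNReal) + 1 / 4 = 1 := by
    rw [← ENNReal.add_div, show (3 + 1 : ENNReal) = 4 by norm_num]
    exact ENNReal.div_self (by norm_num) (by norm_num)
  exact ENNReal.le_sub_of_add_le_right (by simp) h34.le

end

/-! ### Arrival-departure models as instances of the estimator -/

namespace ADModel

variable (G : ADModel)

/-- Arrival times, extended by zero. -/
def arrival (x : ℕ) : ℕ := extendZero G.n G.a x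

/-- The number of possible death times, extended by zero. -/
def span (x : ℕ) : ℕ := extendZero G.n (fun v => G.b v + 1 - G.a v) x

/-- Integer weights of the death times for the common denominator `D`. -/
def weight (D x i : ℕ) : ℕ :=
  if h : x < G.n then
    (G.P ⟨x, h⟩ (G.a ⟨x, h⟩ + i)).num.toNat * (D / (G.P ⟨x, h⟩ (G.a ⟨x, h⟩ + i)).den) else 0

open Classical in
/-- The adjacency matrix, with the vertices `u₀` and `v₀` isolated. -/
noncomputable def adjacency (u₀ v₀ k l : ℕ) : ℕ :=
  if ∃ (hk : k < G.n) (hl : l < G.n), G.graph.Adj ⟨k, hk⟩ ⟨l, hl⟩ ∧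
    k ≠ u₀ ∧ k ≠ v₀ ∧ l ≠ u₀ ∧ l ≠ v₀ then 1 else 0

/-- The first time, not before `t₀`, at which both endpoints of `kl` have arrived. -/
def threshold (t₀ k l : ℕ) : ℕ := max (max (G.arrival k) (G.arrival l)) t₀

variable {G}

lemma cast_weight {D : ℕ} (hD : ∀ v t, (G.P v t).den ∣ D) (x : Fin G.n) (i : ℕ) :
    (G.weight D x i : ℚ) = G.P x (G.a x + i) * D := by
  set q := G.P x (G.a x + i) with hq
  have h1 : (q.num.toNat : ℚ) = q.num := by
    have : (q.num.toNat : ℤ) = q.num := Int.toNat_of_nonneg (Rat.num_nonneg.2 (G.P_nonneg _ _))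
    exact_mod_cast this
  simp only [weight, x.2, dite_true, Fin.eta, ← hq]
  rw [Nat.cast_mul, h1, Nat.cast_div (hD _ _) (by exact_mod_cast q.den_ne_zero)]
  rw [← hq]
  nth_rewrite 3 [← Rat.num_div_den q]
  ring

lemma sum_weight {D : ℕ} (hD : ∀ v t, (G.P v t).den ∣ D) (x : Fin G.n) :
    ∑ i ∈ Finset.range (G.span x), G.weight D x i = D := by
  have h : ((∑ i ∈ Finset.range (G.span x), G.weight D x i : ℕ) : ℚ) = D := by
    push_cast
    rw [Finset.sum_congr rfl fun i _ => cast_weight hD x i, ← Finset.sum_mul]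
    have := G.P_sum x
    rw [← Finset.Ico_add_one_right_eq_Icc, Finset.sum_Ico_eq_sum_range] at this
    rw [span, extendZero_fin, this, one_mul]
  exact_mod_cast h

/-- The graph of the edges that are available at some time `t ≥ t₀`, without the edges at the
vertices `u₀` and `v₀`. -/
def windowGraph (G : ADModel) (t₀ u₀ v₀ : ℕ) (d : Fin G.n → ℕ) : SimpleGraph (Fin G.n) where
  Adj k l := (∃ t, t₀ ≤ t ∧ (G.snapshot d t).Adj k l) ∧
    ((k : ℕ) ≠ u₀ ∧ (k : ℕ) ≠ v₀ ∧ (l : ℕ) ≠ u₀ ∧ (l : ℕ) ≠ v₀)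
  symm := ⟨fun _ _ ⟨⟨t, h1, h2⟩, h3, h4, h5, h6⟩ => ⟨⟨t, h1, h2.symm⟩, h5, h6, h3, h4⟩⟩
  loopless := ⟨fun _ ⟨⟨_, _, h⟩, _⟩ => h.ne rfl⟩

/-- The instance of the estimator for a model. Only the edges that are available at some time
`t ≥ t₀` count, and the vertices `u₀` and `v₀` are isolated. -/
noncomputable def toInstance (G : ADModel) (t₀ u₀ v₀ D p : ℕ) (hD : ∀ v t, (G.P v t).den ∣ D)
    (hp : p.Prime) (hp2 : 2 < p) : Instance where
  n := G.n
  D := D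
  p := p
  a := G.arrival
  len := G.span
  w := G.weight D
  G := G.adjacency u₀ v₀
  thr := G.threshold t₀
  sum_w x hx := sum_weight hD ⟨x, hx⟩
  G_self k := by
    unfold adjacency
    rw [if_neg]
    rintro ⟨hk, _, h, -⟩
    exact h.ne rfl
  G_symm k _ l _ := by
    unfold adjacency
    congr 1
    rw [eq_iff_iff]
    constructor <;> rintro ⟨hk, hl, h1, h2, h3, h4, h5⟩ <;> exact ⟨hl, hk, h1.symm, h4, h5, h2, h3⟩
  thr_symm k _ l _ := by rw [threshold, threshold, max_comm (G.arrival k)]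
  p_prime := hp
  two_lt_p := hp2

section

variable {t₀ u₀ v₀ D p : ℕ} {hD : ∀ v t, (G.P v t).den ∣ D} {hp : p.Prime} {hp2 : 2 < p}

lemma adj_graph_iff (d : Fin G.n → ℕ) (k l : Fin G.n) :
    ((G.toInstance t₀ u₀ v₀ D p hD hp hp2).graph (extendZero G.n d)).Adj k l ↔
      (G.windowGraph t₀ u₀ v₀ d).Adj k l := by
  change _ ≠ _ ∧ Instance.avail _ _ _ _ ≠ 0 ↔ (∃ t, t₀ ≤ t ∧ (G.snapshot d t).Adj k l) ∧
    ((k : ℕ) ≠ u₀ ∧ (k : ℕ) ≠ v₀ ∧ (l : ℕ) ≠ u₀ ∧ (l : ℕ) ≠ v₀)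
  rw [Instance.avail_ne_zero_iff]
  change _ ∧ G.adjacency u₀ v₀ k l ≠ 0 ∧ G.threshold t₀ k l ≤ _ ∧ G.threshold t₀ k l ≤ _ ↔ _
  simp only [extendZero_fin, adjacency, threshold, arrival, snapshot]
  constructor
  · rintro ⟨-, h1, h2, h3⟩
    split_ifs at h1 with h
    · obtain ⟨_, _, h4, h5⟩ := h
      exact ⟨⟨max (max (G.a k) (G.a l)) t₀, le_max_right _ _, h4, ⟨by omega, h2⟩, by omega, h3⟩, h5⟩
    · exact absurd rfl h1
  · rintro ⟨⟨t, ht, h1, h2, h3⟩, h4⟩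
    refine ⟨h1.ne, ?_, by omega, by omega⟩
    rw [if_pos ⟨k.2, l.2, h1, h4⟩]
    exact one_ne_zero

lemma maxMatchingSize_graph (d : Fin G.n → ℕ) :
    maxMatchingSize ((G.toInstance t₀ u₀ v₀ D p hD hp hp2).graph (extendZero G.n d)) =
      maxMatchingSize (G.windowGraph t₀ u₀ v₀ d) :=
  congrArg (maxMatchingSize (V := Fin G.n)) (SimpleGraph.ext (by
    funext k l; exact propext (adj_graph_iff d k l)))

/-- The weighted optimum is `D ^ n` times the expectation over the death times. -/
lemma weightedOpt_toInstance :
    (G.toInstance t₀ u₀ v₀ D p hD hp hp2).weightedOpt = D ^ G.n * ∑ d ∈ G.deaths, G.deathProb d *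
      maxMatchingSize (G.windowGraph t₀ u₀ v₀ d) := by
  have hspan : ∀ x : Fin G.n, G.span x = G.b x + 1 - G.a x := fun x => extendZero_fin _ _
  rw [Finset.mul_sum, Instance.weightedOpt]
  refine Finset.sum_nbij' (fun j x => G.a x + j x) (fun d x => d x - G.a x) ?_ ?_ ?_ ?_ ?_
  · intro j hj
    simp only [Instance.indices, deaths, Fintype.mem_piFinset, Finset.mem_range,
      Finset.mem_Icc] at hj ⊢
    intro (x : Fin G.n)
    have h1 : j x < G.span x := hj x
    have := hspan x
    omega
  · intro d hd
    simp only [Instance.indices, deaths, Fintype.mem_piFinset, Finset.mem_range,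
      Finset.mem_Icc] at hd ⊢
    intro (x : Fin G.n)
    change d x - G.a x < G.span x
    have := hspan x
    have := hd x
    omega
  · intro j _; funext x; simp
  · intro d hd
    simp only [deaths, Fintype.mem_piFinset, Finset.mem_Icc] at hd
    funext x
    exact Nat.add_sub_cancel' (hd x).1
  · intro j _
    have h1 : (G.toInstance t₀ u₀ v₀ D p hD hp hp2).deathOf j =
        extendZero G.n fun x => G.a x + j x := by
      funext x
      simp only [Instance.deathOf, extendZero]
      change (if h : x < G.n then G.arrival x + _ else 0) = _
      split_ifs with h
      · rw [arrival, extendZero, dif_pos h]; rfl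
      · rfl
    rw [h1, maxMatchingSize_graph, ← mul_assoc]
    congr 1
    change ((∏ x : Fin G.n, G.weight D x (j x) : ℕ) : ℚ) = _
    rw [Nat.cast_prod, deathProb, Finset.prod_congr rfl fun x _ => cast_weight hD x (j x),
      Finset.prod_mul_distrib, Finset.prod_const, Finset.card_univ, Fintype.card_fin, mul_comm]

lemma sum_deathProb (G : ADModel) : ∑ d ∈ G.deaths, G.deathProb d = 1 := by
  unfold deaths deathProb
  rw [← Finset.prod_univ_sum]
  exact Finset.prod_eq_one fun v _ => G.P_sum v

lemma opt_eq_sum (G : ADModel) :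
    G.opt = ∑ d ∈ G.deaths, G.deathProb d * maxMatchingSize (G.instantiation d) := by
  classical
  rw [← Finset.sum_fiberwise_of_maps_to (t := Finset.univ) (g := fun d => G.instantiation d)
    fun _ _ => Finset.mem_univ _]
  unfold opt instProb
  refine Finset.sum_congr (by ext; simp) fun I _ => ?_
  rw [Finset.sum_mul]
  refine Finset.sum_congr (by ext; simp) fun d hd => ?_
  rw [(Finset.mem_filter.1 hd).2]

/-- The expected size of an optimal matching, as a weighted optimum. -/
lemma weightedOpt_eq_opt (hu : G.n ≤ u₀) (hv : G.n ≤ v₀) :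
    (G.toInstance 1 u₀ v₀ D p hD hp hp2).weightedOpt = D ^ G.n * G.opt := by
  rw [weightedOpt_toInstance, opt_eq_sum]
  congr 1
  refine Finset.sum_congr rfl fun d _ => ?_
  congr 3
  ext k l
  constructor
  · rintro ⟨⟨t, -, h⟩, -⟩; exact ⟨t, h⟩
  · rintro ⟨t, h⟩
    have := G.one_le_a k
    have h2 := h.2.1.1
    have := k.2
    have := l.2
    exact ⟨⟨t, by omega, h⟩, by omega, by omega, by omega, by omega⟩

lemma IsTimedMatching.isMatchingSet {d : Fin G.n → ℕ} {M : (G.instantiation d).Subgraph}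
    {τ : Sym2 (Fin G.n) → ℕ} (h : G.IsTimedMatching d M τ) {I : SimpleGraph (Fin G.n)}
    {E : Set (Sym2 (Fin G.n))} (hE : E ⊆ M.edgeSet)
    (hI : ∀ e ∈ E, e ∈ (G.snapshot d (τ e)).edgeSet → e ∈ I.edgeSet) : IsMatchingSet I E :=
  ⟨fun e he => hI e he (h.2 e (hE he)), fun e he f hf =>
    h.1.isMatchingSet.2 e (hE he) f (hE hf)⟩

lemma exists_isTimedMatching {d : Fin G.n → ℕ} {E : Set (Sym2 (Fin G.n))}
    (hE : ∀ e ∈ E, ∀ f ∈ E, ∀ v, v ∈ e → v ∈ f → e = f) (τ : Sym2 (Fin G.n) → ℕ)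
    (hτ : ∀ e ∈ E, e ∈ (G.snapshot d (τ e)).edgeSet) :
    ∃ M : (G.instantiation d).Subgraph, G.IsTimedMatching d M τ ∧ M.edgeSet = E := by
  have h : IsMatchingSet (G.instantiation d) E := by
    refine ⟨fun e he => ?_, hE⟩
    have h1 := hτ e he
    induction e with
    | _ k l => exact ⟨_, h1⟩
  obtain ⟨M, hM, rfl⟩ := h.exists_subgraph
  exact ⟨M, ⟨hM, hτ⟩, rfl⟩

/-- The times at which the edges of a matching in the window graph can be matched. -/
lemma exists_times (t₀ u₀ v₀ : ℕ) (d : Fin G.n → ℕ) : ∃ τ : Sym2 (Fin G.n) → ℕ,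
    ∀ e ∈ (G.windowGraph t₀ u₀ v₀ d).edgeSet, t₀ ≤ τ e ∧ e ∈ (G.snapshot d (τ e)).edgeSet := by
  have h : ∀ e : Sym2 (Fin G.n), ∃ t, e ∈ (G.windowGraph t₀ u₀ v₀ d).edgeSet →
      t₀ ≤ t ∧ e ∈ (G.snapshot d t).edgeSet := by
    intro e
    induction e with
    | _ k l =>
      by_cases h : (G.windowGraph t₀ u₀ v₀ d).Adj k l
      · obtain ⟨⟨t, h1, h2⟩, -⟩ := h
        exact ⟨t, fun _ => ⟨h1, h2⟩⟩
      · exact ⟨0, fun h' => absurd h' h⟩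
  choose τ hτ using h
  exact ⟨τ, hτ⟩

/-- The expected size of an optimal matching without edges matched at time `1`, as a weighted
optimum. -/
lemma weightedOpt_eq_optGivenNone (hu : G.n ≤ u₀) (hv : G.n ≤ v₀) :
    (G.toInstance 2 u₀ v₀ D p hD hp hp2).weightedOpt = D ^ G.n * G.optGivenNone := by
  rw [weightedOpt_toInstance, optGivenNone]
  congr 1
  refine Finset.sum_congr rfl fun d _ => ?_
  rw [maxMatchingSize, maxMatchingSize_set_eq]
  congr 3
  ext m
  constructor
  · rintro ⟨E, hE, rfl⟩
    obtain ⟨τ, hτ⟩ := exists_times 2 u₀ v₀ d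
    obtain ⟨M, hM, rfl⟩ := exists_isTimedMatching hE.2 τ fun e he => (hτ e (hE.1 he)).2
    refine ⟨M, τ, hM, fun f hf => ?_, rfl⟩
    have := (hτ f (hE.1 hf)).1
    omega
  · rintro ⟨M, τ, hM, h1, rfl⟩
    refine ⟨_, hM.isMatchingSet le_rfl fun e he h => ?_, rfl⟩
    have h2 := h1 e he
    generalize τ e = t at h h2
    induction e with
    | _ k l =>
      have h3 : (G.snapshot d t).Adj k l := h
      have := G.one_le_a k
      have := h3.2.1.1
      have := k.2
      have := l.2
      exact ⟨⟨t, by omega, h3⟩, by omega, by omega, by omega, by omega⟩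

/-- The expected size of an optimal matching in which the given edge is matched at time `1`, as a
weighted optimum: that edge contributes `1`, and the remaining edges avoid its endpoints. -/
lemma weightedOpt_eq_optGivenEdge {u v : Fin G.n} (hadj : G.graph.Adj u v) (hau : G.a u = 1)
    (hav : G.a v = 1) : (G.toInstance 1 u v D p hD hp hp2).weightedOpt + D ^ G.n =
      D ^ G.n * G.optGivenEdge s(u, v) := by
  rw [weightedOpt_toInstance, optGivenEdge]
  have h1 : (D : ℚ) ^ G.n = D ^ G.n * ∑ d ∈ G.deaths, G.deathProb d := by
    rw [G.sum_deathProb, mul_one]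
  nth_rewrite 2 [h1]
  rw [← mul_add, ← Finset.sum_add_distrib]
  congr 1
  refine Finset.sum_congr rfl fun d hd => ?_
  rw [← mul_add_one]
  congr 1
  norm_cast
  set I := G.windowGraph 1 u v d with hI
  simp only [deaths, Fintype.mem_piFinset, Finset.mem_Icc] at hd
  have hIe : ∀ f ∈ I.edgeSet, u ∉ f ∧ v ∉ f := by
    intro f hf
    induction f with
    | _ k l =>
      have h2 : (k : ℕ) ≠ u ∧ (k : ℕ) ≠ v ∧ (l : ℕ) ≠ u ∧ (l : ℕ) ≠ v := hf.2
      simp only [Sym2.mem_iff, Fin.ext_iff]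
      omega
  have hbdd : BddAbove {k : ℕ | ∃ (M : (G.instantiation d).Subgraph) (τ : Sym2 (Fin G.n) → ℕ),
      G.IsTimedMatching d M τ ∧ (s(u, v) ∈ M.edgeSet ∧ τ s(u, v) = 1) ∧
        M.edgeSet.ncard = k} := by
    refine ⟨Nat.card (Sym2 (Fin G.n)), ?_⟩
    rintro k ⟨M, -, -, -, rfl⟩
    exact Set.ncard_le_card _
  refine le_antisymm ?_ ?_
  · obtain ⟨E, hE, hEc⟩ := exists_isMatchingSet_ncard_eq I
    obtain ⟨τ, hτ⟩ := exists_times 1 u v d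
    have hnot : s(u, v) ∉ E := fun h => (hIe _ (hE.1 h)).1 (Sym2.mem_mk_left _ _)
    have hdisj : ∀ f ∈ E, ∀ x, x ∈ s(u, v) → x ∉ f := by
      intro f hf x hx
      rcases Sym2.mem_iff.1 hx with rfl | rfl
      exacts [(hIe f (hE.1 hf)).1, (hIe f (hE.1 hf)).2]
    classical
    have hins : ∀ e ∈ insert s(u, v) E, ∀ f ∈ insert s(u, v) E, ∀ x, x ∈ e → x ∈ f → e = f := by
      rintro e (rfl | he) f (rfl | hf) x hxe hxf
      · rfl
      · exact absurd hxf (hdisj f hf x hxe)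
      · exact absurd hxe (hdisj e he x hxf)
      · exact hE.2 e he f hf x hxe hxf
    have htime : ∀ e ∈ insert s(u, v) E,
        e ∈ (G.snapshot d (Function.update τ s(u, v) 1 e)).edgeSet := by
      rintro e (rfl | he)
      · rw [Function.update_self]
        exact ⟨hadj, ⟨hau.le, hau ▸ (hd u).1⟩, hav.le, hav ▸ (hd v).1⟩
      · rw [Function.update_of_ne (by rintro rfl; exact hnot he)]
        exact (hτ e (hE.1 he)).2
    obtain ⟨M, hM, hME⟩ := exists_isTimedMatching hins _ htime
    rw [← hEc, ← Set.ncard_insert_of_notMem hnot (Set.toFinite E), ← hME]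
    exact le_csSup hbdd ⟨M, _, hM, ⟨by simp [hME], by simp⟩, rfl⟩
  · refine csSup_le' ?_
    rintro k ⟨M, τ, hM, ⟨h2, -⟩, rfl⟩
    have h3 : IsMatchingSet I (M.edgeSet \ {s(u, v)}) := by
      refine hM.isMatchingSet Set.sdiff_subset fun f hf h => ?_
      have h4 : ∀ x, x ∈ s(u, v) → x ∉ f := fun x hx hxf =>
        hf.2 (hM.1.isMatchingSet.2 f hf.1 _ h2 x hxf hx)
      generalize τ f = t at h
      induction f with
      | _ k l =>
        have h5 := h4 u (Sym2.mem_mk_left _ _)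
        have h6 := h4 v (Sym2.mem_mk_right _ _)
        simp only [Sym2.mem_iff, Fin.ext_iff] at h5 h6
        have h7 : (G.snapshot d t).Adj k l := h
        have := G.one_le_a k
        have := h7.2.1.1
        have hne : (k : ℕ) ≠ u ∧ (k : ℕ) ≠ v ∧ (l : ℕ) ≠ u ∧ (l : ℕ) ≠ v := by omega
        exact ⟨⟨t, by omega, h7⟩, hne⟩
    have h8 := h3.ncard_le
    have h9 := Set.ncard_sdiff_singleton_add_one h2 (Set.toFinite _)
    omega

end

end ADModel

/-! ### Reading the encoding of a model -/

lemma List.getD_flatMap_finRange {n : ℕ} (f : Fin n → List ℕ) (v : Fin n) {i : ℕ}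
    (hi : i < (f v).length) :
    ((List.finRange n).flatMap f).getD
      (∑ x ∈ Finset.range v, extendZero n (fun y => (f y).length) x + i) 0 = (f v).getD i 0 := by
  induction n with
  | zero => exact v.elim0
  | succ n ih =>
    rw [List.finRange_succ, List.flatMap_cons, List.flatMap_map]
    induction v using Fin.cases with
    | zero =>
      rw [Fin.val_zero, Finset.range_zero, Finset.sum_empty, zero_add, List.getD_append _ _ _ _ hi]
    | succ v =>
      have h0 : extendZero (n + 1) (fun y => (f y).length) 0 = (f 0).length :=
        extendZero_fin _ (0 : Fin (n + 1))
      have h1 : ∀ x, extendZero (n + 1) (fun y => (f y).length) (x + 1) =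
          extendZero n (fun y => (f y.succ).length) x := by
        intro x
        simp only [extendZero, Nat.add_lt_add_iff_right]
        rfl
      rw [Fin.val_succ, Finset.sum_range_succ', h0, List.getD_append_right _ _ _ _ (by omega)]
      simp only [h1]
      rw [← ih (fun y => f y.succ) v hi]
      congr 1
      omega

lemma List.length_flatMap_pair (f g : ℕ → ℕ) (m : ℕ) :
    ((List.range m).flatMap fun i => [f i, g i]).length = 2 * m := by
  induction m with
  | zero => rfl
  | succ m ih =>
    rw [List.range_succ, List.flatMap_append, List.length_append, ih]
    simp only [List.flatMap_cons, List.flatMap_nil, List.append_nil, List.length_cons,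
      List.length_nil]
    omega

lemma List.getD_flatMap_pair (f g : ℕ → ℕ) {m i : ℕ} (hi : i < m) :
    ((List.range m).flatMap fun i => [f i, g i]).getD (2 * i) 0 = f i ∧
    ((List.range m).flatMap fun i => [f i, g i]).getD (2 * i + 1) 0 = g i := by
  induction m with
  | zero => omega
  | succ m ih =>
    have hl := List.length_flatMap_pair f g m
    rw [List.range_succ, List.flatMap_append]
    rcases Nat.lt_succ_iff_lt_or_eq.1 hi with h | rfl
    · rw [List.getD_append _ _ _ _ (by omega), List.getD_append _ _ _ _ (by omega)]
      exact ih h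
    · rw [List.getD_append_right _ _ _ _ (by omega), List.getD_append_right _ _ _ _ (by omega), hl]
      simp

lemma List.getD_mem_or_eq_zero (L : List ℕ) (i : ℕ) : L.getD i 0 ∈ L ∨ L.getD i 0 = 0 := by
  rcases lt_or_ge i L.length with h | h
  · left; rw [List.getD_eq_getElem _ _ h]; exact List.getElem_mem h
  · right; exact List.getD_eq_default _ _ h

/-- A positive common multiple of the nonzero entries of a list. -/
def entryProd (L : List ℕ) : ℕ := ∏ i ∈ Finset.range L.length, (L.getD i 0 + (1 - L.getD i 0))

lemma entryProd_pos (L : List ℕ) : 0 < entryProd L :=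
  Finset.prod_pos fun i _ => by omega

lemma dvd_entryProd {L : List ℕ} {x : ℕ} (hx : x ∈ L) (hx0 : x ≠ 0) : x ∣ entryProd L := by
  obtain ⟨i, hi, rfl⟩ := List.mem_iff_getElem.1 hx
  have h2 := Finset.dvd_prod_of_mem (fun i => L.getD i 0 + (1 - L.getD i 0))
    (Finset.mem_range.2 hi)
  simp only [List.getD_eq_getElem _ _ hi] at h2
  rwa [show L[i] + (1 - L[i]) = L[i] by omega] at h2

lemma inputSize_cons (x : ℕ) (L : List ℕ) : inputSize (x :: L) = Nat.size x + 1 + inputSize L := by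
  simp [inputSize]

lemma length_le_inputSize (L : List ℕ) : L.length ≤ inputSize L := by
  induction L with
  | nil => simp
  | cons x L ih => rw [inputSize_cons, List.length_cons]; omega

lemma size_getD_le_inputSize (L : List ℕ) (i : ℕ) : Nat.size (L.getD i 0) ≤ inputSize L := by
  induction L generalizing i with
  | nil => simp
  | cons x L ih =>
    rw [inputSize_cons]
    rcases i with - | i
    · simp only [List.getD_cons_zero]; omega
    · have := ih i
      simp only [List.getD_cons_succ]; omega

lemma entryProd_le (L : List ℕ) : entryProd L ≤ 2 ^ inputSize L := by
  induction L with
  | nil => simp [entryProd, inputSize]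
  | cons x L ih =>
    rw [entryProd, List.length_cons, Finset.prod_range_succ', inputSize_cons, pow_add, mul_comm]
    simp only [List.getD_cons_zero, List.getD_cons_succ]
    refine Nat.mul_le_mul ?_ ih
    have h1 := Nat.lt_size_self x
    rw [pow_succ]
    omega

namespace ADModel

variable (G : ADModel)

/-- The position of the table of the vertex `x` in the encoding. -/
def offset (x : ℕ) : ℕ := 1 + G.n * G.n + ∑ y ∈ Finset.range x, (2 + 2 * G.span y)

/-- The table of a vertex in the encoding. -/
def table (v : Fin G.n) : List ℕ :=
  [G.a v, G.b v] ++ (List.range (G.b v + 1 - G.a v)).flatMap fun i =>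
    [(G.P v (G.a v + i)).num.toNat, (G.P v (G.a v + i)).den]

open Classical in
/-- The adjacency matrix in the encoding. -/
noncomputable def adjList : List ℕ := (List.finRange G.n).flatMap fun u =>
  (List.finRange G.n).map fun v => if G.graph.Adj u v then 1 else 0

lemma encode_eq : G.encode = [G.n] ++ G.adjList ++ (List.finRange G.n).flatMap G.table := rfl

variable {G}

lemma length_table (v : Fin G.n) : (G.table v).length = 2 + 2 * G.span v := by
  rw [table, List.length_append, List.length_flatMap_pair, span, extendZero_fin]
  simp

lemma length_adjList : G.adjList.length = G.n * G.n := by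
  simp [adjList, List.length_flatMap]

lemma getD_encode_n : G.encode.getD 0 0 = G.n := by
  rw [encode_eq]; rfl

open Classical in
lemma getD_encode_adj (k l : Fin G.n) :
    G.encode.getD (1 + (k * G.n + l)) 0 = if G.graph.Adj k l then 1 else 0 := by
  have hb : (k : ℕ) * G.n + l < G.n * G.n := by nlinarith [k.2, l.2]
  rw [encode_eq, List.append_assoc, List.getD_append_right _ _ _ _ (by simp)]
  simp only [List.length_cons, List.length_nil, zero_add, Nat.add_sub_cancel_left]
  rw [List.getD_append _ _ _ _ (by rw [length_adjList]; exact hb)]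
  have h := List.getD_flatMap_finRange (fun u => (List.finRange G.n).map fun v =>
    if G.graph.Adj u v then 1 else 0) k (i := l) (by simp)
  simp only [List.length_map, List.length_finRange] at h
  have h2 : ∑ x ∈ Finset.range k, extendZero G.n (fun _ => G.n) x = k * G.n := by
    rw [Finset.sum_congr rfl (g := fun _ => G.n)]
    · simp
    · intro x hx
      rw [extendZero, dif_pos ((Finset.mem_range.1 hx).trans k.2)]
  rw [h2] at h
  rw [adjList, h]
  simp [List.getD_eq_getElem?_getD]

lemma getD_encode_table (v : Fin G.n) {i : ℕ} (hi : i < 2 + 2 * G.span v) :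
    G.encode.getD (G.offset v + i) 0 = (G.table v).getD i 0 := by
  have hl : ([G.n] ++ G.adjList).length = 1 + G.n * G.n := by
    rw [List.length_append, length_adjList]; rfl
  rw [encode_eq, List.getD_append_right _ _ _ _ (by rw [hl, offset]; omega), hl,
    ← List.getD_flatMap_finRange G.table v (by rwa [length_table])]
  congr 1
  have : ∑ x ∈ Finset.range v, extendZero G.n (fun y => (G.table y).length) x =
      ∑ y ∈ Finset.range v, (2 + 2 * G.span y) := by
    refine Finset.sum_congr rfl fun x hx => ?_
    have hx' := (Finset.mem_range.1 hx).trans v.2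
    rw [extendZero, dif_pos hx', length_table]
  rw [offset, this]; omega

lemma getD_encode_a (v : Fin G.n) : G.encode.getD (G.offset v) 0 = G.a v :=
  getD_encode_table v (i := 0) (by omega)

lemma getD_encode_b (v : Fin G.n) : G.encode.getD (G.offset v + 1) 0 = G.b v :=
  getD_encode_table v (i := 1) (by omega)

lemma getD_encode_num (v : Fin G.n) {i : ℕ} (hi : i < G.span v) :
    G.encode.getD (G.offset v + (2 + 2 * i)) 0 = (G.P v (G.a v + i)).num.toNat ∧
    G.encode.getD (G.offset v + (3 + 2 * i)) 0 = (G.P v (G.a v + i)).den := by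
  rw [getD_encode_table v (by omega), getD_encode_table v (by omega), table,
    List.getD_append_right _ _ _ _ (by simp), List.getD_append_right _ _ _ _ (by simp; omega)]
  rw [span, extendZero_fin] at hi
  have h := List.getD_flatMap_pair (fun i => (G.P v (G.a v + i)).num.toNat)
    (fun i => (G.P v (G.a v + i)).den) hi
  simp only [List.length_cons, List.length_nil, zero_add]
  rw [show 2 + 2 * i - (1 + 1) = 2 * i by omega, show 3 + 2 * i - (1 + 1) = 2 * i + 1 by omega]
  exact h

lemma den_mem_encode (v : Fin G.n) {t : ℕ} (ht : t ∈ Set.Icc (G.a v) (G.b v)) :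
    (G.P v t).den ∈ G.encode := by
  have hs : G.span v = G.b v + 1 - G.a v := extendZero_fin _ _
  have h := (getD_encode_num v (i := t - G.a v) (by have := ht.1; have := ht.2; omega)).2
  rw [Nat.add_sub_cancel' ht.1] at h
  rcases G.encode.getD_mem_or_eq_zero (G.offset v + (3 + 2 * (t - G.a v))) with h' | h'
  · rwa [h] at h'
  · exact absurd (h.symm.trans h') (G.P v t).den_ne_zero

lemma den_dvd_entryProd {L : List ℕ} (hL : ∀ x ∈ G.encode, x ∈ L) (v : Fin G.n) (t : ℕ) :
    (G.P v t).den ∣ entryProd L := by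
  by_cases ht : t ∈ Set.Icc (G.a v) (G.b v)
  · exact dvd_entryProd (hL _ (den_mem_encode v ht)) (G.P v t).den_ne_zero
  · rw [G.P_support v t ht]; exact one_dvd _

end ADModel

/-! ### Derived operations of the programs -/

namespace RExpr

/-- The remainder of `a` modulo `b`. -/
def mod (a b : RExpr) : RExpr := sub a (mul (div a b) b)

/-- The maximum of `a` and `b`. -/
def max (a b : RExpr) : RExpr := add a (sub b a)

/-- `1` if `a ≤ b`, and `0` otherwise. -/
def le (a b : RExpr) : RExpr := sub (const 1) (sub a b)

/-- `1` if `a ≠ b`, and `0` otherwise. -/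
def ne (a b : RExpr) : RExpr := sub (const 1) (sub (const 1) (add (sub a b) (sub b a)))

@[simp] lemma eval_mod (s : RState) (a b : RExpr) : (mod a b).eval s = a.eval s % b.eval s := by
  have := Nat.div_add_mod (a.eval s) (b.eval s)
  simp only [mod, eval]
  rw [mul_comm]
  omega

@[simp] lemma eval_max (s : RState) (a b : RExpr) :
    (max a b).eval s = Max.max (a.eval s) (b.eval s) := by
  simp only [max, eval]; omega

@[simp] lemma eval_le (s : RState) (a b : RExpr) :
    (le a b).eval s = if a.eval s ≤ b.eval s then 1 else 0 := by
  simp only [le, eval]; split_ifs <;> omega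

@[simp] lemma eval_ne (s : RState) (a b : RExpr) :
    (ne a b).eval s = if a.eval s = b.eval s then 0 else 1 := by
  simp only [ne, eval]; split_ifs <;> omega

end RExpr

namespace RProg

variable {ω : ℕ → Bool} {X : ℕ} {p q : RProg} {s : RState} {Q : RState → Prop}

lemma Sat.assign_seq {x : ℕ} {e : RExpr} (v : ℕ) (hv : e.eval s = v) (hb : v < 2 ^ X)
    (h : Sat ω X q (s.setVar x v) Q) : Sat ω X (RProg.seq (RProg.assign x e) q) s Q :=
  Sat.seq (R := fun s' => s' = s.setVar x v) (Sat.assign (hv ▸ hb) (by rw [hv]))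
    (by rintro _ _ _ rfl; exact h)

lemma Sat.assign_of_eq {x : ℕ} {e : RExpr} (v : ℕ) (hv : e.eval s = v) (hb : v < 2 ^ X)
    (h : Q (s.setVar x v)) : Sat ω X (RProg.assign x e) s Q :=
  Sat.assign (hv ▸ hb) (by rwa [hv])

lemma Sat.store_of_eq {A : ℕ} {i e : RExpr} (j v : ℕ) (hj : i.eval s = j) (hv : e.eval s = v)
    (hb : v < 2 ^ X) (h : Q (s.setArr A j v)) : Sat ω X (RProg.store A i e) s Q :=
  Sat.store (hv ▸ hb) (by rwa [hj, hv])

end RProg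

/-! ### The layout of the memory -/

-- The variables `v_len` and `v_out` hold the number of entries of the input at the beginning, and
-- the numerator and the denominator of the output at the end. The variables up to `v_Dn` hold the
-- parameters of the scheme; the others belong to the single parts of the computation.
notation "v_len" => (0 : ℕ)
notation "v_out" => (1 : ℕ)
notation "v_base" => (2 : ℕ)
notation "v_start" => (3 : ℕ)
notation "v_uex" => (4 : ℕ)
notation "v_vex" => (5 : ℕ)
notation "v_add" => (6 : ℕ)
notation "v_n" => (7 : ℕ)
notation "v_nn" => (8 : ℕ)
notation "v_D" => (9 : ℕ)
notation "v_E" => (10 : ℕ)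
notation "v_p" => (11 : ℕ)
notation "v_N" => (12 : ℕ)
notation "v_K" => (13 : ℕ)
notation "v_Dn" => (14 : ℕ)
notation "v_u" => (20 : ℕ)
notation "v_v" => (21 : ℕ)
notation "v_c" => (22 : ℕ)
notation "v_R" => (23 : ℕ)
notation "v_W" => (24 : ℕ)
notation "v_x" => (25 : ℕ)
notation "v_o" => (26 : ℕ)
notation "v_a" => (27 : ℕ)
notation "v_m" => (28 : ℕ)
notation "v_lo" => (29 : ℕ)
notation "v_T" => (30 : ℕ)
notation "v_i" => (31 : ℕ)
notation "v_q" => (32 : ℕ)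
notation "v_C" => (33 : ℕ)
notation "v_dd" => (34 : ℕ)
notation "v_k" => (35 : ℕ)
notation "v_l" => (36 : ℕ)
notation "v_last" => (38 : ℕ)
notation "v_cnt" => (39 : ℕ)
notation "v_t" => (40 : ℕ)
notation "v_piv" => (41 : ℕ)
notation "v_row" => (42 : ℕ)
notation "v_col" => (43 : ℕ)
notation "v_j" => (50 : ℕ)
notation "v_e" => (51 : ℕ)
notation "v_S" => (52 : ℕ)
notation "v_total" => (53 : ℕ)
notation "v_bit" => (54 : ℕ)
notation "v_coin" => (55 : ℕ)
-- The input, the positions of the tables of the vertices, the adjacency matrix, the thresholds of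
-- the edges, the sampled death times, the sampled evaluation point, and two matrices.
notation "a_in" => (0 : ℕ)
notation "a_off" => (1 : ℕ)
notation "a_G" => (2 : ℕ)
notation "a_thr" => (3 : ℕ)
notation "a_d" => (10 : ℕ)
notation "a_z" => (11 : ℕ)
notation "a_A" => (12 : ℕ)
notation "a_B" => (13 : ℕ)

/-- The global part of the memory holds the instance `c`. -/
structure Env (c : Instance) (s : RState) : Prop where
  n : s.var v_n = c.n
  nn : s.var v_nn = c.n * c.n
  D : s.var v_D = c.D
  p : s.var v_p = c.p
  a : ∀ x < c.n, s.arr a_in (s.arr a_off x) = c.a x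
  len : ∀ x < c.n, s.arr a_in (s.arr a_off x + 1) + 1 - s.arr a_in (s.arr a_off x) = c.len x
  w : ∀ x < c.n, ∀ i < c.len x, s.arr a_in (s.arr a_off x + (2 + 2 * i)) *
    (c.D / s.arr a_in (s.arr a_off x + (3 + 2 * i))) = c.w x i
  G : ∀ k < c.n, ∀ l < c.n, s.arr a_G (k * c.n + l) = c.G k l
  thr : ∀ k < c.n, ∀ l < c.n, s.arr a_thr (k * c.n + l) = c.thr k l

/-- The program does not write to the global part of the memory. -/
def RProg.Keeps (p : RProg) : Bool :=
  !(p.modsVar v_n || p.modsVar v_nn || p.modsVar v_D || p.modsVar v_p || p.modsArr a_in ||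
    p.modsArr a_off || p.modsArr a_G || p.modsArr a_thr)

lemma Env.mono {c : Instance} {s s' : RState} (h : Env c s) {p : RProg} (ha : p.Agree s s')
    (hp : p.Keeps = true := by rfl) : Env c s' := by
  simp only [RProg.Keeps, Bool.not_eq_true', Bool.or_eq_false_iff] at hp
  obtain ⟨⟨⟨⟨⟨⟨⟨h1, h2⟩, h3⟩, h4⟩, h5⟩, h6⟩, h7⟩, h8⟩ := hp
  obtain ⟨g1, g2, g3, g4, g5, g6, g7, g8, g9⟩ := h
  refine ⟨?_, ?_, ?_, ?_, ?_, ?_, ?_, ?_, ?_⟩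
  · rwa [ha.var _ h1]
  · rwa [ha.var _ h2]
  · rwa [ha.var _ h3]
  · rwa [ha.var _ h4]
  · rwa [ha.arr _ h5, ha.arr _ h6]
  · rwa [ha.arr _ h5, ha.arr _ h6]
  · rwa [ha.arr _ h5, ha.arr _ h6]
  · rwa [ha.arr _ h7]
  · rwa [ha.arr _ h8]

/-! ### The program: sampling the death times -/

/-- The bound `X` for the bit lengths and the numbers of rounds is large enough for `c`. -/
structure Fits (c : Instance) (X : ℕ) : Prop where
  nn : c.n * c.n ≤ X
  p : c.p ≤ X
  len : ∀ x < c.n, c.len x ≤ X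
  D_pos : 0 < c.D
  pow : c.D ^ c.n < 2 ^ X
  death : ∀ x < c.n, c.a x + c.len x < 2 ^ X

lemma Fits.n {c : Instance} {X : ℕ} (h : Fits c X) : c.n ≤ X :=
  (Nat.le_mul_self _).trans h.nn

lemma Nat.lt_two_pow_of_le {a X : ℕ} (h : a ≤ X) : a < 2 ^ X := h.trans_lt X.lt_two_pow_self

namespace Sampler

open RProg

/-- The masked weight of the death time with index `v_i` of the current vertex. -/
def weightExpr : RExpr :=
  .mul (.mul (.get a_in (.add (.var v_o) (.add (.const 2) (.mul (.const 2) (.var v_i)))))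
    (.div (.var v_D) (.get a_in (.add (.var v_o) (.add (.const 3) (.mul (.const 2) (.var v_i)))))))
    (.sub (.const 1) (.sub (.var v_lo) (.add (.var v_a) (.var v_i))))

/-- Read the table of the vertex `v_x`. -/
def vertexHead : RProg :=
  seq (assign v_o (.get a_off (.var v_x))) <|
  seq (assign v_a (.get a_in (.var v_o))) <|
  seq (assign v_m (.sub (.add (.get a_in (.add (.var v_o) (.const 1))) (.const 1)) (.var v_a))) <|
  seq (assign v_T (.const 0)) <|
  ite (.mul (.ne (.var v_x) (.var v_u)) (.ne (.var v_x) (.var v_v)))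
    (assign v_lo (.var v_a)) (assign v_lo (.var v_c))

/-- Compute the total weight of the vertex `v_x`. -/
def vertexTotal : RProg := forTo v_i v_m (assign v_T (.add (.var v_T) weightExpr))

/-- Split off the digit of the vertex `v_x` from the random number. -/
def vertexDigit : RProg :=
  seq (assign v_q (.mod (.var v_R) (.var v_T))) <|
  seq (assign v_R (.div (.var v_R) (.var v_T))) <|
  seq (assign v_W (.mul (.var v_W) (.var v_T))) <|
  seq (assign v_C (.const 0)) (assign v_dd (.const 0))

/-- Decode the digit of the vertex `v_x`. -/
def vertexDecode : RProg :=
  forTo v_i v_m (seq (ite (.le (.var v_C) (.var v_q)) (assign v_dd (.var v_i)) skip)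
    (assign v_C (.add (.var v_C) weightExpr)))

/-- Sample the death time of the vertex `v_x`. -/
def vertexProg : RProg :=
  seq vertexHead <| seq vertexTotal <| seq vertexDigit <| seq vertexDecode <|
  store a_d (.var v_x) (.add (.var v_a) (.var v_dd))

variable {ω : ℕ → Bool} {X : ℕ} {c : Instance} {s : RState}

lemma eval_weightExpr (hE : Env c s) {u v x i : ℕ} (hx : x < c.n) (hi : i < c.len x)
    (ho : s.var v_o = s.arr a_off x) (ha : s.var v_a = c.a x) (hlo : s.var v_lo = c.low u v x)
    (hiv : s.var v_i = i) : weightExpr.eval s = c.maskW u v x i := by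
  simp only [weightExpr, RExpr.eval, ho, ha, hlo, hiv, hE.D]
  rw [hE.w x hx i hi, Instance.maskW]

lemma sat_vertexHead (hE : Env c s) (hF : Fits c X) {u v x : ℕ} (hx : x < c.n)
    (hu : s.var v_u = u) (hv : s.var v_v = v) (hc : s.var v_c = c.thr u v) (hxv : s.var v_x = x) :
    Sat ω X vertexHead s fun s' => s'.var v_o = s'.arr a_off x ∧ s'.var v_a = c.a x ∧
      s'.var v_m = c.len x ∧ s'.var v_lo = c.low u v x ∧ s'.var v_T = 0 := by
  refine Sat.of_bounded fun hs => ?_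
  have h2 : c.a x < 2 ^ X := by have := hF.death x hx; omega
  refine Sat.assign_seq (s.arr a_off x) (by simp [RExpr.eval, hxv]) (hs.arr _ _) ?_
  refine Sat.assign_seq (c.a x) (by simp [RExpr.eval, hE.a x hx]) h2 ?_
  refine Sat.assign_seq (c.len x)
    (by simp [RExpr.eval, ← hE.len x hx, ← hE.a x hx]) (Nat.lt_two_pow_of_le (hF.len x hx)) ?_
  refine Sat.assign_seq 0 rfl (by positivity) ?_
  refine Sat.ite (fun h => ?_) fun h => ?_
  · refine Sat.assign_of_eq (c.a x) (by simp [RExpr.eval]) h2 ?_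
    simp [RExpr.eval, hxv, hu, hv] at h
    simp [Instance.low, h]
  · refine Sat.assign_of_eq (c.thr u v) (by simp [RExpr.eval, hc]) (hc ▸ hs.var _) ?_
    simp [RExpr.eval, hxv, hu, hv] at h
    have h' : x = u ∨ x = v := by omega
    simp [Instance.low, h']

lemma sat_vertexTotal (hE : Env c s) (hF : Fits c X) {u v x : ℕ} (hx : x < c.n)
    (ho : s.var v_o = s.arr a_off x) (ha : s.var v_a = c.a x) (hlo : s.var v_lo = c.low u v x)
    (hm : s.var v_m = c.len x) (hT : s.var v_T = 0) :
    Sat ω X vertexTotal s fun s' => s'.var v_T = c.total u v x := by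
  refine Sat.of_bounded fun hs => ?_
  refine Sat.forTo (fun k s' => s'.var v_T = ∑ i ∈ Finset.range k, c.maskW u v x i) hm
    (hN := hF.len x hx) (hinv := fun _ _ _ h => by simpa using h) (h0 := by simpa using hT)
    (hstep := fun k hk s' hs' hag hi hI => ?_)
  have hw := eval_weightExpr (hE.mono hag) (u := u) (v := v) hx hk
    ((hag.var _ rfl).trans (ho.trans (by rw [hag.arr _ rfl]))) ((hag.var _ rfl).trans ha)
    ((hag.var _ rfl).trans hlo) hi
  refine Sat.assign_of_eq (∑ i ∈ Finset.range (k + 1), c.maskW u v x i) ?_ ?_ (by simp)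
  · rw [RExpr.eval, hw, RExpr.eval, hI, Finset.sum_range_succ]
  · refine lt_of_le_of_lt ?_ (hE.D ▸ hs.var v_D)
    exact (Finset.sum_le_sum_of_subset (Finset.range_mono hk)).trans (c.total_le u v hx)

lemma sat_vertexDigit {r W T : ℕ} (hR : s.var v_R = r) (hW : s.var v_W = W) (hT : s.var v_T = T)
    (hWT : W * T < 2 ^ X) :
    Sat ω X vertexDigit s fun s' => s'.var v_q = r % T ∧ s'.var v_R = r / T ∧
      s'.var v_W = W * T ∧ s'.var v_C = 0 ∧ s'.var v_dd = 0 := by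
  refine Sat.of_bounded fun hs => ?_
  have hr : r < 2 ^ X := hR ▸ hs.var _
  refine Sat.assign_seq (r % T) (by simp [RExpr.eval, hR, hT])
    ((Nat.mod_le _ _).trans_lt hr) ?_
  refine Sat.assign_seq (r / T) (by simp [RExpr.eval, hR, hT])
    ((Nat.div_le_self _ _).trans_lt hr) ?_
  refine Sat.assign_seq (W * T) (by simp [RExpr.eval, hW, hT]) hWT ?_
  refine Sat.assign_seq 0 rfl (by positivity) ?_
  exact Sat.assign_of_eq 0 rfl (by positivity) (by simp)

lemma sat_vertexDecode (hE : Env c s) (hF : Fits c X) {u v x q : ℕ} (hx : x < c.n)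
    (ho : s.var v_o = s.arr a_off x) (ha : s.var v_a = c.a x) (hlo : s.var v_lo = c.low u v x)
    (hm : s.var v_m = c.len x) (hq : s.var v_q = q) (hC : s.var v_C = 0) (hdd : s.var v_dd = 0) :
    Sat ω X vertexDecode s fun s' => s'.var v_dd = decode (c.maskW u v x) (c.len x) q := by
  refine Sat.of_bounded fun hs => ?_
  refine (Sat.forTo (fun k s' => s'.var v_C = ∑ i ∈ Finset.range k, c.maskW u v x i ∧
    s'.var v_dd = decode (c.maskW u v x) k q) hm
    (hN := hF.len x hx) (hinv := fun _ _ _ h => by simpa using h)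
    (h0 := ⟨by simpa using hC, by simpa [decode, lastIdx] using hdd⟩)
    (hstep := fun k hk s' hs' hag hi hI => ?_)).imp fun s' _ _ h => h.2
  have hw : ∀ t, weightExpr.eval (s'.setVar v_dd t) = c.maskW u v x k := by
    intro t
    have := eval_weightExpr (hE.mono hag) (u := u) (v := v) hx hk
      ((hag.var _ rfl).trans (ho.trans (by rw [hag.arr _ rfl]))) ((hag.var _ rfl).trans ha)
      ((hag.var _ rfl).trans hlo) hi
    rw [← this]
    simp [weightExpr, RExpr.eval]
  have hw0 : weightExpr.eval s' = c.maskW u v x k := by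
    rw [← hw (s'.var v_dd)]
    simp [weightExpr, RExpr.eval]
  have hbd : ∑ i ∈ Finset.range (k + 1), c.maskW u v x i < 2 ^ X := by
    refine lt_of_le_of_lt ?_ (hE.D ▸ hs.var v_D)
    exact (Finset.sum_le_sum_of_subset (Finset.range_mono hk)).trans (c.total_le u v hx)
  have hq' : s'.var v_q = q := (hag.var _ rfl).trans hq
  refine Sat.seq (R := fun s₁ => s₁ = s'.setVar v_dd (decode (c.maskW u v x) (k + 1) q) ∨
    s₁ = s' ∧ decode (c.maskW u v x) (k + 1) q = decode (c.maskW u v x) k q) ?_ ?_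
  · refine Sat.ite (fun h => ?_) fun h => ?_
    · simp only [RExpr.eval_le, RExpr.eval, hI.1, hq', ne_eq, ite_eq_right_iff, one_ne_zero,
        imp_false, not_not] at h
      refine Sat.assign_of_eq k (by simpa [RExpr.eval] using hi)
        (Nat.lt_two_pow_of_le (hk.le.trans (hF.len x hx))) (Or.inl ?_)
      rw [decode, lastIdx, if_pos h, Nat.add_sub_cancel]
    · simp only [RExpr.eval_le, RExpr.eval, hI.1, hq', ite_eq_right_iff, one_ne_zero,
        imp_false] at h
      refine Sat.skip (Or.inr ⟨rfl, ?_⟩)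
      rw [decode, lastIdx, if_neg h, decode]
  · rintro s₁ - - (rfl | ⟨rfl, hd⟩)
    · refine Sat.assign_of_eq (∑ i ∈ Finset.range (k + 1), c.maskW u v x i) ?_ hbd (by simp)
      rw [RExpr.eval, hw, RExpr.eval, Finset.sum_range_succ, ← hI.1]; simp
    · refine Sat.assign_of_eq (∑ i ∈ Finset.range (k + 1), c.maskW u v x i) ?_ hbd
        (by simp [hd, hI.2])
      rw [RExpr.eval, hw0, RExpr.eval, hI.1, Finset.sum_range_succ]

lemma sat_vertexProg (hE : Env c s) (hF : Fits c X) {u v x r W : ℕ} (hx : x < c.n)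
    (hu : s.var v_u = u) (hv : s.var v_v = v) (hc : s.var v_c = c.thr u v) (hxv : s.var v_x = x)
    (hR : s.var v_R = r) (hW : s.var v_W = W) (hWT : W * c.total u v x < 2 ^ X) :
    Sat ω X vertexProg s fun s' => s'.var v_R = r / c.total u v x ∧
      s'.var v_W = W * c.total u v x ∧
      s'.arr a_d = Function.update (s.arr a_d) x
        (c.a x + decode (c.maskW u v x) (c.len x) (r % c.total u v x)) := by
  refine Sat.seq (sat_vertexHead hE hF hx hu hv hc hxv) ?_
  rintro s₁ hs₁ ha₁ ⟨ho, ha, hm, hlo, hT⟩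
  have hE₁ := hE.mono ha₁
  refine Sat.seq (sat_vertexTotal hE₁ hF hx ho ha hlo hm hT) ?_
  rintro s₂ hs₂ ha₂ hT₂
  have hE₂ := hE₁.mono ha₂
  refine Sat.seq (sat_vertexDigit (((ha₁.seq ha₂).var _ rfl).trans hR)
    (((ha₁.seq ha₂).var _ rfl).trans hW) hT₂ hWT) ?_
  rintro s₃ hs₃ ha₃ ⟨hq, hR₃, hW₃, hC, hdd⟩
  have hE₃ := hE₂.mono ha₃
  have h3 := ha₂.seq ha₃
  refine Sat.seq (sat_vertexDecode hE₃ hF (u := u) (v := v) hx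
    ((h3.var _ rfl).trans (ho.trans (by rw [h3.arr _ rfl])))
    ((h3.var _ rfl).trans ha) ((h3.var _ rfl).trans hlo) ((h3.var _ rfl).trans hm) hq hC hdd) ?_
  rintro s₄ hs₄ ha₄ hdd₄
  have h4 := ha₁.seq (h3.seq ha₄)
  refine Sat.store_of_eq x (c.a x + decode (c.maskW u v x) (c.len x) (r % c.total u v x)) ?_ ?_
    ?_ ⟨?_, ?_, ?_⟩
  · simpa [RExpr.eval] using (h4.var v_x rfl).trans hxv
  · simp only [RExpr.eval, hdd₄]
    rw [(h3.seq ha₄).var v_a rfl, ha]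
  · have h5 := hF.death x hx
    have h6 := lastIdx_le (fun i => ∑ j ∈ Finset.range i, c.maskW u v x j ≤ r % c.total u v x)
      (c.len x)
    rw [decode]; omega
  · exact (ha₄.var _ rfl).trans hR₃
  · exact (ha₄.var _ rfl).trans hW₃
  · rw [← h4.arr a_d rfl]
    funext y
    simp [Function.update_apply]

/-- Sample all the death times. -/
def deathProg : RProg := forTo v_x v_n vertexProg

lemma sat_deathProg (hE : Env c s) (hF : Fits c X) {u v r : ℕ}
    (hu : s.var v_u = u) (hv : s.var v_v = v) (hc : s.var v_c = c.thr u v)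
    (hR : s.var v_R = r) (hW : s.var v_W = 1) :
    Sat ω X deathProg s fun s' => s'.var v_R = r / c.edgeW u v c.n ∧
      s'.var v_W = c.edgeW u v c.n ∧ ∀ x < c.n, s'.arr a_d x = c.death u v r x := by
  refine (Sat.forTo (fun k s' => s'.var v_R = r / c.edgeW u v k ∧ s'.var v_W = c.edgeW u v k ∧
      ∀ x < k, s'.arr a_d x = c.deathAt u v r x) hE.n
    (hN := hF.n) (hinv := fun _ _ _ h => by simpa using h)
    (h0 := by simp [Instance.edgeW, hR, hW]) (hstep := fun k hk s' hs' hag hi hI => ?_)).imp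
    fun s' _ _ h => ⟨h.1, h.2.1, fun x hx => ?_⟩
  · obtain ⟨h1, h2, h3⟩ := hI
    have hsucc : c.edgeW u v (k + 1) = c.edgeW u v k * c.total u v k := Finset.prod_range_succ _ _
    refine (sat_vertexProg (hE.mono hag) hF (u := u) (v := v) hk ((hag.var _ rfl).trans hu)
      ((hag.var _ rfl).trans hv) ((hag.var _ rfl).trans hc) hi h1 h2 ?_).imp
      fun s₁ _ _ ⟨g1, g2, g3⟩ => ⟨?_, ?_, fun x hx => ?_⟩
    · rw [← hsucc]
      exact ((c.edgeW_le u v hk).trans (Nat.pow_le_pow_right hF.D_pos hk)).trans_lt hF.pow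
    · rw [g1, hsucc, Nat.div_div_eq_div_mul]
    · rw [g2, hsucc]
    · rw [g3, Function.update_apply]
      split_ifs with hxk
      · rw [hxk, Instance.deathAt]
      · exact h3 x (by omega)
  · rw [h.2.2 x hx, Instance.death, extendZero, dif_pos hx]

end Sampler

/-! ### The program: the rank of the Tutte matrix -/

section Elimination

variable {m F : Type} [Fintype m] [DecidableEq m] [Field F]

/-- One fraction-free elimination step with the pivot `(i, j)`. -/
def Matrix.eliminate (A : Matrix m m F) (i j : m) : Matrix m m F :=
  Matrix.of fun k l => A i j * A k l - A k j * A i l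

/-- An elimination step with a nonzero pivot reduces the rank by one: it differs from a scalar
multiple by a matrix of rank one, and its kernel gains the unit vector of the pivot column. -/
lemma Matrix.rank_eliminate {A : Matrix m m F} {i j : m} (h : A i j ≠ 0) :
    (A.eliminate i j).rank + 1 = A.rank := by
  have hmul : ∀ y : m → F, (A.eliminate i j).mulVec y =
      A i j • A.mulVec y - (A.mulVec y) i • A.col j := by
    intro y
    funext k
    simp only [Matrix.eliminate, Matrix.mulVec, dotProduct, Matrix.of_apply, Pi.sub_apply,
      Pi.smul_apply, smul_eq_mul, Matrix.col_apply, sub_mul, Finset.sum_sub_distrib,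
      Finset.mul_sum, Finset.sum_mul]
    congr 1
    · exact Finset.sum_congr rfl fun l _ => by ring
    · exact Finset.sum_congr rfl fun l _ => by ring
  refine le_antisymm ?_ ?_
  · have h1 := LinearMap.finrank_range_add_finrank_ker (A.eliminate i j).mulVecLin
    have h2 := LinearMap.finrank_range_add_finrank_ker A.mulVecLin
    have h3 : LinearMap.ker A.mulVecLin < LinearMap.ker (A.eliminate i j).mulVecLin := by
      refine lt_of_le_of_ne (fun y hy => ?_) fun heq => ?_
      · rw [LinearMap.mem_ker, Matrix.mulVecLin_apply] at hy ⊢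
        rw [hmul, hy]; simp
      · have h4 : Pi.single j 1 ∈ LinearMap.ker (A.eliminate i j).mulVecLin := by
          rw [LinearMap.mem_ker, Matrix.mulVecLin_apply, hmul, Matrix.mulVec_single_one]
          simp
        rw [← heq, LinearMap.mem_ker, Matrix.mulVecLin_apply, Matrix.mulVec_single_one] at h4
        exact h (congrFun h4 i)
    have h4 := Submodule.finrank_lt_finrank_of_lt h3
    rw [Matrix.rank, Matrix.rank]
    omega
  · have hle : LinearMap.range A.mulVecLin ≤
        LinearMap.range (A.eliminate i j).mulVecLin ⊔ Submodule.span F {A.col j} := by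
      rintro _ ⟨y, rfl⟩
      rw [Matrix.mulVecLin_apply]
      have h5 : A.mulVec y = (A i j)⁻¹ • (A.eliminate i j).mulVec y +
          ((A i j)⁻¹ * (A.mulVec y) i) • A.col j := by
        rw [hmul, smul_sub, smul_smul, smul_smul, inv_mul_cancel₀ h, one_smul, sub_add_cancel]
      rw [h5]
      exact Submodule.add_mem_sup (Submodule.smul_mem _ _ ⟨y, rfl⟩)
        (Submodule.smul_mem _ _ (Submodule.mem_span_singleton_self _))
    have h6 := (Submodule.finrank_mono hle).trans
      (Submodule.finrank_add_le_finrank_add_finrank _ _)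
    have h7 : Module.finrank F (Submodule.span F {A.col j}) ≤ 1 := by
      simpa using finrank_span_le_card ({A.col j} : Set (m → F))
    rw [Matrix.rank, Matrix.rank]
    omega

end Elimination

/-- The matrix over the field with `p` elements with the given entries, row by row. -/
def toMat (n p : ℕ) (f : ℕ → ℕ) : Matrix (Fin n) (Fin n) (ZMod p) :=
  Matrix.of fun k l => (f (k * n + l) : ZMod p)

lemma Nat.div_mod_of_flat {n k l : ℕ} (hl : l < n) :
    (k * n + l) / n = k ∧ (k * n + l) % n = l := by
  have hn : 0 < n := by omega
  constructor
  · rw [mul_comm, Nat.mul_add_div hn, Nat.div_eq_of_lt hl, add_zero]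
  · rw [mul_comm, Nat.mul_add_mod, Nat.mod_eq_of_lt hl]

lemma Nat.flat_lt {n k l : ℕ} (hk : k < n) (hl : l < n) : k * n + l < n * n := by nlinarith

namespace Instance

variable (c : Instance)

/-- The entries of the Tutte matrix for the death times `d` at the point `z`, as numbers below
`p`. -/
def entry (d z : ℕ → ℕ) (e : ℕ) : ℕ :=
  if c.avail d (e / c.n) (e % c.n) = 0 then 0
  else if e % c.n < e / c.n then z e else (c.p - z (e % c.n * c.n + e / c.n)) % c.p

lemma toMat_entry (d z : ℕ → ℕ) (hz : ∀ e < c.n * c.n, z e < c.p) :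
    toMat c.n c.p (c.entry d z) = tutteMatrix (c.graph d) fun k => (z k : ZMod c.p) := by
  ext k l
  obtain ⟨h1, h2⟩ := Nat.div_mod_of_flat (k := k) l.2
  have hadj : (c.graph d).Adj k l ↔ c.avail d k l ≠ 0 := by
    refine ⟨fun h => h.2, fun h => ⟨?_, h⟩⟩
    rintro rfl
    rw [avail_ne_zero_iff, c.G_self] at h
    exact h.1 rfl
  simp only [toMat, tutteMatrix, Matrix.of_apply, entry, h1, h2, hadj, Fin.lt_def]
  have e1 : ((finProdFinEquiv (k, l) : Fin (c.n * c.n)) : ℕ) = k * c.n + l := by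
    simp [finProdFinEquiv, mul_comm, add_comm]
  have e2 : ((finProdFinEquiv (l, k) : Fin (c.n * c.n)) : ℕ) = l * c.n + k := by
    simp [finProdFinEquiv, mul_comm, add_comm]
  rw [e1, e2]
  by_cases h : c.avail d k l = 0
  · simp [h]
  · rw [if_neg h, if_pos h]
    split_ifs
    · rfl
    · rw [ZMod.natCast_mod, Nat.cast_sub (hz _ (Nat.flat_lt l.2 k.2)).le]
      simp

/-- The pivot of an elimination step: the last nonzero entry (plus one). -/
def pivot (f : ℕ → ℕ) : ℕ := lastIdx (fun e => f e ≠ 0) (c.n * c.n)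

/-- The entries after an elimination step with the pivot `(i, j)`. -/
def elim (f : ℕ → ℕ) (i j e : ℕ) : ℕ :=
  (f (i * c.n + j) * f e + (c.p - f (e / c.n * c.n + j)) * f (i * c.n + e % c.n)) % c.p

lemma toMat_elim {f : ℕ → ℕ} (hf : ∀ e < c.n * c.n, f e < c.p) (i j : Fin c.n) :
    toMat c.n c.p (c.elim f i j) = (toMat c.n c.p f).eliminate i j := by
  ext k l
  obtain ⟨h1, h2⟩ := Nat.div_mod_of_flat (k := k) l.2
  simp only [toMat, Matrix.of_apply, elim, h1, h2, Matrix.eliminate]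
  rw [ZMod.natCast_mod, Nat.cast_add, Nat.cast_mul, Nat.cast_mul,
    Nat.cast_sub (hf _ (Nat.flat_lt k.2 j.2)).le, ZMod.natCast_self]
  ring

lemma rank_elim_of_pivot {f : ℕ → ℕ} (hf : ∀ e < c.n * c.n, f e < c.p) {e : ℕ}
    (he : c.pivot f = e + 1) :
    (toMat c.n c.p (c.elim f (e / c.n) (e % c.n))).rank + 1 = (toMat c.n c.p f).rank := by
  obtain ⟨h1, h2, -⟩ := lastIdx_eq_succ he
  have hn : 0 < c.n := Nat.pos_of_ne_zero fun h => by simp [h] at h1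
  have hi : e / c.n < c.n := Nat.div_lt_of_lt_mul h1
  have hj : e % c.n < c.n := Nat.mod_lt _ hn
  refine (congrArg (fun A => Matrix.rank A + 1)
    (c.toMat_elim hf ⟨e / c.n, hi⟩ ⟨e % c.n, hj⟩)).trans (Matrix.rank_eliminate ?_)
  simp only [toMat, Matrix.of_apply]
  rw [show e / c.n * c.n + e % c.n = e by rw [mul_comm]; exact Nat.div_add_mod e c.n, Ne,
    ZMod.natCast_eq_zero_iff]
  exact Nat.not_dvd_of_pos_of_lt (Nat.pos_of_ne_zero h2) (hf e h1)

lemma toMat_eq_zero_of_pivot {f : ℕ → ℕ} (h : c.pivot f = 0) : toMat c.n c.p f = 0 := by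
  ext k l
  have := lastIdx_eq_zero h _ (Nat.flat_lt k.2 l.2)
  simp only [not_not] at this
  simp [toMat, this]

lemma toMat_elim_eq_zero_of_pivot {f : ℕ → ℕ} (h : c.pivot f = 0) :
    toMat c.n c.p (c.elim f 0 0) = 0 := by
  have h0 := lastIdx_eq_zero h
  ext k l
  obtain ⟨h1, h2⟩ := Nat.div_mod_of_flat (k := k) l.2
  have h3 := h0 _ (Nat.flat_lt k.2 l.2)
  have h4 := h0 _ (Nat.flat_lt k.pos l.2)
  simp only [not_not] at h3 h4
  simp only [toMat, elim, Matrix.of_apply, h2, h3, h4, mul_zero, add_zero, Nat.zero_mod,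
    Nat.cast_zero, Matrix.zero_apply]

end Instance

namespace Sampler

open RProg

variable {ω : ℕ → Bool} {X : ℕ} {c : Instance} {s : RState}

/-- Compute the evaluation point of the Tutte matrix. -/
def pointProg : RProg := forTo v_x v_nn <|
  seq (store a_z (.var v_x) (.mod (.var v_R) (.var v_p)))
    (assign v_R (.div (.var v_R) (.var v_p)))

lemma sat_pointProg (hE : Env c s) (hF : Fits c X) {r : ℕ} (hR : s.var v_R = r) :
    Sat ω X pointProg s fun s' => ∀ k < c.n * c.n, s'.arr a_z k = c.point r k := by
  refine (Sat.forTo (fun k s' => s'.var v_R = r / c.p ^ k ∧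
    ∀ x < k, s'.arr a_z x = c.point r x) hE.nn (hN := hF.nn)
    (hinv := fun _ _ _ h => by simpa using h) (h0 := by simp [hR])
    (hstep := fun k hk s' hs' hag hi hI => ?_)).imp fun s' _ _ h => h.2
  obtain ⟨h1, h2⟩ := hI
  have hp := (hE.mono hag).p
  have hb : r / c.p ^ k < 2 ^ X := h1 ▸ hs'.var _
  refine Sat.seq (R := fun s₁ => s₁ = s'.setArr a_z k (c.point r k)) ?_ ?_
  · refine Sat.store_of_eq k _ (by simpa [RExpr.eval] using hi)
      (by simp [RExpr.eval, h1, hp, Instance.point]) ?_ rfl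
    exact (Nat.mod_le _ _).trans_lt hb
  · rintro s₁ - - rfl
    refine Sat.assign_of_eq (r / c.p ^ (k + 1)) ?_ ?_ ⟨by simp, ?_⟩
    · simp [RExpr.eval, h1, hp, Nat.div_div_eq_div_mul, pow_succ]
    · rw [pow_succ, ← Nat.div_div_eq_div_mul]
      exact (Nat.div_le_self _ _).trans_lt hb
    · intro x hx
      simp only [RState.setVar_arr, RState.setArr_arr, true_and]
      split_ifs with h
      · rw [h]
      · exact h2 x (by omega)

/-- Whether the edge with the row `v_k` and the column `v_l` is available. -/
def availExpr : RExpr :=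
  .mul (.mul (.get a_G (.var v_x))
    (.sub (.const 1) (.sub (.get a_thr (.var v_x)) (.get a_d (.var v_k)))))
    (.sub (.const 1) (.sub (.get a_thr (.var v_x)) (.get a_d (.var v_l))))

/-- Compute the Tutte matrix and the last available edge. -/
def matrixProg : RProg :=
  seq (assign v_last (.const 0)) <| forTo v_x v_nn <|
  seq (assign v_k (.div (.var v_x) (.var v_n))) <|
  seq (assign v_l (.mod (.var v_x) (.var v_n))) <|
  ite availExpr
    (ite (.le (.add (.var v_l) (.const 1)) (.var v_k))
      (seq (assign v_last (.add (.var v_x) (.const 1)))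
        (store a_A (.var v_x) (.get a_z (.var v_x))))
      (store a_A (.var v_x) (.mod (.sub (.var v_p) (.get a_z (.add (.mul (.var v_l) (.var v_n))
        (.var v_k)))) (.var v_p))))
    (store a_A (.var v_x) (.const 0))

lemma sat_matrixProg (hE : Env c s) (hF : Fits c X) {d z : ℕ → ℕ}
    (hd : ∀ x < c.n, s.arr a_d x = d x) (hz : ∀ e < c.n * c.n, s.arr a_z e = z e)
    (hzp : ∀ e < c.n * c.n, z e < c.p) :
    Sat ω X matrixProg s fun s' => s'.var v_last = c.lastEdge d ∧
      ∀ e < c.n * c.n, s'.arr a_A e = c.entry d z e := by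
  have hp2 : c.p < 2 ^ X := Nat.lt_two_pow_of_le hF.p
  refine Sat.assign_seq 0 rfl (by positivity) ?_
  refine Sat.forTo (fun k s' => s'.var v_last = lastIdx (fun e =>
      c.avail d (e / c.n) (e % c.n) ≠ 0 ∧ e % c.n < e / c.n) k ∧
      ∀ x < k, s'.arr a_A x = c.entry d z x) (N := c.n * c.n) (by simpa using hE.nn) (hN := hF.nn)
    (hinv := fun _ _ _ h => by simpa using h) (h0 := by simp [lastIdx])
    (hstep := fun e he s' hs' hag hi hI => ?_)
  have hE' : Env c s' := by
    have : Env c (s.setVar v_last 0) :=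
      hE.mono (p := assign v_last (.const 0)) (Exec.assign (ω := ω) s v_last (.const 0)).agree
    exact this.mono hag
  have hn : 0 < c.n := Nat.pos_of_ne_zero fun h => by simp [h] at he
  have hk : e / c.n < c.n := Nat.div_lt_of_lt_mul he
  have hl : e % c.n < c.n := Nat.mod_lt _ hn
  have hflat : e / c.n * c.n + e % c.n = e := by rw [mul_comm]; exact Nat.div_add_mod e c.n
  have heX : e + 1 < 2 ^ X := Nat.lt_two_pow_of_le (he.trans_le hF.nn)
  have hd' : ∀ x < c.n, s'.arr a_d x = d x := fun x hx => by
    rw [hag.arr a_d rfl]; exact hd x hx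
  have hz' : ∀ x < c.n * c.n, s'.arr a_z x = z x := fun x hx => by
    rw [hag.arr a_z rfl]; exact hz x hx
  refine Sat.assign_seq (e / c.n) (by simp [RExpr.eval, hi, hE'.n])
    ((Nat.div_le_self _ _).trans_lt (by omega)) ?_
  refine Sat.assign_seq (e % c.n) (by simp [RExpr.eval, hi, hE'.n])
    ((Nat.mod_le _ _).trans_lt (by omega)) ?_
  have hav : availExpr.eval ((s'.setVar v_k (e / c.n)).setVar v_l (e % c.n)) =
      c.avail d (e / c.n) (e % c.n) := by
    have hG := hE'.G _ hk _ hl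
    have hthr := hE'.thr _ hk _ hl
    rw [hflat] at hG hthr
    simp [availExpr, RExpr.eval, hi, hd' _ hk, hd' _ hl, hG, hthr, Instance.avail]
  -- the entry `e` is written, and the earlier ones are kept
  have hstore : ∀ (s₁ : RState) (v : ℕ), s₁.arr a_A = s'.arr a_A → v = c.entry d z e →
      ∀ x < e + 1, (s₁.setArr a_A e v).arr a_A x = c.entry d z x := by
    intro s₁ v hs₁ hv x hx
    simp only [RState.setArr_arr, true_and]
    split_ifs with h
    · rw [h, hv]
    · rw [hs₁]; exact hI.2 x (by omega)
  refine Sat.ite (fun h => ?_) fun h => ?_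
  · rw [hav] at h
    refine Sat.ite (fun h' => ?_) fun h' => ?_
    · have hlt : e % c.n < e / c.n := by
        by_contra hcon
        simp [RExpr.eval] at h'
        omega
      refine Sat.assign_seq (e + 1) (by simp [RExpr.eval, hi]) heX ?_
      refine Sat.store_of_eq e (z e) (by simp [RExpr.eval, hi])
        (by simp [RExpr.eval, hi, hz' e he]) ((hzp e he).trans hp2) ⟨?_, ?_⟩
      · simp [lastIdx, h, hlt]
      · refine hstore _ _ rfl ?_
        rw [Instance.entry, if_neg h, if_pos hlt]
    · have hlt : ¬e % c.n < e / c.n := by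
        intro hcon
        simp [RExpr.eval] at h'
        omega
      refine Sat.store_of_eq e ((c.p - z (e % c.n * c.n + e / c.n)) % c.p)
        (by simp [RExpr.eval, hi])
        (by simp [RExpr.eval, hE'.n, hE'.p, hz' _ (Nat.flat_lt hl hk)])
        ((Nat.mod_lt _ c.p_prime.pos).trans hp2) ⟨?_, ?_⟩
      · simp [lastIdx, hlt, hI.1]
      · refine hstore _ _ rfl ?_
        rw [Instance.entry, if_neg h, if_neg hlt]
  · rw [hav] at h
    refine Sat.store_of_eq e 0 (by simp [RExpr.eval, hi]) rfl (by positivity) ⟨?_, ?_⟩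
    · simp [lastIdx, h, hI.1]
    · refine hstore _ _ rfl ?_
      rw [Instance.entry, if_pos h]

/-- Find a pivot and count it. If the matrix vanishes, then nothing is counted, and the pivot `(0, 0)`
of the following elimination step does no harm. -/
def pivotProg : RProg :=
  seq (assign v_piv (.const 0)) <|
  seq (forTo v_x v_nn (ite (.get a_A (.var v_x)) (assign v_piv (.add (.var v_x) (.const 1))) skip)) <|
  seq (assign v_cnt (.add (.var v_cnt) (.sub (.const 1) (.sub (.const 1) (.var v_piv))))) <|
  seq (assign v_row (.div (.sub (.var v_piv) (.const 1)) (.var v_n)))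
    (assign v_col (.mod (.sub (.var v_piv) (.const 1)) (.var v_n)))

/-- The entry `v_x` after the elimination step. -/
def elimExpr : RExpr :=
  .mod (.add (.mul (.get a_A (.add (.mul (.var v_row) (.var v_n)) (.var v_col)))
      (.get a_A (.var v_x)))
    (.mul (.sub (.var v_p) (.get a_A (.add (.mul (.div (.var v_x) (.var v_n)) (.var v_n))
        (.var v_col))))
      (.get a_A (.add (.mul (.var v_row) (.var v_n)) (.mod (.var v_x) (.var v_n)))))) (.var v_p)

/-- Compute the rank of the matrix. -/
def rankProg : RProg :=
  seq (assign v_cnt (.const 0)) <| forTo v_t v_n <|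
  seq pivotProg <| seq (fill v_x v_nn a_B elimExpr) (fill v_x v_nn a_A (.get a_B (.var v_x)))

lemma sat_pivotProg (hE : Env c s) (hF : Fits c X) {f : ℕ → ℕ} {m : ℕ}
    (hf : ∀ e < c.n * c.n, s.arr a_A e = f e) (hm : s.var v_cnt = m) (hmX : m < X) :
    Sat ω X pivotProg s fun s' => s'.var v_cnt = m + (1 - (1 - c.pivot f)) ∧
      s'.var v_row = (c.pivot f - 1) / c.n ∧ s'.var v_col = (c.pivot f - 1) % c.n := by
  refine Sat.assign_seq 0 rfl (by positivity) ?_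
  have hE0 : Env c (s.setVar v_piv 0) :=
    hE.mono (p := assign v_piv (.const 0)) (Exec.assign (ω := ω) s v_piv (.const 0)).agree
  have hpX : c.pivot f ≤ X := (lastIdx_le _ _).trans hF.nn
  refine Sat.seq (Sat.forTo (fun k s' => s'.var v_piv = lastIdx (fun e => f e ≠ 0) k)
    (N := c.n * c.n) (by simpa using hE.nn) (hN := hF.nn)
    (hinv := fun _ _ _ h => by simpa using h) (h0 := by simp [lastIdx])
    (hstep := fun e he s' hs' hag hi hI => ?_)) ?_
  · have hA : s'.arr a_A e = f e := by rw [hag.arr a_A rfl]; exact hf e he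
    refine Sat.ite (fun h => ?_) fun h => ?_
    · simp only [RExpr.eval, hi, hA] at h
      refine Sat.assign_of_eq (e + 1) (by simp [RExpr.eval, hi])
        (Nat.lt_two_pow_of_le (he.trans_le hF.nn)) ?_
      simp [lastIdx, h]
    · simp only [RExpr.eval, hi, hA] at h
      refine Sat.skip ?_
      simp [lastIdx, h, hI]
  · rintro s₁ hs₁ hag hpiv
    change s₁.var v_piv = c.pivot f at hpiv
    have hn := (hE0.mono hag).n
    have hm₁ : s₁.var v_cnt = m := by rw [hag.var _ rfl]; simpa using hm
    refine Sat.assign_seq (m + (1 - (1 - c.pivot f))) (by simp [RExpr.eval, hpiv, hm₁])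
      (Nat.lt_two_pow_of_le (by omega)) ?_
    refine Sat.assign_seq ((c.pivot f - 1) / c.n) (by simp [RExpr.eval, hpiv, hn])
      (Nat.lt_two_pow_of_le ((Nat.div_le_self _ _).trans (by omega))) ?_
    refine Sat.assign_of_eq ((c.pivot f - 1) % c.n) (by simp [RExpr.eval, hpiv, hn])
      (Nat.lt_two_pow_of_le ((Nat.mod_le _ _).trans (by omega))) ?_
    simp

/-- Every round of elimination removes one from the rank and adds one to the counter, until the
matrix vanishes, which happens after at most `n` rounds. -/
lemma sat_rankProg (hE : Env c s) (hF : Fits c X) {f : ℕ → ℕ}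
    (hf : ∀ e < c.n * c.n, s.arr a_A e = f e) (hfp : ∀ e < c.n * c.n, f e < c.p) :
    Sat ω X rankProg s fun s' => s'.var v_cnt = (toMat c.n c.p f).rank := by
  refine Sat.assign_seq 0 rfl (by positivity) ?_
  have hE0 : Env c (s.setVar v_cnt 0) :=
    hE.mono (p := assign v_cnt (.const 0)) (Exec.assign (ω := ω) s v_cnt (.const 0)).agree
  have hp2 : c.p < 2 ^ X := Nat.lt_two_pow_of_le hF.p
  have hend : ∀ s' : RState, (∃ g : ℕ → ℕ, (∀ e < c.n * c.n, s'.arr a_A e = g e) ∧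
      (∀ e < c.n * c.n, g e < c.p) ∧
      s'.var v_cnt + (toMat c.n c.p g).rank = (toMat c.n c.p f).rank ∧
      (toMat c.n c.p g).rank ≤ c.n - c.n) → s'.var v_cnt = (toMat c.n c.p f).rank := by
    rintro s' ⟨g, -, -, h1, h2⟩
    omega
  refine Sat.imp ?_ fun s' _ _ => hend s'
  refine Sat.forTo (fun t s' => ∃ g : ℕ → ℕ, (∀ e < c.n * c.n, s'.arr a_A e = g e) ∧
      (∀ e < c.n * c.n, g e < c.p) ∧
      s'.var v_cnt + (toMat c.n c.p g).rank = (toMat c.n c.p f).rank ∧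
      (toMat c.n c.p g).rank ≤ c.n - t) (N := c.n) (by simpa using hE.n) (hN := hF.n)
    (hinv := fun _ _ _ h => by simpa using h)
    (h0 := ⟨f, hf, hfp, by simp, Matrix.rank_le_width _⟩)
    (hstep := fun t ht s' hs' hag hi hI => ?_)
  obtain ⟨g, hg, hgp, hcnt, hrk⟩ := hI
  have hE' := hE0.mono hag
  have hn : 0 < c.n := by omega
  have hpp := c.p_prime.pos
  have hrk0 : (toMat c.n c.p f).rank ≤ c.n := Matrix.rank_le_width _
  set i := (c.pivot g - 1) / c.n with hi_def
  set j := (c.pivot g - 1) % c.n with hj_def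
  have hpn : c.pivot g ≤ c.n * c.n := lastIdx_le _ _
  have hnn : 0 < c.n * c.n := Nat.mul_pos hn hn
  have hi_lt : i < c.n := Nat.div_lt_of_lt_mul (by omega)
  have hj_lt : j < c.n := Nat.mod_lt _ hn
  by_cases hfull : s'.var v_cnt < X
  swap
  · -- the count cannot exceed the bound
    exfalso
    have := hF.n
    have := hF.nn
    have h3 : s'.var v_cnt = c.n ∧ c.n = X := by omega
    have h4 : c.n * c.n ≤ c.n * 1 := by omega
    have h5 : c.n ≤ 1 := Nat.le_of_mul_le_mul_left h4 hn
    have := hF.p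
    have := c.two_lt_p
    omega
  refine Sat.seq (sat_pivotProg hE' hF hg rfl hfull) ?_
  rintro s₁ hs₁ ha₁ ⟨hc₁, hr₁, hl₁⟩
  have hE₁ := hE'.mono ha₁
  have hg₁ : ∀ e < c.n * c.n, s₁.arr a_A e = g e := fun e he => by
    rw [ha₁.arr a_A rfl]; exact hg e he
  have helim : ∀ e, c.elim g i j e < 2 ^ X := fun e => (Nat.mod_lt _ hpp).trans hp2
  refine Sat.seq (Sat.fill (c.elim g i j) hE₁.nn hF.nn
    (hf := fun e he s₂ hag₂ hi₂ _ => ⟨?_, helim e⟩)) ?_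
  · have hE₂ := hE₁.mono hag₂
    have hg₂ : ∀ e < c.n * c.n, s₂.arr a_A e = g e := fun e he => by
      rw [hag₂.arr a_A rfl]; exact hg₁ e he
    have hr₂ : s₂.var v_row = i := (hag₂.var _ rfl).trans hr₁
    have hl₂ : s₂.var v_col = j := (hag₂.var _ rfl).trans hl₁
    simp only [elimExpr, RExpr.eval, RExpr.eval_mod, hr₂, hl₂, hi₂, hE₂.n, hE₂.p]
    rw [hg₂ _ (Nat.flat_lt hi_lt hj_lt), hg₂ _ he,
      hg₂ _ (Nat.flat_lt (Nat.div_lt_of_lt_mul he) hj_lt),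
      hg₂ _ (Nat.flat_lt hi_lt (Nat.mod_lt _ hn)), Instance.elim]
  rintro s₂ hs₂ ha₂ hB
  have hE₂ := hE₁.mono ha₂
  refine (Sat.fill (c.elim g i j) hE₂.nn hF.nn
    (hf := fun e he s₃ hag₃ hi₃ _ => ⟨?_, helim e⟩)).imp ?_
  · simp only [RExpr.eval, hi₃]
    rw [hag₃.arr a_B rfl, hB e he]
  rintro s₃ hs₃ ha₃ hA
  refine ⟨c.elim g i j, hA, fun e _ => Nat.mod_lt _ hpp, ?_⟩
  have hc₃ : s₃.var v_cnt = s'.var v_cnt + (1 - (1 - c.pivot g)) := by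
    rw [(ha₂.seq ha₃).var v_cnt rfl, hc₁]
  rcases hpiv : c.pivot g with - | e
  · have h0 : (toMat c.n c.p (c.elim g i j)).rank = 0 := by
      have hij : i = 0 ∧ j = 0 := by simp [hi_def, hj_def, hpiv]
      rw [hij.1, hij.2, c.toMat_elim_eq_zero_of_pivot hpiv, Matrix.rank_zero]
    have h1 : (toMat c.n c.p g).rank = 0 := by
      rw [c.toMat_eq_zero_of_pivot hpiv, Matrix.rank_zero]
    rw [hpiv] at hc₃
    omega
  · have h1 := c.rank_elim_of_pivot hgp hpiv
    have hij : i = e / c.n ∧ j = e % c.n := by simp [hi_def, hj_def, hpiv]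
    rw [← hij.1, ← hij.2] at h1
    rw [hpiv] at hc₃
    omega

end Sampler

/-! ### The program: summing the samples -/

namespace Instance

variable (c : Instance)

lemma sampleVal_le (u v R : ℕ) : c.sampleVal u v R ≤ c.D ^ c.n * c.n := by
  rw [sampleVal]
  split_ifs
  · exact Nat.mul_le_mul (c.edgeW_le u v le_rfl) (c.tutteRank_le _ _)
  · positivity

/-- The contribution of the pair with the number `e` to the sample. -/
noncomputable def sampleTerm (R e : ℕ) : ℕ :=
  if c.G (e / c.n) (e % c.n) ≠ 0 ∧ e % c.n < e / c.n then c.sampleVal (e / c.n) (e % c.n) R else 0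

lemma sampleTerm_le (R e : ℕ) : c.sampleTerm R e ≤ c.D ^ c.n * c.n := by
  rw [sampleTerm]
  split_ifs
  · exact c.sampleVal_le _ _ _
  · positivity

lemma sum_sampleTerm_le (R m : ℕ) :
    ∑ e ∈ Finset.range m, c.sampleTerm R e ≤ m * (c.D ^ c.n * c.n) := by
  simpa using Finset.sum_le_card_nsmul (Finset.range m) _ _ fun e _ => c.sampleTerm_le R e

lemma sample_le_pow (R : ℕ) : c.sample R ≤ c.n * c.n * (c.D ^ c.n * c.n) :=
  c.sum_sampleTerm_le R (c.n * c.n)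

end Instance

namespace Sampler

open RProg

variable {ω : ℕ → Bool} {X : ℕ} {c : Instance} {s : RState}

/-- Prepare the sampling for the edge with the number `v_e`. -/
def edgeHead : RProg :=
  seq (assign v_u (.div (.var v_e) (.var v_n))) <|
  seq (assign v_v (.mod (.var v_e) (.var v_n))) <|
  seq (assign v_c (.get a_thr (.var v_e))) <|
  seq (assign v_R (.var v_S)) (assign v_W (.const 1))

/-- Add the contribution of the edge with the number `v_e` to the sum of all samples. -/
def edgeProg : RProg :=
  seq edgeHead <| seq deathProg <| seq pointProg <| seq matrixProg <|
  ite (.ne (.var v_last) (.add (.var v_e) (.const 1))) skip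
    (seq rankProg (assign v_total (.add (.var v_total) (.mul (.var v_W) (.var v_cnt)))))

/-- Add one sample to the sum of all samples. -/
def sampleProg : RProg :=
  forTo v_e v_nn (ite (.mul (.get a_G (.var v_e)) (.le (.add (.mod (.var v_e) (.var v_n))
    (.const 1)) (.div (.var v_e) (.var v_n)))) edgeProg skip)

/-- Draw a random number with `v_K` binary digits. -/
def drawProg : RProg :=
  seq (assign v_S (.const 0)) <| forTo v_bit v_K <|
  seq (toss v_coin) (assign v_S (.add (.mul (.const 2) (.var v_S)) (.var v_coin)))

/-- Sum `v_N` samples. -/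
def sumProg : RProg :=
  seq (assign v_total (.const 0)) <| forTo v_j v_N (seq drawProg sampleProg)

lemma sat_edgeHead (hE : Env c s) (hX : 0 < X) {e R : ℕ} (he : e < c.n * c.n)
    (hev : s.var v_e = e) (hS : s.var v_S = R) :
    Sat ω X edgeHead s fun s' => s'.var v_u = e / c.n ∧ s'.var v_v = e % c.n ∧
      s'.var v_c = c.thr (e / c.n) (e % c.n) ∧ s'.var v_R = R ∧ s'.var v_W = 1 := by
  refine Sat.of_bounded fun hs => ?_
  have hn : 0 < c.n := Nat.pos_of_ne_zero fun h => by simp [h] at he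
  have hflat : e / c.n * c.n + e % c.n = e := by rw [mul_comm]; exact Nat.div_add_mod e c.n
  have hthr := hE.thr _ (Nat.div_lt_of_lt_mul he) _ (Nat.mod_lt e hn)
  rw [hflat] at hthr
  have heX : e < 2 ^ X := hev ▸ hs.var _
  refine Sat.assign_seq (e / c.n) (by simp [RExpr.eval, hev, hE.n])
    ((Nat.div_le_self _ _).trans_lt heX) ?_
  refine Sat.assign_seq (e % c.n) (by simp [RExpr.eval, hev, hE.n])
    ((Nat.mod_le _ _).trans_lt heX) ?_
  refine Sat.assign_seq (c.thr (e / c.n) (e % c.n)) (by simp [RExpr.eval, hev, hthr])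
    (hthr ▸ hs.arr _ _) ?_
  refine Sat.assign_seq R (by simp [RExpr.eval, hS]) (hS ▸ hs.var _) ?_
  exact Sat.assign_of_eq 1 rfl (Nat.one_lt_two_pow hX.ne') (by simp)

lemma sat_edgeProg (hE : Env c s) (hF : Fits c X) {e R M : ℕ} (he : e < c.n * c.n)
    (hev : s.var v_e = e) (hS : s.var v_S = R) (hT : s.var v_total = M)
    (hM : M + c.D ^ c.n * c.n < 2 ^ X) :
    Sat ω X edgeProg s fun s' => s'.var v_total = M + c.sampleVal (e / c.n) (e % c.n) R := by
  have hflat : e / c.n * c.n + e % c.n = e := by rw [mul_comm]; exact Nat.div_add_mod e c.n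
  have hX : 0 < X := c.p_prime.pos.trans_le hF.p
  refine Sat.seq (sat_edgeHead hE hX he hev hS) ?_
  rintro s₁ - ha₁ ⟨hu, hv, hc, hR, hW⟩
  have hE₁ := hE.mono ha₁
  refine Sat.seq (sat_deathProg hE₁ hF hu hv hc hR hW) ?_
  rintro s₂ - ha₂ ⟨hR₂, hW₂, hd₂⟩
  have hE₂ := hE₁.mono ha₂
  refine Sat.seq (sat_pointProg hE₂ hF hR₂) ?_
  rintro s₃ - ha₃ hz₃
  have hE₃ := hE₂.mono ha₃
  have hzp : ∀ k < c.n * c.n, c.point (R / c.edgeW (e / c.n) (e % c.n) c.n) k < c.p :=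
    fun k _ => Nat.mod_lt _ c.p_prime.pos
  refine Sat.seq (sat_matrixProg hE₃ hF (d := c.death (e / c.n) (e % c.n) R)
    (fun x hx => by rw [ha₃.arr a_d rfl]; exact hd₂ x hx) hz₃ hzp) ?_
  rintro s₄ - ha₄ ⟨hlast, hA⟩
  have hE₄ := hE₃.mono ha₄
  have h4 := ha₁.seq (ha₂.seq (ha₃.seq ha₄))
  have he₄ : s₄.var v_e = e := (h4.var _ rfl).trans hev
  have hT₄ : s₄.var v_total = M := (h4.var _ rfl).trans hT
  have hW₄ : s₄.var v_W = c.edgeW (e / c.n) (e % c.n) c.n :=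
    ((ha₃.seq ha₄).var _ rfl).trans hW₂
  refine Sat.ite (fun h => ?_) fun h => ?_
  · simp only [RExpr.eval_ne, RExpr.eval, he₄, hlast, ne_eq, ite_eq_left_iff, one_ne_zero,
      imp_false, not_not] at h
    refine Sat.skip ?_
    rw [hT₄, Instance.sampleVal, if_neg (by rwa [hflat]), add_zero]
  · simp only [RExpr.eval_ne, RExpr.eval, he₄, hlast, ite_eq_left_iff, one_ne_zero,
      imp_false, not_not] at h
    refine Sat.seq (sat_rankProg hE₄ hF hA fun k hk => ?_) ?_
    · rw [Instance.entry]
      split_ifs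
      · exact c.p_prime.pos
      · exact hzp k hk
      · exact Nat.mod_lt _ c.p_prime.pos
    · rintro s₅ - ha₅ hcnt
      rw [c.toMat_entry _ _ hzp] at hcnt
      have hval : c.sampleVal (e / c.n) (e % c.n) R =
          c.edgeW (e / c.n) (e % c.n) c.n * s₅.var v_cnt := by
        rw [Instance.sampleVal, if_pos (by rwa [hflat]), hcnt, Instance.tutteRank]
      refine Sat.assign_of_eq (M + c.sampleVal (e / c.n) (e % c.n) R) ?_ ?_ (by simp)
      · simp only [RExpr.eval]
        rw [hval, ha₅.var v_total rfl, ha₅.var v_W rfl, hT₄, hW₄]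
      · exact (Nat.add_le_add_left (c.sampleVal_le _ _ _) _).trans_lt hM

lemma sat_sampleProg (hE : Env c s) (hF : Fits c X) {R M : ℕ} (hS : s.var v_S = R)
    (hT : s.var v_total = M) (hM : M + c.n * c.n * (c.D ^ c.n * c.n) < 2 ^ X) :
    Sat ω X sampleProg s fun s' => s'.var v_total = M + c.sample R := by
  refine Sat.forTo (fun k s' => s'.var v_total = M + ∑ e ∈ Finset.range k, c.sampleTerm R e)
    hE.nn (hN := hF.nn) (hinv := fun _ _ _ h => by simpa using h) (h0 := by simpa using hT)
    (hstep := fun e he s' hs' hag hi hI => ?_)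
  have hE' := hE.mono hag
  have hn : 0 < c.n := Nat.pos_of_ne_zero fun h => by simp [h] at he
  have hflat : e / c.n * c.n + e % c.n = e := by rw [mul_comm]; exact Nat.div_add_mod e c.n
  have hG := hE'.G _ (Nat.div_lt_of_lt_mul he) _ (Nat.mod_lt e hn)
  rw [hflat] at hG
  have hcond : ∀ b : ℕ, b = RExpr.eval s' (.mul (.get a_G (.var v_e)) (.le (.add (.mod (.var v_e)
      (.var v_n)) (.const 1)) (.div (.var v_e) (.var v_n)))) →
      (b ≠ 0 ↔ c.G (e / c.n) (e % c.n) ≠ 0 ∧ e % c.n < e / c.n) := by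
    rintro b rfl
    simp [RExpr.eval, hi, hG, hE'.n, and_comm]
  rw [Finset.sum_range_succ, ← add_assoc]
  refine Sat.ite (fun h => ?_) fun h => ?_
  · rw [hcond _ rfl] at h
    refine (sat_edgeProg hE' hF he hi ((hag.var _ rfl).trans hS) hI ?_).imp fun s₁ _ _ h₁ => ?_
    · refine lt_of_le_of_lt ?_ hM
      have h1 := c.sum_sampleTerm_le R e
      have h2 : (e + 1) * (c.D ^ c.n * c.n) ≤ c.n * c.n * (c.D ^ c.n * c.n) :=
        Nat.mul_le_mul_right _ he
      rw [add_mul, one_mul] at h2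
      omega
    · rw [h₁, Instance.sampleTerm, if_pos h]
  · have h' := (hcond _ rfl).not.1 (not_not.2 h)
    refine Sat.skip ?_
    rw [hI, Instance.sampleTerm, if_neg h', add_zero]

/-- The number drawn is determined by the coins tossed meanwhile. -/
lemma sat_drawProg (hX : 0 < X) {K m : ℕ} (hK : s.var v_K = K) (hKX : K ≤ X)
    (hm : s.coins = m) :
    Sat ω X drawProg s fun s' => s'.var v_S = blockNum ω m K ∧ s'.coins = m + K := by
  refine Sat.assign_seq 0 rfl (by positivity) ?_
  refine Sat.forTo (fun k s' => s'.var v_S = blockNum ω m k ∧ s'.coins = m + k) (N := K)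
    (by simpa using hK) (hN := hKX) (hinv := fun _ _ _ h => by simpa using h)
    (h0 := by simpa [blockNum] using hm) (hstep := fun k hk s' hs' hag hi hI => ?_)
  obtain ⟨h1, h2⟩ := hI
  refine Sat.seq (R := fun s₁ => s₁.var v_S = blockNum ω m k ∧ s₁.coins = m + k + 1 ∧
    s₁.var v_coin = if ω (m + k) = true then 1 else 0) (Sat.toss hX ?_) ?_
  · simp [h1, h2]
  · rintro s₁ - - ⟨g1, g2, g3⟩
    refine Sat.assign_of_eq (blockNum ω m (k + 1)) ?_ ?_ ⟨by simp, by simp [g2, add_assoc]⟩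
    · simp [RExpr.eval, g1, g3, blockNum]
    · exact (blockNum_lt ω m (k + 1)).trans_le (Nat.pow_le_pow_right (by norm_num) (by omega))

/-- The samples use consecutive blocks of `K` coins. -/
lemma sat_sumProg (hE : Env c s) (hF : Fits c X) {N K : ℕ} (hN : s.var v_N = N)
    (hK : s.var v_K = K) (hNX : N ≤ X) (hKX : K ≤ X) (h0 : s.coins = 0)
    (hM : N * (c.n * c.n * (c.D ^ c.n * c.n)) < 2 ^ X) :
    Sat ω X sumProg s fun s' =>
      s'.var v_total = ∑ j ∈ Finset.range N, c.sample (blockNum ω (j * K) K) := by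
  have hX : 0 < X := c.p_prime.pos.trans_le hF.p
  refine Sat.assign_seq 0 rfl (by positivity) ?_
  have hE0 : Env c (s.setVar v_total 0) :=
    hE.mono (p := assign v_total (.const 0)) (Exec.assign (ω := ω) s v_total (.const 0)).agree
  refine Sat.imp (R := fun s' => s'.var v_total =
    ∑ j ∈ Finset.range N, c.sample (blockNum ω (j * K) K) ∧ s'.coins = N * K) ?_
    fun _ _ _ h => h.1
  refine Sat.forTo (fun j s' => s'.var v_total =
    ∑ i ∈ Finset.range j, c.sample (blockNum ω (i * K) K) ∧ s'.coins = j * K) (N := N)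
    (by simpa using hN) (hN := hNX) (hinv := fun _ _ _ h => by simpa using h)
    (h0 := by simpa using h0) (hstep := fun j hj s' hs' hag hi hI => ?_)
  obtain ⟨h1, h2⟩ := hI
  have hK' : s'.var v_K = K := (hag.var _ rfl).trans (by simpa using hK)
  refine Sat.seq (sat_drawProg hX hK' hKX h2) ?_
  rintro s₁ - ha₁ ⟨hS, hco⟩
  refine (sat_sampleProg ((hE0.mono hag).mono ha₁) hF hS ((ha₁.var _ rfl).trans h1) ?_).imp
    fun s₂ _ ha₂ h3 => ⟨?_, ?_⟩
  · refine lt_of_le_of_lt ?_ hM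
    have h4 := Finset.sum_le_card_nsmul (Finset.range j)
      (fun i => c.sample (blockNum ω (i * K) K)) _ fun i _ => c.sample_le_pow _
    rw [Finset.card_range, smul_eq_mul] at h4
    have h5 := Nat.mul_le_mul_right (c.n * c.n * (c.D ^ c.n * c.n)) (Nat.succ_le_of_lt hj)
    rw [Nat.succ_eq_add_one, add_mul, one_mul] at h5
    omega
  · rw [h3, Finset.sum_range_succ]
  · rw [ha₂.coins rfl, hco, add_mul, one_mul]

end Sampler

/-! ### The program: reading the input and choosing the parameters -/

/-- The largest prime number in `(m, 2 * m]`. -/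
def fieldSize (m : ℕ) : ℕ := m + lastIdx (fun k => (m + 1 + k).Prime) m

/-- By Bertrand's postulate there is a prime to choose. -/
lemma fieldSize_spec {m : ℕ} (hm : m ≠ 0) :
    (fieldSize m).Prime ∧ m < fieldSize m ∧ fieldSize m ≤ 2 * m := by
  obtain ⟨q, hq, h1, h2⟩ := Nat.exists_prime_lt_and_le_two_mul m hm
  rw [fieldSize]
  rcases h : lastIdx (fun k => (m + 1 + k).Prime) m with - | k
  · have := lastIdx_eq_zero h (q - (m + 1)) (by omega)
    rw [Nat.add_sub_cancel' (by omega)] at this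
    exact absurd hq this
  · obtain ⟨h3, h4, -⟩ := lastIdx_eq_succ h
    rw [show m + (k + 1) = m + 1 + k by omega]
    exact ⟨h4, by omega, by omega⟩

lemma ADModel.length_encode (G : ADModel) : G.encode.length = G.offset G.n := by
  rw [encode_eq, List.length_append, List.length_append, length_adjList, List.length_flatMap,
    offset, Finset.sum_range, ← List.sum_ofFn, List.ofFn_eq_map]
  simp only [length_table, List.length_cons, List.length_nil, zero_add]

lemma ADModel.offset_mono (G : ADModel) {x y : ℕ} (h : x ≤ y) : G.offset x ≤ G.offset y :=
  Nat.add_le_add_left (Finset.sum_le_sum_of_subset (Finset.range_mono h)) _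

lemma ADModel.offset_succ (G : ADModel) (x : ℕ) :
    G.offset (x + 1) = G.offset x + (2 + 2 * G.span x) := by
  rw [offset, offset, Finset.sum_range_succ]; ring

namespace Sampler

open RProg

variable {ω : ℕ → Bool} {X : ℕ} {s : RState}

/-- Multiply the variable `y` by the power of the variable `b` with the exponent in the variable
`l`. -/
def powProg (y l b : ℕ) : RProg := forTo v_x l (assign y (.mul (.var y) (.var b)))

lemma sat_powProg {y l b m N q : ℕ} (hy : s.var y = m) (hl : s.var l = N) (hb : s.var b = q)
    (hq : 0 < q) (hN : N ≤ X) (hX : m * q ^ N < 2 ^ X) (hyx : y ≠ v_x := by decide)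
    (hlx : v_x ≠ l := by decide) (hbx : b ≠ v_x := by decide) (hyl : y ≠ l := by decide)
    (hyb : b ≠ y := by decide) :
    Sat ω X (powProg y l b) s fun s' => s'.var y = m * q ^ N := by
  have hb' : (powProg y l b).modsVar b = false := by
    simp [powProg, RProg.forTo, RProg.modsVar, hbx.symm, hyb.symm]
  refine Sat.forTo (fun k s' => s'.var y = m * q ^ k) hl hlx
    (by simp [RProg.modsVar, hyx]) (by simp [RProg.modsVar, hyl]) hN
    (fun _ _ _ h => by simpa [hyx] using h) (by simpa using hy) ?_
  intro k hk s' hs' hag hi hI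
  refine Sat.assign_of_eq (m * q ^ (k + 1)) ?_ ?_ (by simp)
  · rw [RExpr.eval, RExpr.eval, RExpr.eval, hI, hag.var b hb', hb, pow_succ, mul_assoc]
  · exact (Nat.mul_le_mul_left _ (Nat.pow_le_pow_right hq hk)).trans_lt hX

/-- Read the number of vertices, and compute the reciprocal of the accuracy. -/
def headProg : RProg :=
  seq (assign v_n (.get a_in (.var v_base))) <|
  seq (assign v_nn (.mul (.var v_n) (.var v_n)))
    (assign v_E (.add (.div (.get a_in (.const 1)) (.get a_in (.const 0))) (.const 1)))

lemma sat_headProg {n E base : ℕ} (hb : s.var v_base = base) (hn : s.arr a_in base = n)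
    (hE : s.arr a_in 1 / s.arr a_in 0 + 1 = E) (hnX : n * n < 2 ^ X) (hEX : E < 2 ^ X) :
    Sat ω X headProg s fun s' => s'.var v_n = n ∧ s'.var v_nn = n * n ∧ s'.var v_E = E := by
  refine Sat.assign_seq n (by simp [RExpr.eval, hb, hn])
    ((Nat.le_mul_self n).trans_lt hnX) ?_
  refine Sat.assign_seq (n * n) (by simp [RExpr.eval]) hnX ?_
  exact Sat.assign_of_eq E (by simp [RExpr.eval, hE]) hEX (by simp)

/-- Compute the positions of the tables of the vertices. -/
def offsetProg : RProg :=
  seq (assign v_o (.add (.add (.var v_base) (.const 1)) (.var v_nn))) <| forTo v_x v_n <|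
  seq (store a_off (.var v_x) (.var v_o))
    (assign v_o (.add (.var v_o) (.add (.const 2) (.mul (.const 2) (.sub
      (.add (.get a_in (.add (.var v_o) (.const 1))) (.const 1)) (.get a_in (.var v_o)))))))

lemma sat_offsetProg {G : ADModel} {base : ℕ} (hb : s.var v_base = base)
    (hin : ∀ i, s.arr a_in (base + i) = G.encode.getD i 0) (hn : s.var v_n = G.n)
    (hnn : s.var v_nn = G.n * G.n) (hnX : G.n ≤ X) (hX : base + G.offset G.n < 2 ^ X) :
    Sat ω X offsetProg s fun s' => ∀ x < G.n, s'.arr a_off x = base + G.offset x := by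
  have hX' : ∀ x ≤ G.n, base + G.offset x < 2 ^ X := fun x hx =>
    (Nat.add_le_add_left (G.offset_mono hx) _).trans_lt hX
  refine Sat.assign_seq (base + G.offset 0) ?_ (hX' 0 (Nat.zero_le _)) ?_
  · simp [RExpr.eval, hb, hnn, ADModel.offset]; ring
  refine Sat.imp (R := fun s' => s'.var v_o = base + G.offset G.n ∧
    ∀ x < G.n, s'.arr a_off x = base + G.offset x) ?_ fun _ _ _ h => h.2
  refine Sat.forTo (fun k s' => s'.var v_o = base + G.offset k ∧
    ∀ x < k, s'.arr a_off x = base + G.offset x) (N := G.n)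
    (by simpa using hn) (hN := hnX) (hinv := fun _ _ _ h => by simpa using h)
    (h0 := by simp) (hstep := fun k hk s' hs' hag hi hI => ?_)
  obtain ⟨h1, h2⟩ := hI
  have hin' : ∀ i, s'.arr a_in (base + i) = G.encode.getD i 0 := fun i => by
    rw [hag.arr a_in rfl]; exact hin i
  have ha := ADModel.getD_encode_a (G := G) ⟨k, hk⟩
  have hb := ADModel.getD_encode_b (G := G) ⟨k, hk⟩
  have hspan : G.span k = G.b ⟨k, hk⟩ + 1 - G.a ⟨k, hk⟩ := by rw [ADModel.span, extendZero, dif_pos hk]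
  refine Sat.seq (R := fun s₁ => s₁ = s'.setArr a_off k (base + G.offset k))
    (Sat.store_of_eq k _ (by simpa [RExpr.eval] using hi) (by simpa [RExpr.eval] using h1)
      (hX' k hk.le) rfl) ?_
  rintro s₁ - - rfl
  refine Sat.assign_of_eq (base + G.offset (k + 1)) ?_ (hX' _ hk) ⟨by simp, fun x hx => ?_⟩
  · simp only [RExpr.eval, RState.setArr_var, RState.setArr_arr, h1, zero_ne_one, false_and,
      if_false, add_assoc, hin']
    rw [ha, hb, G.offset_succ, hspan]
  · simp only [RState.setVar_arr, RState.setArr_arr, true_and]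
    split_ifs with h
    · rw [h]
    · exact h2 x (by omega)

/-- Compute a common denominator of all the probabilities. -/
def denProg : RProg :=
  seq (assign v_D (.const 1)) <| forTo v_x v_len <|
  assign v_D (.mul (.var v_D) (.add (.get a_in (.var v_x)) (.sub (.const 1)
    (.get a_in (.var v_x)))))

lemma sat_denProg {L : List ℕ} (hin : ∀ i, s.arr a_in i = L.getD i 0) (hlen : s.var v_len = L.length)
    (hL : L.length ≤ X) (hX : entryProd L < 2 ^ X) :
    Sat ω X denProg s fun s' => s'.var v_D = entryProd L := by
  have hX0 : 1 < 2 ^ X := (Nat.succ_le_of_lt (entryProd_pos L)).trans_lt hX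
  refine Sat.assign_seq 1 rfl hX0 ?_
  refine Sat.forTo (fun k s' => s'.var v_D = ∏ i ∈ Finset.range k, (L.getD i 0 + (1 - L.getD i 0)))
    (N := L.length) (by simpa using hlen) (hN := hL) (hinv := fun _ _ _ h => by simpa using h)
    (h0 := by simp) (hstep := fun k hk s' hs' hag hi hI => ?_)
  have hin' : s'.arr a_in k = L.getD k 0 := by rw [hag.arr a_in rfl]; exact hin k
  refine Sat.assign_of_eq (∏ i ∈ Finset.range (k + 1), (L.getD i 0 + (1 - L.getD i 0))) ?_
    (lt_of_le_of_lt ?_ hX) (by simp)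
  · simp only [RExpr.eval, hi, hin', hI, Finset.prod_range_succ]
  · exact Finset.prod_le_prod_of_subset_of_one_le' (Finset.range_mono hk) fun i _ _ => by omega

/-- The threshold of the edge with the number `v_x`. -/
def thrExpr : RExpr :=
  .max (.max (.get a_in (.get a_off (.div (.var v_x) (.var v_n))))
    (.get a_in (.get a_off (.mod (.var v_x) (.var v_n))))) (.var v_start)

/-- The adjacency of the pair with the number `v_x`, where the vertices `v_uex` and `v_vex` are
isolated. -/
def adjExpr : RExpr :=
  .mul (.mul (.get a_in (.add (.add (.var v_base) (.const 1)) (.var v_x)))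
    (.mul (.ne (.div (.var v_x) (.var v_n)) (.var v_uex))
      (.ne (.div (.var v_x) (.var v_n)) (.var v_vex))))
    (.mul (.ne (.mod (.var v_x) (.var v_n)) (.var v_uex))
      (.ne (.mod (.var v_x) (.var v_n)) (.var v_vex)))

/-- Compute the thresholds and the adjacency matrix. -/
def tableProg : RProg := seq (fill v_x v_nn a_thr thrExpr) (fill v_x v_nn a_G adjExpr)

lemma sat_tableProg {G : ADModel} {base t₀ u₀ v₀ : ℕ} (hb : s.var v_base = base)
    (hin : ∀ i, s.arr a_in (base + i) = G.encode.getD i 0) (hn : s.var v_n = G.n)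
    (hnn : s.var v_nn = G.n * G.n) (hnX : G.n * G.n ≤ X)
    (hoff : ∀ x < G.n, s.arr a_off x = base + G.offset x) (ht : s.var v_start = t₀)
    (hu : s.var v_uex = u₀) (hv : s.var v_vex = v₀) :
    Sat ω X tableProg s fun s' =>
      (∀ e < G.n * G.n, s'.arr a_G e = G.adjacency u₀ v₀ (e / G.n) (e % G.n)) ∧
      ∀ e < G.n * G.n, s'.arr a_thr e = G.threshold t₀ (e / G.n) (e % G.n) := by
  refine Sat.of_bounded fun hs => ?_
  have hdiv : ∀ e < G.n * G.n, e / G.n < G.n ∧ e % G.n < G.n := fun e he => by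
    have hn : 0 < G.n := Nat.pos_of_ne_zero fun h => by simp [h] at he
    exact ⟨Nat.div_lt_of_lt_mul he, Nat.mod_lt _ hn⟩
  have harr : ∀ x < G.n, s.arr a_in (s.arr a_off x) = G.arrival x := fun x hx => by
    rw [hoff x hx, hin, ADModel.getD_encode_a ⟨x, hx⟩, ADModel.arrival, extendZero, dif_pos hx]
  refine Sat.seq (Sat.fill (fun e => G.threshold t₀ (e / G.n) (e % G.n)) hnn hnX
    (hf := fun e he s' hag hi _ => ⟨?_, ?_⟩)) ?_
  · simp only [thrExpr, RExpr.eval_max, RExpr.eval, RExpr.eval_mod, hi]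
    rw [hag.var v_n rfl, hag.var v_start rfl, hag.arr a_in rfl, hag.arr a_off rfl, hn, ht,
      harr _ (hdiv e he).1, harr _ (hdiv e he).2, ADModel.threshold]
  · rw [ADModel.threshold, ← harr _ (hdiv e he).1, ← harr _ (hdiv e he).2, ← ht]
    exact max_lt (max_lt (hs.arr _ _) (hs.arr _ _)) (hs.var _)
  rintro s₁ hs₁ ha₁ hthr
  refine (Sat.fill (fun e => G.adjacency u₀ v₀ (e / G.n) (e % G.n)) ((ha₁.var _ rfl).trans hnn) hnX
    (hf := fun e he s' hag hi _ => ⟨?_, ?_⟩)).imp fun s₂ _ ha₂ h => ⟨h, fun e he => ?_⟩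
  · have h1 := ha₁.seq hag
    obtain ⟨hk, hl⟩ := hdiv e he
    have hflat : e / G.n * G.n + e % G.n = e := by rw [mul_comm]; exact Nat.div_add_mod e G.n
    have hadj := ADModel.getD_encode_adj (G := G) ⟨_, hk⟩ ⟨_, hl⟩
    simp only [hflat] at hadj
    simp only [adjExpr, RExpr.eval_ne, RExpr.eval, RExpr.eval_mod, hi]
    rw [h1.var v_n rfl, h1.var v_base rfl, h1.var v_uex rfl, h1.var v_vex rfl, h1.arr a_in rfl, hn,
      hb, hu, hv, add_assoc, hin, hadj, ADModel.adjacency]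
    by_cases h : G.graph.Adj ⟨_, hk⟩ ⟨_, hl⟩
    · simp only [h, hk, hl, if_true, true_and, one_mul, exists_true_left]
      split_ifs <;> simp_all
    · simp [h]
  · rw [ADModel.adjacency]
    have : 1 < 2 ^ X := Nat.one_lt_two_pow (by omega)
    split_ifs <;> omega
  · rw [ha₂.arr a_thr rfl]; exact hthr e he

/-- Choose the prime number for the field. -/
def primeProg : RProg :=
  seq (assign v_p (.var v_t)) <| forTo v_k v_t <|
  seq (assign v_q (.add (.add (.var v_t) (.const 1)) (.var v_k))) <|
  seq (assign v_m (.sub (.var v_q) (.const 2))) <|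
  seq (assign v_C (.const 0)) <|
  seq (forTo v_x v_m (ite (.mod (.var v_q) (.add (.var v_x) (.const 2))) skip
    (assign v_C (.const 1)))) <|
  ite (.var v_C) skip (assign v_p (.var v_q))

lemma sat_primeProg {m : ℕ} (ht : s.var v_t = m) (hm : 2 ≤ m) (hX : 2 * m ≤ X) :
    Sat ω X primeProg s fun s' => s'.var v_p = fieldSize m := by
  have hX1 : 1 < 2 ^ X := Nat.one_lt_two_pow (by omega)
  refine Sat.assign_seq m (by simp [RExpr.eval, ht]) (Nat.lt_two_pow_of_le (by omega)) ?_
  refine Sat.forTo (fun k s' => s'.var v_p = m + lastIdx (fun k => (m + 1 + k).Prime) k) (N := m)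
    (by simpa using ht) (hN := by omega) (hinv := fun _ _ _ h => by simpa using h)
    (h0 := by simp [lastIdx]) (hstep := fun k hk s' hs' hag hi hI => ?_)
  have ht' : s'.var v_t = m := (hag.var _ rfl).trans (by simpa using ht)
  have hqX : m + 1 + k < 2 ^ X := Nat.lt_two_pow_of_le (by omega)
  refine Sat.assign_seq (m + 1 + k) (by simp [RExpr.eval, ht', hi]) hqX ?_
  refine Sat.assign_seq (m + 1 + k - 2) (by simp [RExpr.eval]) (by omega) ?_
  refine Sat.assign_seq 0 rfl (by positivity) ?_
  refine Sat.seq (Sat.forTo (fun j s₁ => s₁.var v_C = 0 ↔ ∀ i < j, ¬ (i + 2) ∣ m + 1 + k)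
    (N := m + 1 + k - 2) (by simp) (hN := by omega)
    (hinv := fun _ _ _ h => by simpa using h) (h0 := by simp)
    (hstep := fun j hj s₁ hs₁ hag₁ hi₁ hI₁ => ?_)) ?_
  · have hq : s₁.var v_q = m + 1 + k := (hag₁.var _ rfl).trans (by simp)
    refine Sat.ite (fun h => ?_) fun h => ?_
    · simp only [RExpr.eval_mod, RExpr.eval, hq, hi₁, ne_eq, ← Nat.dvd_iff_mod_eq_zero] at h
      refine Sat.skip ?_
      rw [hI₁, Nat.forall_lt_succ_right]
      exact ⟨fun h1 => ⟨h1, h⟩, fun h1 => h1.1⟩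
    · simp only [RExpr.eval_mod, RExpr.eval, hq, hi₁, ← Nat.dvd_iff_mod_eq_zero] at h
      refine Sat.assign_of_eq 1 rfl hX1 ?_
      simp only [RState.setVar_var, if_true, one_ne_zero, false_iff, not_forall, not_not]
      exact ⟨j, by omega, h⟩
  · rintro s₁ - ha₁ hC
    have hp₁ : s₁.var v_p = s'.var v_p := (ha₁.var _ rfl).trans (by simp)
    have hq₁ : s₁.var v_q = m + 1 + k := (ha₁.var _ rfl).trans (by simp)
    have hprime : (m + 1 + k).Prime ↔ ∀ i < m + 1 + k - 2, ¬ (i + 2) ∣ m + 1 + k := by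
      rw [Nat.prime_def]
      constructor
      · rintro ⟨-, h⟩ i hi hd
        rcases h _ hd with h | h <;> omega
      · refine fun h => ⟨by omega, fun d hd => ?_⟩
        have hle := Nat.le_of_dvd (by omega) hd
        by_contra! hcon
        have hd0 : d ≠ 0 := by rintro rfl; rw [Nat.zero_dvd] at hd; omega
        refine h (d - 2) (by omega) ?_
        rwa [Nat.sub_add_cancel (by omega)]
    refine Sat.ite (fun h => ?_) fun h => ?_
    · refine Sat.skip ?_
      have : ¬ (m + 1 + k).Prime := by rw [hprime, ← hC]; exact h
      rw [hp₁, hI, lastIdx, if_neg this]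
    · have : (m + 1 + k).Prime := by rw [hprime, ← hC]; exact h
      refine Sat.assign_of_eq (m + 1 + k) (by simp [RExpr.eval, hq₁]) hqX ?_
      simp only [RState.setVar_var, if_true]
      rw [lastIdx, if_pos this]; omega

/-- Choose the number of binary digits of the random numbers. -/
def digitsProg : RProg :=
  seq (assign v_W (.const 1)) <| seq (assign v_K (.const 0)) <|
  loop (.sub (.var v_T) (.var v_W)) (seq (assign v_W (.mul (.const 2) (.var v_W)))
    (assign v_K (.add (.var v_K) (.const 1))))

lemma sat_digitsProg {Y : ℕ} (hT : s.var v_T = Y) (hY : Nat.clog 2 Y < X) :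
    Sat ω X digitsProg s fun s' => s'.var v_K = Nat.clog 2 Y := by
  refine Sat.assign_seq 1 rfl (Nat.one_lt_two_pow (by omega)) ?_
  refine Sat.assign_seq 0 rfl (by positivity) ?_
  refine Sat.imp (R := fun s' => s'.var v_W = 2 ^ Nat.clog 2 Y ∧ s'.var v_K = Nat.clog 2 Y) ?_
    fun _ _ _ h => h.2
  refine Sat.loop (fun k s' => s'.var v_W = 2 ^ k ∧ s'.var v_K = k) _ hY.le (by simp) ?_ ?_
  · rintro k hk s' hs' hag ⟨h1, h2⟩
    have hT' : s'.var v_T = Y := (hag.var _ rfl).trans (by simpa using hT)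
    have h3 : 2 ^ k < Y := (Nat.lt_clog_iff_pow_lt (by norm_num)).1 hk
    refine ⟨by simp only [RExpr.eval, hT', h1]; omega, ?_⟩
    refine Sat.assign_seq (2 ^ (k + 1)) (by simp [RExpr.eval, h1, pow_succ, mul_comm])
      (Nat.pow_lt_pow_right (by norm_num) (by omega)) ?_
    exact Sat.assign_of_eq (k + 1) (by simp [RExpr.eval, h2])
      (Nat.lt_two_pow_of_le (by omega)) (by simp)
  · rintro s' hag ⟨h1, -⟩
    have hT' : s'.var v_T = Y := (hag.var _ rfl).trans (by simpa using hT)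
    have h3 : Y ≤ 2 ^ Nat.clog 2 Y := Nat.le_pow_clog (by norm_num) Y
    simp only [RExpr.eval, hT', h1]
    omega

end Sampler

/-! ### The program: the approximation scheme -/

namespace Sampler

open RProg

/-- The reciprocal of the accuracy, rounded up: the first two entries of the input are the
numerator and the denominator of the accuracy. -/
def accuracy (L : List ℕ) : ℕ := L.getD 1 0 / L.getD 0 0 + 1

/-- The number of elements of the field. It is larger than `8 * n * E`, so that a random
evaluation point fails with probability at most `1 / (8 * E)`. -/
def primeOf (n E : ℕ) : ℕ := fieldSize (8 * n * E + 2)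

/-- The number of samples: a sample is at most `n ^ 3` times the weighted optimum `A`, so that the
variance of a sum of `N` samples is at most `4 * N * n ^ 3 * A ^ 2`, and Chebyshev's inequality is
applied with the deviation `N * A / E`. -/
def rounds (n E : ℕ) : ℕ := 16 * (n * n * n) * (E * E) + 1

/-- A lower bound for the range of the random numbers which makes their digits uniform up to a
relative error of `1 / (8 * E)`. -/
def rangeOf (n E D : ℕ) : ℕ := D ^ n * (8 * E) * primeOf n E ^ (n * n)

/-- The number of binary digits of the random numbers. -/
def digits (n E D : ℕ) : ℕ := Nat.clog 2 (rangeOf n E D)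

lemma primeOf_spec (n E : ℕ) :
    (primeOf n E).Prime ∧ 8 * n * E + 2 < primeOf n E ∧ primeOf n E ≤ 2 * (8 * n * E + 2) :=
  fieldSize_spec (by omega)

lemma two_lt_primeOf (n E : ℕ) : 2 < primeOf n E := by
  have := (primeOf_spec n E).2.1
  omega

/-- The instance on which the scheme works for the model `G` and the input `L`. -/
noncomputable def instanceOf (G : ADModel) (L : List ℕ) (t₀ u₀ v₀ : ℕ)
    (hL : ∀ x ∈ G.encode, x ∈ L) : Instance :=
  G.toInstance t₀ u₀ v₀ (entryProd L) (primeOf G.n (accuracy L)) (ADModel.den_dvd_entryProd hL)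
    (primeOf_spec _ _).1 (two_lt_primeOf _ _)

/-- Compute the parameters of the scheme. -/
def paramProg : RProg :=
  seq (assign v_Dn (.const 1)) <| seq (powProg v_Dn v_n v_D) <|
  seq (assign v_t (.add (.mul (.mul (.const 8) (.var v_n)) (.var v_E)) (.const 2))) <|
  seq primeProg <|
  seq (assign v_N (.add (.mul (.mul (.const 16) (.mul (.mul (.var v_n) (.var v_n)) (.var v_n)))
    (.mul (.var v_E) (.var v_E))) (.const 1))) <|
  seq (assign v_T (.mul (.var v_Dn) (.mul (.const 8) (.var v_E)))) <|
  seq (powProg v_T v_nn v_p) digitsProg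

/-- Write the output. -/
def outputProg : RProg :=
  seq (assign v_out (.mul (.mul (.const 2) (.var v_N)) (.var v_Dn)))
    (assign v_len (.add (.var v_total) (.mul (.var v_add) (.var v_out))))

/-- The approximation scheme. -/
def mainProg : RProg :=
  seq headProg <| seq offsetProg <| seq denProg <| seq tableProg <| seq paramProg <|
  seq sumProg outputProg

/-- The bound `X` for the bit lengths and the numbers of rounds is large enough for the whole
scheme. -/
structure Room (G : ADModel) (L : List ℕ) (base : ℕ) (X : ℕ) : Prop where
  nn : G.n * G.n ≤ X
  length : L.length ≤ X
  acc : accuracy L ≤ X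
  field : 2 * (8 * G.n * accuracy L + 2) ≤ X
  rounds : rounds G.n (accuracy L) ≤ X
  span : ∀ x < G.n, G.span x ≤ X
  offset : base + G.offset G.n < 2 ^ X
  death : ∀ x < G.n, G.arrival x + G.span x < 2 ^ X
  den : entryProd L < 2 ^ X
  range : rangeOf G.n (accuracy L) (entryProd L) ≤ 2 ^ (X - 1)
  sum : Sampler.rounds G.n (accuracy L) * (G.n * G.n * (entryProd L ^ G.n * G.n)) < 2 ^ (X - 1)
  out : 2 * Sampler.rounds G.n (accuracy L) * entryProd L ^ G.n < 2 ^ (X - 1)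

variable {ω : ℕ → Bool} {X : ℕ} {s : RState} {G : ADModel} {L : List ℕ} {base : ℕ}

lemma Room.X_pos (h : Room G L base X) : 0 < X := by have := h.field; omega

lemma Room.half (h : Room G L base X) : 2 ^ (X - 1) + 2 ^ (X - 1) = 2 ^ X := by
  obtain ⟨Y, rfl⟩ := Nat.exists_eq_add_one.2 h.X_pos
  rw [Nat.add_sub_cancel, pow_succ]; ring

lemma Room.range_lt (h : Room G L base X) : rangeOf G.n (accuracy L) (entryProd L) < 2 ^ X :=
  h.range.trans_lt (Nat.pow_lt_pow_right (by norm_num) (by have := h.X_pos; omega))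

lemma Room.digits_lt (h : Room G L base X) : digits G.n (accuracy L) (entryProd L) < X := by
  have h1 : digits G.n (accuracy L) (entryProd L) ≤ X - 1 := Nat.clog_le_of_le_pow h.range
  have := h.X_pos
  omega

lemma accuracy_pos (L : List ℕ) : 0 < accuracy L := Nat.succ_pos _

lemma Room.range_aux (h : Room G L base X) : entryProd L ^ G.n * (8 * accuracy L) < 2 ^ X :=
  (Nat.le_mul_of_pos_right _ (pow_pos (primeOf_spec _ _).1.pos _)).trans_lt h.range_lt

lemma Room.pow_lt (h : Room G L base X) : entryProd L ^ G.n < 2 ^ X :=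
  (Nat.le_mul_of_pos_right _ (by have := accuracy_pos L; omega)).trans_lt h.range_aux

lemma Room.fits (h : Room G L base X) {t₀ u₀ v₀ : ℕ} (hL : ∀ x ∈ G.encode, x ∈ L) :
    Fits (instanceOf G L t₀ u₀ v₀ hL) X where
  nn := h.nn
  p := (primeOf_spec _ _).2.2.trans h.field
  len := h.span
  D_pos := entryProd_pos L
  pow := h.pow_lt
  death := h.death

lemma sat_paramProg {n E D : ℕ} (hn : s.var v_n = n) (hnn : s.var v_nn = n * n)
    (hE : s.var v_E = E) (hD : s.var v_D = D) (hD0 : 0 < D) (hnX : n * n ≤ X)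
    (hfield : 2 * (8 * n * E + 2) ≤ X) (hrounds : rounds n E ≤ X) (hpow : D ^ n < 2 ^ X)
    (hpow' : D ^ n * (8 * E) < 2 ^ X) (hrange : rangeOf n E D < 2 ^ X) (hdigits : digits n E D < X) :
    Sat ω X paramProg s fun s' => s'.var v_Dn = D ^ n ∧ s'.var v_p = primeOf n E ∧
      s'.var v_N = rounds n E ∧ s'.var v_K = digits n E D := by
  refine Sat.assign_seq 1 rfl (Nat.one_lt_two_pow (by omega)) ?_
  refine Sat.seq (sat_powProg (m := 1) (N := n) (q := D) (by simp) (by simpa using hn)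
    (by simpa using hD) hD0 ((Nat.le_mul_self n).trans hnX) (by simpa using hpow)) ?_
  rintro s₁ - ha₁ hDn
  rw [one_mul] at hDn
  have hn₁ : s₁.var v_n = n := (ha₁.var _ rfl).trans (by simpa using hn)
  have hnn₁ : s₁.var v_nn = n * n := (ha₁.var _ rfl).trans (by simpa using hnn)
  have hE₁ : s₁.var v_E = E := (ha₁.var _ rfl).trans (by simpa using hE)
  refine Sat.assign_seq (8 * n * E + 2) (by simp [RExpr.eval, hn₁, hE₁])
    (Nat.lt_two_pow_of_le (by omega)) ?_
  refine Sat.seq (sat_primeProg (m := 8 * n * E + 2) (by simp) (by omega) hfield) ?_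
  rintro s₂ - ha₂ hp
  change s₂.var v_p = primeOf n E at hp
  have hn₂ : s₂.var v_n = n := (ha₂.var _ rfl).trans (by simpa using hn₁)
  have hnn₂ : s₂.var v_nn = n * n := (ha₂.var _ rfl).trans (by simpa using hnn₁)
  have hE₂ : s₂.var v_E = E := (ha₂.var _ rfl).trans (by simpa using hE₁)
  have hDn₂ : s₂.var v_Dn = D ^ n := (ha₂.var _ rfl).trans (by simpa using hDn)
  refine Sat.assign_seq (rounds n E) (by simp [RExpr.eval, hn₂, hE₂, rounds])
    (Nat.lt_two_pow_of_le hrounds) ?_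
  refine Sat.assign_seq (D ^ n * (8 * E)) (by simp [RExpr.eval, hDn₂, hE₂]) hpow' ?_
  refine Sat.seq (sat_powProg (m := D ^ n * (8 * E)) (N := n * n) (q := primeOf n E) (by simp)
    (by simpa using hnn₂) (by simpa using hp) (primeOf_spec n E).1.pos hnX hrange) ?_
  rintro s₃ - ha₃ hT
  refine (sat_digitsProg (Y := rangeOf n E D) hT hdigits).imp fun s₄ _ ha₄ hK => ⟨?_, ?_, ?_, hK⟩
  · exact ((ha₃.seq ha₄).var _ rfl).trans (by simpa using hDn₂)
  · exact ((ha₃.seq ha₄).var _ rfl).trans (by simpa using hp)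
  · exact ((ha₃.seq ha₄).var _ rfl).trans (by simp)

/-- The memory holds the instance of the model when the tables have been computed. -/
lemma env_of_tables {t₀ u₀ v₀ : ℕ} (hL : ∀ x ∈ G.encode, x ∈ L)
    (hin : ∀ i, s.arr a_in (base + i) = G.encode.getD i 0) (hn : s.var v_n = G.n)
    (hnn : s.var v_nn = G.n * G.n) (hD : s.var v_D = entryProd L)
    (hp : s.var v_p = primeOf G.n (accuracy L))
    (hoff : ∀ x < G.n, s.arr a_off x = base + G.offset x)
    (hG : ∀ e < G.n * G.n, s.arr a_G e = G.adjacency u₀ v₀ (e / G.n) (e % G.n))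
    (hthr : ∀ e < G.n * G.n, s.arr a_thr e = G.threshold t₀ (e / G.n) (e % G.n)) :
    Env (instanceOf G L t₀ u₀ v₀ hL) s where
  n := hn
  nn := hnn
  D := hD
  p := hp
  a x hx := by
    change x < G.n at hx
    change _ = G.arrival x
    rw [hoff x hx, hin, ADModel.getD_encode_a ⟨x, hx⟩, ADModel.arrival, extendZero, dif_pos hx]
  len x hx := by
    change x < G.n at hx
    change _ = G.span x
    rw [hoff x hx, add_assoc, hin, hin, ADModel.getD_encode_a ⟨x, hx⟩,
      ADModel.getD_encode_b ⟨x, hx⟩, ADModel.span, extendZero, dif_pos hx]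
  w x hx i hi := by
    change x < G.n at hx
    change i < G.span x at hi
    change _ = G.weight (entryProd L) x i
    obtain ⟨h1, h2⟩ := ADModel.getD_encode_num (G := G) ⟨x, hx⟩ hi
    change _ * (entryProd L / _) = _
    rw [hoff x hx, add_assoc, add_assoc, hin, hin, h1, h2, ADModel.weight, dif_pos hx]
  G k hk l hl := by
    change k < G.n at hk
    change l < G.n at hl
    obtain ⟨h1, h2⟩ := Nat.div_mod_of_flat (k := k) hl
    exact (hG _ (Nat.flat_lt hk hl)).trans (by rw [h1, h2]; rfl)
  thr k hk l hl := by
    change k < G.n at hk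
    change l < G.n at hl
    obtain ⟨h1, h2⟩ := Nat.div_mod_of_flat (k := k) hl
    exact (hthr _ (Nat.flat_lt hk hl)).trans (by rw [h1, h2]; rfl)

/-- The initial state of the scheme: the input in the array `a_in`, the position at which the
encoding of the model begins, and the parameters of the window and of the output. -/
structure Ready (L : List ℕ) (base t₀ u₀ v₀ m : ℕ) (s : RState) : Prop where
  arr : ∀ i, s.arr a_in i = L.getD i 0
  length : s.var v_len = L.length
  coins : s.coins = 0
  base : s.var v_base = base
  start : s.var v_start = t₀
  uex : s.var v_uex = u₀
  vex : s.var v_vex = v₀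
  add : s.var v_add = m

/-- The numerator of the output. -/
noncomputable def outputNum (ω : ℕ → Bool) (c : Instance) (E m : ℕ) : ℕ :=
  ∑ j ∈ Finset.range (rounds c.n E), c.sample (blockNum ω (j * digits c.n E c.D) (digits c.n E c.D)) +
    m * (2 * rounds c.n E * c.D ^ c.n)

/-- The output of the scheme in terms of the coins. -/
lemma sat_mainProg {t₀ u₀ v₀ m : ℕ} (h : Ready L base t₀ u₀ v₀ m s) (hm : m ≤ 1)
    (hL : ∀ x ∈ G.encode, x ∈ L) (henc : ∀ i, L.getD (base + i) 0 = G.encode.getD i 0)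
    (hR : Room G L base X) :
    Sat ω X mainProg s fun s' =>
      s'.var v_len = outputNum ω (instanceOf G L t₀ u₀ v₀ hL) (accuracy L) m ∧
      s'.var v_out = 2 * rounds G.n (accuracy L) * entryProd L ^ G.n := by
  have hin : ∀ i, s.arr a_in (base + i) = G.encode.getD i 0 := fun i => by rw [h.arr, henc]
  have hn0 : s.arr a_in base = G.n := by have := hin 0; rwa [add_zero, ADModel.getD_encode_n] at this
  refine Sat.seq (sat_headProg h.base hn0 (E := accuracy L) (by rw [h.arr, h.arr, accuracy])
    (Nat.lt_two_pow_of_le hR.nn) (Nat.lt_two_pow_of_le hR.acc)) ?_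
  rintro s₁ - ha₁ ⟨hn, hnn, hE⟩
  refine Sat.seq (sat_offsetProg (G := G) ((ha₁.var _ rfl).trans h.base)
    (fun i => by rw [ha₁.arr a_in rfl]; exact hin i) hn hnn ((Nat.le_mul_self _).trans hR.nn)
    hR.offset) ?_
  rintro s₂ - ha₂ hoff
  have h2 := ha₁.seq ha₂
  refine Sat.seq (sat_denProg (L := L) (fun i => by rw [h2.arr a_in rfl]; exact h.arr i)
    ((h2.var _ rfl).trans h.length) hR.length hR.den) ?_
  rintro s₃ - ha₃ hD
  have h3 := ha₁.seq (ha₂.seq ha₃)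
  have h23 := ha₂.seq ha₃
  refine Sat.seq (sat_tableProg (G := G) ((h3.var _ rfl).trans h.base)
    (fun i => by rw [h3.arr a_in rfl]; exact hin i) ((h23.var _ rfl).trans hn)
    ((h23.var _ rfl).trans hnn) hR.nn (fun x hx => by rw [ha₃.arr a_off rfl]; exact hoff x hx)
    ((h3.var _ rfl).trans h.start) ((h3.var _ rfl).trans h.uex) ((h3.var _ rfl).trans h.vex)) ?_
  rintro s₄ - ha₄ ⟨hG, hthr⟩
  have h24 := ha₂.seq (ha₃.seq ha₄)
  refine Sat.seq (sat_paramProg (n := G.n) (E := accuracy L) (D := entryProd L)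
    ((h24.var _ rfl).trans hn) ((h24.var _ rfl).trans hnn) ((h24.var _ rfl).trans hE)
    ((ha₄.var _ rfl).trans hD) (entryProd_pos L) hR.nn hR.field hR.rounds hR.pow_lt hR.range_aux
    hR.range_lt hR.digits_lt) ?_
  rintro s₅ - ha₅ ⟨hDn, hp, hN, hK⟩
  have h25 := ha₂.seq (ha₃.seq (ha₄.seq ha₅))
  have h15 := ha₁.seq h25
  have h35 := ha₃.seq (ha₄.seq ha₅)
  have hEnv : Env (instanceOf G L t₀ u₀ v₀ hL) s₅ := by
    refine env_of_tables hL (base := base) (fun i => ?_) ((h25.var _ rfl).trans hn)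
      ((h25.var _ rfl).trans hnn) (((ha₄.seq ha₅).var _ rfl).trans hD) hp (fun x hx => ?_)
      (fun e he => ?_) (fun e he => ?_)
    · rw [h15.arr a_in rfl]; exact hin i
    · rw [h35.arr a_off rfl]; exact hoff x hx
    · rw [ha₅.arr a_G rfl]; exact hG e he
    · rw [ha₅.arr a_thr rfl]; exact hthr e he
  refine Sat.seq (sat_sumProg hEnv (hR.fits hL) hN hK hR.rounds hR.digits_lt.le
    ((h15.coins rfl).trans h.coins) ?_) ?_
  · exact hR.sum.trans_le (Nat.pow_le_pow_right (by norm_num) (Nat.sub_le _ _))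
  rintro s₆ - ha₆ htot
  have h16 := h15.seq ha₆
  have hadd : s₆.var v_add = m := (h16.var _ rfl).trans h.add
  have hX := hR.half
  have hout := hR.out
  refine Sat.assign_seq (2 * rounds G.n (accuracy L) * entryProd L ^ G.n) ?_ (by omega) ?_
  · simp only [RExpr.eval]
    rw [ha₆.var v_N rfl, ha₆.var v_Dn rfl, hN, hDn]
  refine Sat.assign_of_eq (outputNum ω (instanceOf G L t₀ u₀ v₀ hL) (accuracy L) m) ?_ ?_
    ⟨by simp, by simp⟩
  · simp [RExpr.eval, htot, hadd, outputNum]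
    rfl
  · have h4 := Finset.sum_le_card_nsmul (Finset.range (rounds G.n (accuracy L)))
      (fun j => (instanceOf G L t₀ u₀ v₀ hL).sample (blockNum ω
        (j * digits G.n (accuracy L) (entryProd L)) (digits G.n (accuracy L) (entryProd L)))) _
      fun i _ => Instance.sample_le_pow _ _
    rw [Finset.card_range, smul_eq_mul] at h4
    have h5 := h4.trans_lt hR.sum
    have h6 : m * (2 * rounds G.n (accuracy L) * entryProd L ^ G.n) ≤
        1 * (2 * rounds G.n (accuracy L) * entryProd L ^ G.n) := Nat.mul_le_mul_right _ hm
    exact (add_lt_add_of_lt_of_le h5 h6).trans (by omega)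

end Sampler

/-! ### The accuracy of the scheme -/

/-- With probability at least `3 / 4` the sum of the samples is close to its mean. -/
lemma Instance.sample_estimate (c : Instance) {E : ℕ} {ε : ℝ} (hε : 1 ≤ ε * E)
    (hp : c.p = Sampler.primeOf c.n E) :
    3 / 4 ≤ fairCoins {ω | |((∑ j ∈ Finset.range (Sampler.rounds c.n E),
      c.sample (blockNum ω (j * Sampler.digits c.n E c.D) (Sampler.digits c.n E c.D)) : ℕ) : ℝ) -
        Sampler.rounds c.n E * (2 * c.weightedOpt)| ≤
          ε * (Sampler.rounds c.n E * (2 * c.weightedOpt))} := by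
  set N := Sampler.rounds c.n E with hN
  set K := Sampler.digits c.n E c.D with hK
  set A : ℝ := (c.weightedOpt : ℝ) with hA
  have hA0 : 0 ≤ A := by rw [hA]; exact_mod_cast c.weightedOpt_nonneg
  have hE0 : 0 < (E : ℝ) := by
    rcases Nat.eq_zero_or_pos E with h | h
    · rw [h] at hε; norm_num at hε
    · exact_mod_cast h
  have hle : ∀ R, (c.sample R : ℝ) ≤ c.n ^ 3 * A := fun R => by
    have := c.sample_le R
    rw [hA]; exact_mod_cast this
  rcases hA0.eq_or_lt with hA0 | hA0
  · -- all the samples vanish if the optimum is zero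
    have h0 : ∀ R, c.sample R = 0 := fun R => by
      have := hle R
      rw [← hA0, mul_zero] at this
      exact_mod_cast le_antisymm this (by positivity)
    have : {ω : ℕ → Bool | |((∑ j ∈ Finset.range N, c.sample (blockNum ω (j * K) K) : ℕ) : ℝ) -
        N * (2 * A)| ≤ ε * (N * (2 * A))} = Set.univ := by
      ext ω; simp [h0, ← hA0]
    rw [this, MeasureTheory.measure_univ]
    exact ENNReal.div_le_of_le_mul (by norm_num)
  have hpE := (Sampler.primeOf_spec c.n E).2.1
  rw [← hp] at hpE
  have hp0 : 0 < (c.p : ℝ) := by exact_mod_cast c.p_prime.pos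
  have hnp : (c.n : ℝ) / c.p ≤ 1 / (8 * E) := by
    rw [div_le_div_iff₀ hp0 (by positivity)]
    have : c.n * (8 * E) ≤ 1 * c.p := by nlinarith
    exact_mod_cast this
  have hEq : 0 < (E : ℚ) := by exact_mod_cast hE0
  have hrange : (c.D : ℚ) ^ c.n * c.p ^ (c.n * c.n) ≤ 1 / (8 * E) * (2 ^ K : ℕ) := by
    have h1 : Sampler.rangeOf c.n E c.D ≤ 2 ^ K := Nat.le_pow_clog (by norm_num) _
    rw [Sampler.rangeOf, ← hp] at h1
    have h2 : (c.D : ℚ) ^ c.n * (8 * E) * c.p ^ (c.n * c.n) ≤ (2 ^ K : ℕ) := by exact_mod_cast h1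
    rw [div_mul_eq_mul_div, one_mul, le_div_iff₀ (by positivity)]
    linarith
  have hη1 : 1 / (8 * (E : ℚ)) ≤ 1 := by
    rw [div_le_one (by positivity)]
    have : (1 : ℚ) ≤ E := by exact_mod_cast (Nat.cast_pos.1 hE0)
    linarith
  obtain ⟨hlow, hupp⟩ := c.sum_sample_bounds hrange hη1
  replace hlow := (Rat.cast_le (K := ℝ)).2 hlow
  replace hupp := (Rat.cast_le (K := ℝ)).2 hupp
  have hη1' := (Rat.cast_le (K := ℝ)).2 hη1
  push_cast at hlow hupp hη1'
  set μ : ℝ := (∑ R ∈ Finset.range (2 ^ K), (c.sample R : ℝ)) / 2 ^ K with hμ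
  have hK0 : (0 : ℝ) < 2 ^ K := by positivity
  have hμK : 2 ^ K * μ = ∑ R ∈ Finset.range (2 ^ K), (c.sample R : ℝ) := by
    rw [hμ, mul_div_cancel₀ _ hK0.ne']
  have hlow' : (1 - 1 / (8 * (E : ℝ))) * (1 - c.n / c.p) * (2 * A) ≤ μ := by
    rw [hμ, le_div_iff₀ hK0]
    exact le_trans (by rw [hA]; ring_nf; rfl) hlow
  have hupp' : μ ≤ (1 + 1 / (8 * (E : ℝ))) * (2 * A) := by
    rw [hμ, div_le_iff₀ hK0]
    exact hupp.trans (by rw [hA]; ring_nf; rfl)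
  have hη0 : 0 < 1 / (8 * (E : ℝ)) := by positivity
  have hnp0 : 0 ≤ (c.n : ℝ) / c.p := by positivity
  have hηE : E * (1 / (8 * (E : ℝ))) = 1 / 8 := by field_simp
  set η := 1 / (8 * (E : ℝ)) with hη
  have hlow2 : 2 * A - 4 * η * A ≤ μ := by
    refine le_trans ?_ hlow'
    have h1 : 1 - 2 * η ≤ (1 - η) * (1 - c.n / c.p) := by nlinarith
    nlinarith
  have hupp2 : μ ≤ 2 * A + 2 * η * A := by linarith
  have hN0 : (0 : ℝ) < N := by
    have : 0 < N := Nat.succ_pos _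
    exact_mod_cast this
  have hNE : 16 * (c.n : ℝ) ^ 3 ≤ 64 * η ^ 2 * N := by
    have h1 : 16 * (c.n * c.n * c.n) * (E * E) ≤ N := Nat.le_succ _
    have h2 : 16 * ((c.n : ℝ) * c.n * c.n) * (E * E) ≤ N := by exact_mod_cast h1
    have h3 : 64 * η ^ 2 * (16 * ((c.n : ℝ) * c.n * c.n) * (E * E)) =
        1024 * (E * η) ^ 2 * c.n ^ 3 := by ring
    calc 16 * (c.n : ℝ) ^ 3 = 64 * η ^ 2 * (16 * ((c.n : ℝ) * c.n * c.n) * (E * E)) := by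
          rw [h3, hηE]; ring
      _ ≤ _ := by gcongr
  have hεη : 8 * η ≤ ε := by nlinarith
  -- the deviation from the mean is at most half of the permitted error
  refine (fairCoins_estimate (K := K) (N := N) (f := fun R => c.sample R) (b := c.n ^ 3 * A)
    (μ := μ) (δ := 8 * η * A * N) (fun _ => by positivity) hle hμK (by positivity) ?_).trans
    (MeasureTheory.measure_mono fun ω hω => ?_)
  · have h1 : μ ≤ 4 * A := by
      have : η * A ≤ 1 * A := by gcongr
      linarith
    calc 4 * (N * (c.n ^ 3 * A * μ)) ≤ 4 * (N * (c.n ^ 3 * A * (4 * A))) := by gcongr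
      _ = 16 * c.n ^ 3 * (N * A ^ 2) := by ring
      _ ≤ 64 * η ^ 2 * N * (N * A ^ 2) := by gcongr
      _ = _ := by ring
  · simp only [Set.mem_ofPred_eq, abs_lt] at hω
    simp only [Set.mem_ofPred_eq, Nat.cast_sum, abs_le]
    have e1 : 8 * η * A * N = 8 * (η * (N * A)) := by ring
    have e2 : (N : ℝ) * (2 * A) = 2 * (N * A) := by ring
    have e3 : ε * (2 * (N * A)) = 2 * (ε * (N * A)) := by ring
    have h1 : N * (2 * A - 4 * η * A) ≤ N * μ := by gcongr
    have h2 : N * μ ≤ N * (2 * A + 2 * η * A) := by gcongr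
    have e4 : N * (2 * A - 4 * η * A) = 2 * (N * A) - 4 * (η * (N * A)) := by ring
    have e5 : N * (2 * A + 2 * η * A) = 2 * (N * A) + 2 * (η * (N * A)) := by ring
    have h3 : 8 * η * (N * A) ≤ ε * (N * A) := by gcongr
    have h4 : 0 < η * (N * A) := by positivity
    rw [e1] at hω
    rw [e4] at h1
    rw [e5] at h2
    rw [mul_assoc] at h3
    rw [e2, e3]
    obtain ⟨h5, h6⟩ := hω
    constructor <;> linarith

namespace Sampler

open RProg

/-! ### The size of the numbers and the running time -/

lemma accuracy_le {ε : ℚ} (hε : 0 < ε) (l : List ℕ) :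
    1 ≤ ε * accuracy (schemeInput ε l) ∧ (accuracy (schemeInput ε l) : ℚ) ≤ 1 / ε + 1 := by
  have hnum : 0 < ε.num := Rat.num_pos.2 hε
  have h0 : ((ε.num.toNat : ℕ) : ℚ) = ε.num := by
    exact_mod_cast Int.toNat_of_nonneg hnum.le
  have hpos : (0 : ℚ) < ε.num.toNat := by rw [h0]; exact_mod_cast hnum
  have hden : (0 : ℚ) < ε.den := by exact_mod_cast ε.den_pos
  have hε' : ε = (ε.num.toNat : ℚ) / ε.den := by rw [h0]; exact (Rat.num_div_den ε).symm
  have hacc : accuracy (schemeInput ε l) = ε.den / ε.num.toNat + 1 := rfl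
  rw [hacc]
  constructor
  · have h1 := Nat.lt_mul_div_succ ε.den (Nat.cast_pos.1 hpos)
    have h2 : (ε.den : ℚ) ≤ ε.num.toNat * ((ε.den / ε.num.toNat + 1 : ℕ) : ℚ) := by
      exact_mod_cast h1.le
    rw [hε', div_mul_eq_mul_div, one_le_div hden, ← hε']
    exact h2
  · have h1 : ((ε.den / ε.num.toNat : ℕ) : ℚ) ≤ ε.den / ε.num.toNat := Nat.cast_div_le
    rw [Nat.cast_add, Nat.cast_one]
    refine add_le_add_left (h1.trans_eq ?_) 1
    conv_rhs => rw [hε']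
    rw [one_div_div]

variable {G : ADModel} {L : List ℕ} {base : ℕ}

/-- A bound for the bit lengths and the numbers of rounds that is polynomial in the size of the
input and in the reciprocal of the accuracy. -/
def bitBound (L : List ℕ) : ℕ := 40 * (inputSize L + accuracy L) ^ 5

lemma room (henc : ∀ i, L.getD (base + i) 0 = G.encode.getD i 0)
    (hlen : base + G.offset G.n = L.length) : Room G L base (bitBound L) := by
  set S := inputSize L with hS
  set E := accuracy L with hE
  set M := S + E with hM
  set D := entryProd L with hD
  have hX : bitBound L = 40 * M ^ 5 := rfl
  have hE1 : 1 ≤ E := accuracy_pos L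
  clear_value M
  have hM1 : 1 ≤ M := by omega
  have hLS : L.length ≤ S := length_le_inputSize L
  have hoff : 1 + G.n * G.n ≤ G.offset G.n := by rw [ADModel.offset]; omega
  have hnn : G.n * G.n ≤ M := by omega
  have hnM : G.n ≤ M := (Nat.le_mul_self G.n).trans hnn
  have hDS : D ≤ 2 ^ S := entryProd_le L
  have m1 : M ≤ M ^ 5 := Nat.le_self_pow (by norm_num) M
  have m2 : M ^ 2 ≤ M ^ 5 := Nat.pow_le_pow_right hM1 (by norm_num)
  have m3 : M ^ 3 ≤ M ^ 5 := Nat.pow_le_pow_right hM1 (by norm_num)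
  have m0 : 1 ≤ M ^ 5 := Nat.one_le_pow _ _ hM1
  have hfield : 2 * (8 * G.n * E + 2) ≤ 20 * M ^ 2 := by
    have h1 : G.n * E ≤ M * M := Nat.mul_le_mul hnM (by omega)
    have h2 : 1 * 1 ≤ M * M := Nat.mul_le_mul hM1 hM1
    nlinarith
  have hrounds : rounds G.n E ≤ 17 * M ^ 5 := by
    have h1 : G.n * G.n * G.n * (E * E) ≤ M * M * M * (M * M) := by gcongr <;> omega
    have h2 : M * M * M * (M * M) = M ^ 5 := by ring
    rw [rounds, mul_assoc]
    omega
  have hspan : ∀ x < G.n, 2 + 2 * G.span x ≤ L.length := fun x hx => by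
    have h1 := G.offset_mono (Nat.succ_le_of_lt hx)
    rw [Nat.succ_eq_add_one, G.offset_succ] at h1
    omega
  have hpow : D ^ G.n ≤ 2 ^ M ^ 2 := by
    refine (Nat.pow_le_pow_left hDS G.n).trans ?_
    rw [← pow_mul]
    refine Nat.pow_le_pow_right (by norm_num) ?_
    rw [pow_two]
    exact Nat.mul_le_mul (by omega) hnM
  refine ⟨?_, ?_, ?_, ?_, ?_, ?_, ?_, ?_, ?_, ?_, ?_, ?_⟩
  · omega
  · omega
  · rw [← hE]; omega
  · rw [← hE]; omega
  · rw [← hE]; omega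
  · intro x hx
    have := hspan x hx
    omega
  · exact Nat.lt_two_pow_of_le (by omega)
  · intro x hx
    have h1 : G.arrival x < 2 ^ S := by
      have h2 := size_getD_le_inputSize L (base + G.offset x)
      rw [henc, ADModel.getD_encode_a ⟨x, hx⟩, Nat.size_le, ← hS] at h2
      rw [ADModel.arrival, extendZero, dif_pos hx]
      exact h2
    have h2 : G.span x < 2 ^ S := Nat.lt_two_pow_of_le (by have := hspan x hx; omega)
    refine (add_lt_add h1 h2).trans_le ?_
    rw [← two_mul, ← pow_succ']
    exact Nat.pow_le_pow_right (by norm_num) (by omega)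
  · refine hDS.trans_lt (Nat.pow_lt_pow_right (by norm_num) (by omega))
  · have h1 : primeOf G.n E ≤ 20 * M ^ 2 := (primeOf_spec G.n E).2.2.trans hfield
    have h2 : primeOf G.n E ^ (G.n * G.n) ≤ 2 ^ (20 * M ^ 3) := by
      refine (Nat.pow_le_pow_left (Nat.lt_two_pow_of_le h1).le _).trans ?_
      rw [← pow_mul]
      refine Nat.pow_le_pow_right (by norm_num) ?_
      calc 20 * M ^ 2 * (G.n * G.n) ≤ 20 * M ^ 2 * M := Nat.mul_le_mul_left _ hnn
        _ = _ := by ring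
    have h3 : 8 * E ≤ 2 ^ (8 * M) := (Nat.lt_two_pow_of_le (by omega)).le
    calc rangeOf G.n E D ≤ 2 ^ M ^ 2 * 2 ^ (8 * M) * 2 ^ (20 * M ^ 3) :=
          Nat.mul_le_mul (Nat.mul_le_mul hpow h3) h2
      _ = 2 ^ (M ^ 2 + 8 * M + 20 * M ^ 3) := by rw [pow_add, pow_add]
      _ ≤ _ := Nat.pow_le_pow_right (by norm_num) (by omega)
  · have h1 : rounds G.n E < 2 ^ (17 * M ^ 5) := Nat.lt_two_pow_of_le hrounds
    have h2 : G.n * G.n ≤ 2 ^ M := (Nat.lt_two_pow_of_le hnn).le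
    have h3 : G.n ≤ 2 ^ M := (Nat.lt_two_pow_of_le hnM).le
    calc rounds G.n E * (G.n * G.n * (D ^ G.n * G.n)) ≤
          2 ^ (17 * M ^ 5) * (2 ^ M * (2 ^ M ^ 2 * 2 ^ M)) :=
          Nat.mul_le_mul h1.le (Nat.mul_le_mul h2 (Nat.mul_le_mul hpow h3))
      _ = 2 ^ (17 * M ^ 5 + (M + (M ^ 2 + M))) := by rw [pow_add, pow_add, pow_add]
      _ < _ := Nat.pow_lt_pow_right (by norm_num) (by omega)
  · have h1 : rounds G.n E < 2 ^ (17 * M ^ 5) := Nat.lt_two_pow_of_le hrounds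
    calc 2 * rounds G.n E * D ^ G.n ≤ 2 ^ 1 * 2 ^ (17 * M ^ 5) * 2 ^ M ^ 2 :=
          Nat.mul_le_mul (Nat.mul_le_mul (by norm_num) h1.le) hpow
      _ = 2 ^ (1 + 17 * M ^ 5 + M ^ 2) := by rw [pow_add, pow_add]
      _ < _ := Nat.pow_lt_pow_right (by norm_num) (by omega)

lemma bounded_start (L : List ℕ) : (RProg.start L).Bounded (bitBound L) := by
  have hX : inputSize L ≤ bitBound L := by
    have h1 : inputSize L + accuracy L ≤ (inputSize L + accuracy L) ^ 5 :=
      Nat.le_self_pow (by norm_num) _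
    rw [bitBound]; omega
  refine ⟨fun x => ?_, fun A i => ?_⟩
  · simp only [RProg.start]
    split_ifs
    · exact Nat.lt_two_pow_of_le ((length_le_inputSize L).trans hX)
    · positivity
  · simp only [RProg.start]
    split_ifs
    · exact (Nat.size_le.1 (size_getD_le_inputSize L i)).trans_le
        (Nat.pow_le_pow_right (by norm_num) hX)
    · positivity

/-- A polynomial in the bound is a polynomial in the size of the input and in `1 / ε`. -/
lemma bitBound_poly (c : ℕ) : ∃ c' : ℕ, ∀ (ε : ℚ) (l : List ℕ), 0 < ε →
    ((c * (bitBound (schemeInput ε l) + 1) ^ c : ℕ) : ℚ) ≤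
      c' * (inputSize (schemeInput ε l) + 1 / ε) ^ c' := by
  refine ⟨c * 1312 ^ c + 5 * c, fun ε l hε => ?_⟩
  set L := schemeInput ε l
  set Z : ℚ := inputSize L + 1 / ε with hZ
  have hE : (accuracy L : ℚ) ≤ 1 / ε + 1 := (accuracy_le hε l).2
  have hS : (1 : ℚ) ≤ inputSize L := by
    have h1 : L.length ≤ inputSize L := length_le_inputSize L
    have h2 : 1 ≤ L.length := by
      change 1 ≤ ([ε.num.toNat, ε.den] ++ l).length
      rw [List.length_append]; exact Nat.le_add_right_of_le (by simp)
    exact_mod_cast h2.trans h1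
  have hε0 : 0 < 1 / ε := by positivity
  have hZ1 : 1 ≤ Z := by linarith
  have hX : ((bitBound L + 1 : ℕ) : ℚ) ≤ 1312 * Z ^ 5 := by
    have h1 : (inputSize L + accuracy L : ℚ) ≤ 2 * Z := by linarith
    have h2 : (1 : ℚ) ≤ (2 * Z) ^ 5 := one_le_pow₀ (by linarith)
    calc ((bitBound L + 1 : ℕ) : ℚ) = 40 * (inputSize L + accuracy L : ℚ) ^ 5 + 1 := by
          rw [bitBound]; push_cast; rfl
      _ ≤ 40 * (2 * Z) ^ 5 + (2 * Z) ^ 5 := by gcongr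
      _ = _ := by ring
  calc ((c * (bitBound L + 1) ^ c : ℕ) : ℚ) = c * ((bitBound L + 1 : ℕ) : ℚ) ^ c := by push_cast; rfl
    _ ≤ c * (1312 * Z ^ 5) ^ c := by gcongr
    _ = ((c * 1312 ^ c : ℕ) : ℚ) * Z ^ (5 * c) := by push_cast; rw [mul_pow, ← pow_mul]; ring
    _ ≤ _ := by
      refine mul_le_mul ?_ (pow_le_pow_right₀ hZ1 (by omega)) (by positivity) (by positivity)
      exact_mod_cast Nat.le_add_right _ _

/-! ### The three schemes -/

/-- Set the position of the encoding of the model, the first time of the window, the positions of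
the excluded vertices, and the number of edges to be added; then run the scheme. -/
def schemeProg (base t₀ i j m : ℕ) : RProg :=
  seq (seq (assign v_base (.const base)) <| seq (assign v_start (.const t₀)) <|
  seq (assign v_uex (.get a_in (.const i))) <| seq (assign v_vex (.get a_in (.const j)))
    (assign v_add (.const m))) mainProg

lemma sat_schemeProg {ω : ℕ → Bool} {t₀ i j m : ℕ} (ht : t₀ ≤ 2) (hm : m ≤ 1)
    (hL : ∀ x ∈ G.encode, x ∈ L) (henc : ∀ i, L.getD (base + i) 0 = G.encode.getD i 0)
    (hlen : base + G.offset G.n = L.length) :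
    Sat ω (bitBound L) (schemeProg base t₀ i j m) (start L) fun s' =>
      s'.var v_len = outputNum ω (instanceOf G L t₀ (L.getD i 0) (L.getD j 0) hL) (accuracy L) m ∧
      s'.var v_out = 2 * rounds G.n (accuracy L) * entryProd L ^ G.n := by
  have hR := room henc hlen
  have hs := bounded_start L
  have h2 : 2 < 2 ^ bitBound L := Nat.lt_two_pow_of_le (by have := hR.field; omega)
  have harr : ∀ i, (start L).arr a_in i = L.getD i 0 := fun i => rfl
  refine Sat.seq (R := Ready L base t₀ (L.getD i 0) (L.getD j 0) m) ?_ fun s _ _ hs => ?_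
  · refine Sat.assign_seq base rfl (by have := hR.offset; omega) ?_
    refine Sat.assign_seq t₀ rfl (by omega) ?_
    refine Sat.assign_seq (L.getD i 0) rfl (hs.arr a_in i) ?_
    refine Sat.assign_seq (L.getD j 0) rfl (hs.arr a_in j) ?_
    refine Sat.assign_of_eq m rfl (by omega) ?_
    refine ⟨harr, ?_, rfl, ?_, ?_, ?_, ?_, ?_⟩ <;> simp [start]
  · exact sat_mainProg hs hm hL henc hR

/-- The scheme approximates every function which, up to the scaling factor and up to `m`, is the
weighted optimum of an instance of the estimator. -/
lemma hasFPRAS_of_weightedOpt {ι : Type} {enc : ι → List ℕ} {f : ι → ℚ} (model : ι → ADModel)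
    (pre : ι → List ℕ) (k t₀ i j m : ℕ) (ht : t₀ ≤ 2) (hm : m ≤ 1)
    (henc : ∀ Y, enc Y = pre Y ++ (model Y).encode) (hpre : ∀ Y, (pre Y).length = k)
    (hf : ∀ Y (ε : ℚ) (hL : ∀ x ∈ (model Y).encode, x ∈ schemeInput ε (enc Y)),
      (instanceOf (model Y) (schemeInput ε (enc Y)) t₀ ((schemeInput ε (enc Y)).getD i 0)
        ((schemeInput ε (enc Y)).getD j 0) hL).weightedOpt +
        m * entryProd (schemeInput ε (enc Y)) ^ (model Y).n =
      entryProd (schemeInput ε (enc Y)) ^ (model Y).n * f Y) : HasFPRAS enc f := by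
  obtain ⟨c₀, hc₀⟩ := exists_timeBound_le (schemeProg (2 + k) t₀ i j m)
  obtain ⟨c, hc⟩ := bitBound_poly c₀
  refine ⟨schemeProg (2 + k) t₀ i j m, c, fun Y ε hε => ?_⟩
  set L := schemeInput ε (enc Y) with hLdef
  have hL : ∀ x ∈ (model Y).encode, x ∈ L := fun x hx => by
    rw [hLdef, schemeInput, henc]; simp [hx]
  have hget : ∀ i, L.getD (2 + k + i) 0 = (model Y).encode.getD i 0 := fun i => by
    rw [hLdef, schemeInput, henc, ← List.append_assoc,
      List.getD_append_right _ _ _ _ (by simp [hpre]; omega)]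
    congr 1
    simp [hpre]; omega
  have hlen : 2 + k + (model Y).offset (model Y).n = L.length := by
    rw [hLdef, schemeInput, henc, ← ADModel.length_encode]
    simp [hpre]; ring
  have hrun := fun ω => sat_schemeProg (ω := ω) (i := i) (j := j) ht hm hL hget hlen
    (bounded_start L)
  constructor
  · intro ω
    obtain ⟨s, t, h1, h2, -⟩ := hrun ω
    refine ⟨s, t, h1, le_trans ?_ (hc ε (enc Y) hε)⟩
    exact_mod_cast h2.trans (hc₀ _)
  set C := instanceOf (model Y) L t₀ (L.getD i 0) (L.getD j 0) hL with hC
  have hacc : (1 : ℝ) ≤ (ε : ℝ) * accuracy L := by exact_mod_cast (accuracy_le hε (enc Y)).1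
  refine (C.sample_estimate hacc rfl).trans
    (MeasureTheory.measure_mono fun ω hω => ?_)
  obtain ⟨s, t, h1, -, -, -, h2, h3⟩ := hrun ω
  set N := rounds (model Y).n (accuracy L) with hN
  set P : ℚ := (entryProd L : ℚ) ^ (model Y).n with hP
  set T := ∑ j ∈ Finset.range N, C.sample (blockNum ω (j * digits C.n (accuracy L) C.D)
    (digits C.n (accuracy L) C.D)) with hT
  have hf' : C.weightedOpt + m * P = P * f Y := hf Y ε hL
  have hP0 : 0 < P := pow_pos (by exact_mod_cast entryProd_pos L) _
  have hN0 : (0 : ℚ) < N := by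
    have : 0 < N := Nat.succ_pos _
    exact_mod_cast this
  have hω' : |(T : ℚ) - N * (2 * C.weightedOpt)| ≤ ε * (N * (2 * C.weightedOpt)) := by
    have h4 : |(T : ℝ) - N * (2 * C.weightedOpt)| ≤ ε * (N * (2 * C.weightedOpt)) := hω
    exact_mod_cast h4
  have hden : (s.var v_out : ℚ) = 2 * N * P := by rw [h3]; push_cast; rfl
  have hnum : (s.var v_len : ℚ) = T + m * (2 * N * P) := by
    rw [h2, outputNum, Nat.cast_add, Nat.cast_mul]
    congr 2
    exact hden ▸ congrArg Nat.cast h3.symm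
  have hden0 : (0 : ℚ) < 2 * N * P := by positivity
  have hfN : 2 * N * P * f Y = N * (2 * C.weightedOpt) + m * (2 * N * P) := by
    linear_combination (-2 * (N : ℚ)) * hf'
  have hm0 : 0 ≤ ε * (m * (2 * N * P)) := by positivity
  rw [abs_le] at hω'
  refine ⟨s, t, h1, ?_, ?_, ?_⟩
  · intro h0
    rw [h0, Nat.cast_zero] at hden
    exact hden0.ne hden
  · rw [hnum, hden, le_div_iff₀ hden0]
    nlinarith [hω'.1]
  · rw [hnum, hden, div_le_iff₀ hden0]
    nlinarith [hω'.2]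

end Sampler

theorem mainTheorem2 :
    HasFPRAS ADModel.encode ADModel.opt ∧
      HasFPRAS ADModelWithEdge.encode ADModelWithEdge.opt ∧
      HasFPRAS ADModel.encode ADModel.optGivenNone := by
  -- the third entry of the input is the number of vertices, so that excluding it excludes no vertex
  have hn : ∀ (G : ADModel) (ε : ℚ), (schemeInput ε G.encode).getD 2 0 = G.n := fun G ε =>
    ADModel.getD_encode_n
  refine ⟨?_, ?_, ?_⟩
  · refine Sampler.hasFPRAS_of_weightedOpt (fun G => G) (fun _ => []) 0 1 2 2 0 (by norm_num)
      (by norm_num) (fun _ => rfl) (fun _ => rfl) fun G ε hL => ?_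
    rw [Nat.cast_zero, zero_mul, add_zero]
    exact ADModel.weightedOpt_eq_opt (hn G ε).ge (hn G ε).ge
  · -- the third and the fourth entry of the input are the endpoints of the edge
    refine Sampler.hasFPRAS_of_weightedOpt (fun Y => Y.model) (fun Y => [(Y.u : ℕ), (Y.v : ℕ)])
      2 1 2 3 1 (by norm_num) le_rfl (fun _ => rfl) (fun _ => rfl) fun Y ε hL => ?_
    rw [Nat.cast_one, one_mul]
    exact ADModel.weightedOpt_eq_optGivenEdge Y.adj Y.a_u Y.a_v
  · refine Sampler.hasFPRAS_of_weightedOpt (fun G => G) (fun _ => []) 0 2 2 2 0 le_rfl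
      (by norm_num) (fun _ => rfl) (fun _ => rfl) fun G ε hL => ?_
    rw [Nat.cast_zero, zero_mul, add_zero]
    exact ADModel.weightedOpt_eq_optGivenNone (hn G ε).ge (hn G ε).ge
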